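/- **Setting.** Let $X$ be a smooth projective geometrically connected curve of genus $g$ over the field $\mathbb F_q$ with $q$ elements, with function field $\mathbb F_q(X)$. Let $W$ be an algebraically closed field containing an algebraic closure of $\mathbb F_q$, and let $\overline X=X_W$ be the base change of $X$ to $W$; its closed points are the $W$-valued points of $X$. The base change to $\overline X$ of a divisor of $X$ is denoted by the same letter. For $\xi\in\overline X$ let $\mathbb F_q(\xi)\subset W$ be the field generated over $\mathbb F_q$ by the coordinates of $\xi$; the point $\xi$ is *generic* if $\mathbb F_q(\xi)$ is isomorphic to $\mathbb F_q(X)$. In that case every $f\in\mathbb F_q(X)$ has a value $f|_\xi\in W$. For $n\in\mathbb Z$, $\xi^{(n)}$ is the point obtained from $\xi$ by applying the $q^n$-th power automorphism of $W$; extend $\xi\mapsto\xi^{(n)}$ additively to divisors of $\overline X$, and let $f\mapsto f^{(n)}$ be the automorphism of the function field of $\overline X$ which is the $q^n$-th power map on $W$ and the identity on $\mathbb F_q(X)$. Let $D$ be a nonzero effective divisor of $X$. For divisors $E_1,E_2$ of $\overline X$ supported away from $D$, write $E_1\sim_D E_2$ if $E_1-E_2=(f)$ for a nonzero meromorphic function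 $f$ on $\overline X$ which is regular near $D$ and has restriction $1$ to the subscheme $D$. **Shtukas.** A quadruple $(D,\xi,\eta,E)$ is a *shtuka* if $D$ is a nonzero effective divisor of $X$, $\xi,\eta\in\overline X\setminus\operatorname{supp}D$, $E$ is a divisor of $\overline X$ supported away from $D$, $E-E^{(1)}\sim_D-\xi^{(1)}+\eta$, and $\deg E=g-1$. It is *nondegenerate* if $\eta\ne\xi^{(i)}$ for every integer $i$ with $1-\deg(E+D)\le i\le g$. Let $\Psi$ be the set of $\psi\in H^0(\overline X,\mathcal O_{\overline X}(E+D))$ such that $\psi-\psi^{(1)}$ is regular in a neighborhood of $D$. **Catalan–Drinfeld symbol.** If every $\alpha\in H^0(X,\mathcal O_X(D)/\mathcal O_X)$ has a unique lifting $\psi_\alpha\in\Psi$ (that is, $\psi_\alpha$ has image $\alpha$ in $H^0(\mathcal O_{\overline X}(D)/\mathcal O_{\overline X})$), and if $\psi_\alpha/\psi_\beta$ is regular and nonzero at $\xi$ for all nonzero $\alpha,\beta$, we say that the symbol of $(D,\xi,\eta,E)$ is well defined; its values are $$\begin{bmatrix}D&\xi&\eta&E\\&\alpha&\beta&\end{bmatrix}=(\psi_\alpha/\psi_\beta)(\xi)\in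 W^\times .$$ **Hypergeometric ratio.** For a divisor $E_0$ of $X$ supported away from $D$ with $\deg E_0>2g-2$ and nonzero $\alpha,\beta\in H^0(X,\mathcal O_X(D)/\mathcal O_X)$ put $$\operatorname{Hyp}_D(\alpha,\beta,E_0)=\prod_{e\in H^0(X,\mathcal O_X(E_0))}\frac{\tilde\alpha+e}{\tilde\beta+e}\in\mathbb F_q(X)^\times,$$ where $\tilde\alpha,\tilde\beta\in H^0(X,\mathcal O_X(E_0+D))$ are liftings of $\alpha,\beta$; these exist, and the product does not depend on their choice. **Proposition 5.3.** Let $\xi\in\overline X$ be a generic point, let $N>g$ be an integer, and let $(D,\xi,\xi^{(N)},E)$ be a shtuka. Then: 1. $(D,\xi,\xi^{(N)},E)$ is nondegenerate, and its Catalan–Drinfeld symbol is well defined. 2. There exists a divisor $E_0$ of $X$ supported away from $D$ such that $E\sim_D E_0-(\xi^{(1)}+\cdots+\xi^{(N-1)})$. 3. For every $E_0$ as in 2, $\deg E_0>2g-2$, so that $\operatorname{Hyp}_D(\alpha,\beta,E_0)$ is defined, and for all nonzero $\alpha,\beta\in H^0(X,\mathcal O_X(D)/\mathcal O_X)$ $$\begin{bmatrix}D&\xi&\xi^{(N)}&E\\&\alpha&\beta&\end{bmatrix}=\operatorname{Hyp}_D(\alpha,\beta,E_0)|_\xi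 .$$ -/

import Mathlib

open scoped TensorProduct

noncomputable section

namespace RankOneShtuka

/-! Curves through their function fields: a smooth projective geometrically connected curve over a
perfect field is given by its function field, its closed points are the discrete valuation rings of
the function field which contain the constants. -/

/-- `K` is the function field of a smooth projective geometrically connected curve over `k`: it is
finite over `k(x)` for some transcendental `x`, and `k` is algebraically closed in `K`
(used for finite, hence perfect, fields `k`). -/
class IsCurveFunctionField (k K : Type*) [Field k] [Field K] [Algebra k K] : Prop where
  exists_finite : ∃ x : K, Transcendental k x ∧ FiniteDimensional (IntermediateField.adjoin k {x}) K
  algebraicClosure_eq_bot : algebraicClosure k K = ⊥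

/-- A closed point of the curve over `F` with function field `K`, given by its local ring. -/
@[ext]
structure Place (F K : Type*) [Field F] [Field K] [Algebra F K] where
  /-- the local ring of the point -/
  O : ValuationSubring K
  algebraMap_mem : ∀ c : F, algebraMap F K c ∈ O
  dvr : IsDiscreteValuationRing O

namespace Place

variable {F K : Type*} [Field F] [Field K] [Algebra F K]

instance (P : Place F K) : IsDiscreteValuationRing P.O := P.dvr

instance (P : Place F K) : Algebra F P.O :=
  ((algebraMap F K).codRestrict P.O P.algebraMap_mem).toAlgebra

/-- The normalized multiplicative valuation at `P`: for `f ≠ 0` one has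
`P.val f = exp (- ord_P f)`. -/
def val (P : Place F K) : Valuation K (WithZero (Multiplicative ℤ)) :=
  (IsDiscreteValuationRing.maximalIdeal P.O).valuation K

/-- The order of vanishing of `f` at `P` (with the value `0` for `f = 0`). -/
def ord (P : Place F K) (f : K) : ℤ := -WithZero.log (P.val f)

/-- The degree of the residue field of `P` over the constants. -/
def degree (P : Place F K) : ℕ := Module.finrank F (IsLocalRing.ResidueField P.O)

theorem val_algebraMap_le_one (P : Place F K) (c : F) : P.val (algebraMap F K c) ≤ 1 :=
  IsDedekindDomain.HeightOneSpectrum.valuation_le_one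
    (IsDiscreteValuationRing.maximalIdeal P.O) (⟨_, P.algebraMap_mem c⟩ : P.O)

/-- The functions whose pole at `P` has order at most `n`, that is, the stalk at `P` of `O(n P)`. -/
def stalk (P : Place F K) (n : ℤ) : Submodule F K where
  carrier := {f | P.val f ≤ WithZero.exp n}
  zero_mem' := by simp
  add_mem' ha hb := P.val.map_add_le ha hb
  smul_mem' c f hf := by
    simp only [Set.mem_ofPred_eq, Algebra.smul_def, map_mul] at hf ⊢
    exact (mul_le_mul' (P.val_algebraMap_le_one c) hf).trans (one_mul _).le

/-- The value at `P` of a function `f` which is regular at `P`, for a point `P` whose residue field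
consists of the constants: the constant `c` such that `f - c` vanishes at `P`. -/
def eval (P : Place F K) (f : K) : F := by
  classical
  exact if h : ∃ c : F, P.val (f - algebraMap F K c) < 1 then h.choose else 0

end Place

/-- Divisors. -/
abbrev Divisor (F K : Type*) [Field F] [Field K] [Algebra F K] := Place F K →₀ ℤ

section Curve

variable {F K : Type*} [Field F] [Field K] [Algebra F K]

/-- The degree of a divisor. -/
def Divisor.deg (E : Divisor F K) : ℤ := E.sum fun P n => n * (P.degree : ℤ)

/-- The support of `E` is disjoint from the support of `D`. -/
def Divisor.SupportedAway (E D : Divisor F K) : Prop := Disjoint E.support D.support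

/-- The Riemann-Roch space `H⁰(O(E))`: functions `f` with `f = 0` or `(f) + E ≥ 0`. -/
def H0 (E : Divisor F K) : Submodule F K := ⨅ P : Place F K, P.stalk (E P)

variable (F K) in
/-- The repartitions of `K`: families of functions, indexed by the closed points, such that almost
every member is regular at its point. -/
def Repartitions : Submodule F (Place F K → K) where
  carrier := {r | {P | r P ∉ P.stalk 0}.Finite}
  zero_mem' := by simp
  add_mem' {x y} hx hy := (Set.Finite.union hx hy).subset fun P hP => by
    by_contra h
    simp only [Set.mem_union, not_or] at h
    exact hP ((P.stalk 0).add_mem (not_not.mp h.1) (not_not.mp h.2))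
  smul_mem' c x hx := Set.Finite.subset hx fun P hP h => hP ((P.stalk 0).smul_mem c h)

variable (F K) in
/-- `H¹(O)`, as the cokernel of `K → ⨁_P K / O_P`, the map on global sections of the flasque
resolution of the structure sheaf by the constant sheaf `K` and the sum of the skyscraper sheaves
`K / O_P`. It is written as the quotient of the repartitions by the sum of the everywhere
regular repartitions and of the constant families `(f)_P` with `f` in `K`. -/
abbrev H1 := Repartitions F K ⧸
  (Submodule.pi Set.univ (fun P : Place F K => P.stalk 0) ⊔
    LinearMap.range (LinearMap.pi fun _ : Place F K => (LinearMap.id : K →ₗ[F] K))).comap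
      (Repartitions F K).subtype

/-- The genus, the dimension of `H¹(O)`. -/
def genus (F K : Type*) [Field F] [Field K] [Algebra F K] : ℕ := Module.finrank F (H1 F K)

/-- `H⁰(O(D) / O)` for an effective divisor `D`, as the product of the stalks
`O(D)_P / O_P ⊆ K / O_P` (which vanish for `P` outside the support of `D`). -/
def PrincipalParts (D : Divisor F K) : Submodule F (Π P : Place F K, K ⧸ P.stalk 0) :=
  Submodule.pi Set.univ fun P => (P.stalk (D P)).map (P.stalk 0).mkQ

/-- `f|_D ≡ 1`, for an effective divisor `D`. -/
def IsOneOn (D : Divisor F K) (f : K) : Prop :=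
  ∀ P ∈ D.support, P.val (f - 1) ≤ WithZero.exp (-(D P))

/-- `E₁ ∼_D E₂`: the divisor `E₁ - E₂` is principal to the conductor `D`. -/
def EquivOn (D E₁ E₂ : Divisor F K) : Prop :=
  ∃ f : K, f ≠ 0 ∧ IsOneOn D f ∧ ∀ P : Place F K, E₁ P - E₂ P = P.ord f

/-! ### Hypergeometric ratios (high degree case) -/

/-- `a ∈ H⁰(O(E + D))` is a lifting of `α ∈ H⁰(O(D) / O)`; here `E` is supported away from `D`. -/
def IsLift (D E : Divisor F K) (α : PrincipalParts D) (a : K) : Prop :=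
  a ∈ H0 (E + D) ∧ ∀ P ∈ D.support, (P.stalk 0).mkQ a = α.1 P

open Classical in
/-- `Hyp_D(α, β, E) = ∏_{e ∈ H⁰(O(E))} (a + e) / (b + e)` for liftings `a`, `b` of `α`, `β`.
Such liftings exist if `deg E > 2 g - 2`, and the result does not depend on them. -/
def Hyp (D : Divisor F K) (α β : PrincipalParts D) (E : Divisor F K) : K :=
  if h : (∃ a, IsLift D E α a) ∧ (∃ b, IsLift D E β b) then
    ∏ᶠ e : H0 E, (h.1.choose + e) / (h.2.choose + e)
  else 0

end Curve

/-! ### The base change to an algebraically closed field `W`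

The function field of the base change is a fraction field `L` of `W ⊗[k] K`, and the points of the
base change, that is the `W`-valued points of the curve, are the places of `L` over `W`. -/

section Frobenius

variable (k W : Type*) [Field k] [Fintype k] [Field W] [Algebra k W] [IsAlgClosed W]

/-- The `q`-th power automorphism of `W`, where `q` is the number of elements of `k`. -/
def frob : W ≃ₐ[k] W :=
  AlgEquiv.ofBijective (FiniteField.frobeniusAlgHom k W)
    ⟨(FiniteField.frobeniusAlgHom k W).toRingHom.injective, fun y => by
      obtain ⟨x, hx⟩ := IsAlgClosed.exists_pow_nat_eq y (Fintype.card_pos (α := k))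
      exact ⟨x, hx⟩⟩

end Frobenius

section BaseChange

variable {k K W L : Type*} [Field k] [Field K] [Algebra k K] [Field W] [Algebra k W]
  [Field L] [Algebra W L] [Algebra (W ⊗[k] K) L]

variable (k K W L) in
/-- The inclusion of the function field of the curve in that of its base change. -/
def incl : K →+* L :=
  (algebraMap (W ⊗[k] K) L).comp
    (Algebra.TensorProduct.includeRight : K →ₐ[k] W ⊗[k] K).toRingHom

/-- The point `Q` of the base change lies over the closed point `P`. -/
def Place.LiesOver (Q : Place W L) (P : Place k K) : Prop := Q.O.comap (incl k K W L) = P.O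

variable (W L) in
/-- The base change of a divisor: a closed point becomes the sum of the (finitely many) points
lying over it, each with multiplicity one as `k` is perfect. -/
def Divisor.baseChange (D : Divisor k K) : Divisor W L :=
  D.sum fun P n => ∑ᶠ Q ∈ {Q : Place W L | Q.LiesOver P}, Finsupp.single Q n

variable (k K) in
/-- The subfield `k(ξ)` of `W` generated by the coordinates of the point `ξ`, that is, by the values
at `ξ` of the functions on the curve which are regular at `ξ`. -/
def coordField (ξ : Place W L) : IntermediateField k W :=
  IntermediateField.adjoin k
    {c | ∃ f : K, ξ.val (incl k K W L f - algebraMap W L c) < 1}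

variable (k K) in
/-- The point `ξ` is generic: `k(ξ)` is an isomorphic copy of the function field `K`. -/
def IsGeneric (ξ : Place W L) : Prop := Nonempty (coordField k K ξ ≃ₐ[k] K)

variable [Fintype k] [IsAlgClosed W] [IsFractionRing (W ⊗[k] K) L]

variable (k K W L) in
/-- `n`-fold twisting `f ↦ f⁽ⁿ⁾`: the automorphism of `L` which is the `qⁿ`-th power
automorphism on `W` and the identity on `K`. -/
def twistFun (n : ℤ) : L ≃+* L :=
  IsFractionRing.ringEquivOfRingEquiv
    (Algebra.TensorProduct.congr (frob k W ^ n) (AlgEquiv.refl : K ≃ₐ[k] K)).toRingEquiv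

variable [IsScalarTower W (W ⊗[k] K) L]

theorem twistFun_algebraMap (n : ℤ) (c : W) :
    twistFun k K W L n (algebraMap W L c) = algebraMap W L ((frob k W ^ n) c) := by
  simp [twistFun, IsScalarTower.algebraMap_apply W (W ⊗[k] K) L,
    Algebra.TensorProduct.algebraMap_apply]

theorem twistFun_symm_algebraMap (n : ℤ) (c : W) :
    (twistFun k K W L n).symm (algebraMap W L c) =
      algebraMap W L ((frob k W ^ n).symm c) := by
  rw [RingEquiv.symm_apply_eq, twistFun_algebraMap, AlgEquiv.apply_symm_apply]

variable (k K) in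
/-- `n`-fold twisting of points `ξ ↦ ξ⁽ⁿ⁾`: the `qⁿ`-th power automorphism of `W` is applied to the
coordinates of `ξ`. The local ring of `ξ⁽ⁿ⁾` is the image of that of `ξ` under `f ↦ f⁽ⁿ⁾`,
so that `f⁽ⁿ⁾` has at `ξ⁽ⁿ⁾` the `qⁿ`-th power of the value of `f` at `ξ`. -/
def twist (n : ℤ) (ξ : Place W L) : Place W L where
  O := ξ.O.comap ((twistFun k K W L n).symm : L →+* L)
  algebraMap_mem c := by
    rw [ValuationSubring.mem_comap, RingEquiv.coe_toRingHom, twistFun_symm_algebraMap]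
    exact ξ.algebraMap_mem _
  dvr := IsDiscreteValuationRing.RingEquivClass.isDiscreteValuationRing (A := ξ.O)
    ({ toFun := fun x => ⟨twistFun k K W L n x, by
          rw [ValuationSubring.mem_comap, RingEquiv.coe_toRingHom, RingEquiv.symm_apply_apply]
          exact x.2⟩
       invFun := fun x => ⟨(twistFun k K W L n).symm x, x.2⟩
       left_inv := fun x => Subtype.ext ((twistFun k K W L n).symm_apply_apply x)
       right_inv := fun x => Subtype.ext ((twistFun k K W L n).apply_symm_apply x)
       map_mul' := fun x y => Subtype.ext (map_mul (twistFun k K W L n) (x : L) y)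
       map_add' := fun x y => Subtype.ext (map_add (twistFun k K W L n) (x : L) y) } :
      ξ.O ≃+* (ξ.O.comap ((twistFun k K W L n).symm : L →+* L)))

variable (k K) in
/-- Twisting of divisors, the additive extension of the twisting of points. -/
def twistDiv (n : ℤ) (E : Divisor W L) : Divisor W L := E.mapDomain (twist k K n)

/-! ### Shtukas -/

/-- `(D, ξ, η, E)` is a shtuka. -/
structure IsShtuka (D : Divisor k K) (ξ η : Place W L) (E : Divisor W L) : Prop where
  effective : 0 ≤ D
  ne_zero : D ≠ 0
  basepoint_notMem : ξ ∉ (D.baseChange W L).support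
  zero_notMem : η ∉ (D.baseChange W L).support
  supportedAway : E.SupportedAway (D.baseChange W L)
  equivOn : EquivOn (D.baseChange W L) (E - twistDiv k K 1 E)
    (Finsupp.single η 1 - Finsupp.single (twist k K 1 ξ) 1)
  deg_eq : E.deg = (genus k K : ℤ) - 1

/-- The shtuka `(D, ξ, η, E)` is nondegenerate. -/
def IsNondegenerate (D : Divisor k K) (ξ η : Place W L) (E : Divisor W L) : Prop :=
  ∀ i : ℤ, 1 - (E + D.baseChange W L).deg ≤ i → i ≤ (genus k K : ℤ) → η ≠ twist k K i ξ

/-- The set `Ψ` attached to a shtuka with conductor `D` and divisor `E`: the functions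
`ψ ∈ H⁰(O(E + D))` such that `ψ - ψ⁽¹⁾` is regular in a neighborhood of `D`. -/
def Psi (D : Divisor k K) (E : Divisor W L) : Set L :=
  {ψ | ψ ∈ H0 (E + D.baseChange W L) ∧
    ∀ Q ∈ (D.baseChange W L).support, Q.val (ψ - twistFun k K W L 1 ψ) ≤ 1}

/-- `ψ ∈ Ψ` is a lifting of `α ∈ H⁰(O(D) / O)`: at every point `Q` over a point `P` of `D`, the
difference of `ψ` and of a function which represents `α` at `P` is regular. -/
def IsPsiLift (D : Divisor k K) (E : Divisor W L) (α : PrincipalParts D) (ψ : L) : Prop :=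
  ψ ∈ Psi D E ∧ ∀ P ∈ D.support, ∀ Q : Place W L, Q.LiesOver P →
    ∀ a : K, (P.stalk 0).mkQ a = α.1 P → Q.val (ψ - incl k K W L a) ≤ 1

open Classical in
/-- The lifting `ψ_α ∈ Ψ` of `α`, which exists and is unique for a nondegenerate shtuka. -/
def psi (D : Divisor k K) (E : Divisor W L) (α : PrincipalParts D) : L :=
  if h : ∃ ψ, IsPsiLift D E α ψ then h.choose else 0

/-- The Catalan-Drinfeld symbol with upper row `D, ξ, η, E` and lower row `α, β`: the value at `ξ`
of `ψ_α / ψ_β`. The value of the symbol does not involve `η`, which is fixed by the shtuka. -/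
def catalanDrinfeld (D : Divisor k K) (ξ _η : Place W L) (E : Divisor W L)
    (α β : PrincipalParts D) : W :=
  ξ.eval (psi D E α / psi D E β)

/-- The Catalan-Drinfeld symbol of `(D, ξ, η, E)` is well defined: every `α` has exactly one lifting
`ψ_α ∈ Ψ`, and `ψ_α / ψ_β` is regular and nonzero at `ξ` for nonzero `α` and `β`. -/
def SymbolWellDefined (D : Divisor k K) (ξ : Place W L) (E : Divisor W L) : Prop :=
  (∀ α : PrincipalParts D, ∃! ψ, IsPsiLift D E α ψ) ∧
    ∀ α β : PrincipalParts D, α ≠ 0 → β ≠ 0 → ξ.val (psi D E α / psi D E β) = 1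

end BaseChange

end RankOneShtuka

end

/-!
Write `n = N - 1`, let `S = ξ⁽¹⁾ + ⋯ + ξ⁽ⁿ⁾` be the sum of the first `n` twists of the generic
point `ξ`, and let bars denote base change.

Descent of the divisor. The shtuka condition says that `E + S` is equivalent, to the conductor `D`,
to its own twist, by a function `u`. A function `h` with `h⁽¹⁾ = u h` and `h|_D = 1` turns `E + S`
into a divisor which is invariant under the twist, and such a divisor is the base change of a
divisor `E₀` on the curve over `k` (`exists_baseChange_equivOn`, `exists_baseChange_eq`). The
function `h` is a fixed vector of a Frobenius-semilinear operator: a function which is `1` on `D`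
is corrected by Lang's theorem (`span_fixed_eq_top`) for the finite dimensional space of the
sections which vanish on `D`. Degrees give `deg E₀ = g - 1 + n > 2 g - 2`, so that `n = h⁰(O(E₀))`.

The symbol. If `(f) = E - Ē₀ + S` with `f|_D = 1`, then `ψ ↦ f ψ` identifies the liftings of `α` in
`Ψ` with the functions `a + e` which vanish at `ξ⁽¹⁾, …, ξ⁽ⁿ⁾`, where `a` is a lifting of `α` with
poles bounded by `E₀ + D` and `e` is a section of `O(Ē₀)` (`isPsiLift_iff`). These sections are the
`W`-combinations of the elements of `H⁰(O(E₀))`, the value of `b ∈ K` at `ξ⁽ⁱ⁾` is `b(ξ) ^ (q ^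
i)`, and `ξ` has distinct twists, so that the vanishing conditions form an invertible Moore system
of size `n`. The polynomial `∏ (x - v)`, over the values `v` at `ξ` of all elements of `H⁰(O(E₀))`,
is a linearized polynomial `∑ cᵢ x ^ (q ^ i)` with `c₀ ≠ 0` (`exists_linearized_eq_prod`), and its
combination of the values of `f ψ` at `ξ, ξ⁽¹⁾, …, ξ⁽ⁿ⁾` shows that `c₀ (f ψ)(ξ) = ∏ (a(ξ) - v)`
(`existsUnique_section`). This does not vanish for `α ≠ 0`, and the quotient of two such products
is the value of the hypergeometric ratio (`symbol_of_equivOn`).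

Foundations. For a function field of one variable with its closed points, the degree formula for
principal divisors, the finiteness of `H¹(O)`, the Riemann-Roch formula, and the vanishing of
`H¹(O(E))` for `deg E > 2 g - 2` are proved without duality (`deg_div`, `h0_sub_h1`, `h1_eq_zero`).
They apply to the curve over `k` and, by `isCurveFunctionField_baseChange`, to its base change. By
Lang's theorem, the sections of a divisor which is invariant under the twist are spanned by
functions on the curve over `k`. Applied to divisors of large degree this shows that the base
change is unramified, that the twist permutes the points over a closed point transitively, and that
degrees are preserved (`Place.LiesOver.ord_incl`, `Place.LiesOver.exists_twist_eq`,
`Divisor.deg_baseChange`).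
-/

noncomputable section

namespace RankOneShtuka

/-! ### Orders of vanishing and stalks -/

namespace Place

variable {F K : Type*} [Field F] [Field K] [Algebra F K]

theorem val_le_one_iff (P : Place F K) {f : K} : P.val f ≤ 1 ↔ f ∈ P.O := by
  constructor
  · intro h
    obtain ⟨r, hr⟩ := IsDedekindDomain.HeightOneSpectrum.mem_integers_of_valuation_le_one
      (R := P.O) K f (fun v => by
        have hv : v = IsDiscreteValuationRing.maximalIdeal P.O := by
          ext1
          exact IsLocalRing.eq_maximalIdeal (v.isPrime.isMaximal v.ne_bot)
        rw [hv]; exact h)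
    rw [← hr]; exact r.2
  · intro h
    exact IsDedekindDomain.HeightOneSpectrum.valuation_le_one
      (IsDiscreteValuationRing.maximalIdeal P.O) (⟨_, h⟩ : P.O)

theorem val_lt_one_iff (P : Place F K) {f : K} (hf : f ∈ P.O) :
    P.val f < 1 ↔ (⟨f, hf⟩ : P.O) ∈ IsLocalRing.maximalIdeal P.O :=
  IsDedekindDomain.HeightOneSpectrum.valuation_lt_one_iff_mem
    (IsDiscreteValuationRing.maximalIdeal P.O) (⟨_, hf⟩ : P.O)

theorem exists_uniformizer (P : Place F K) : ∃ π : K, P.val π = WithZero.exp (-1 : ℤ) :=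
  IsDedekindDomain.HeightOneSpectrum.valuation_exists_uniformizer K _

theorem val_ne_zero (P : Place F K) {f : K} (hf : f ≠ 0) : P.val f ≠ 0 :=
  (Valuation.ne_zero_iff _).2 hf

theorem val_eq (P : Place F K) {f : K} (hf : f ≠ 0) : P.val f = WithZero.exp (-P.ord f) := by
  rw [ord, neg_neg, WithZero.exp_log (P.val_ne_zero hf)]

theorem ord_of_val (P : Place F K) {f : K} {n : ℤ} (h : P.val f = WithZero.exp n) :
    P.ord f = -n := by
  rw [ord, h, WithZero.log_exp]

theorem ne_zero_of_val (P : Place F K) {f : K} {n : ℤ} (h : P.val f = WithZero.exp n) :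
    f ≠ 0 := by
  rintro rfl
  rw [map_zero] at h
  exact WithZero.exp_ne_zero h.symm

theorem mem_stalk (P : Place F K) {n : ℤ} {f : K} : f ∈ P.stalk n ↔ P.val f ≤ WithZero.exp n :=
  Iff.rfl

theorem mem_stalk_iff_ord (P : Place F K) {n : ℤ} {f : K} (hf : f ≠ 0) :
    f ∈ P.stalk n ↔ -n ≤ P.ord f := by
  rw [mem_stalk, P.val_eq hf, WithZero.exp_le_exp]
  omega

theorem mem_stalk_zero (P : Place F K) {f : K} : f ∈ P.stalk 0 ↔ f ∈ P.O := by
  rw [mem_stalk, WithZero.exp_zero, val_le_one_iff]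

theorem mem_stalk_neg_one (P : Place F K) {f : K} : f ∈ P.stalk (-1) ↔ P.val f < 1 := by
  by_cases hf : f = 0
  · simp [hf]
  · rw [mem_stalk_iff_ord P hf, P.val_eq hf, ← WithZero.exp_zero, WithZero.exp_lt_exp]
    omega

theorem stalk_mono (P : Place F K) {m n : ℤ} (h : m ≤ n) : P.stalk m ≤ P.stalk n :=
  fun _ hf => hf.trans (WithZero.exp_le_exp.2 h)

theorem mul_mem_stalk (P : Place F K) {m n : ℤ} {f g : K} (hf : f ∈ P.stalk m)
    (hg : g ∈ P.stalk n) : f * g ∈ P.stalk (m + n) := by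
  rw [mem_stalk, map_mul, WithZero.exp_add]
  exact mul_le_mul' hf hg

theorem ord_mul (P : Place F K) {f g : K} (hf : f ≠ 0) (hg : g ≠ 0) :
    P.ord (f * g) = P.ord f + P.ord g := by
  rw [ord, ord, ord, map_mul, WithZero.log_mul (P.val_ne_zero hf) (P.val_ne_zero hg)]
  ring

theorem ord_inv (P : Place F K) (f : K) : P.ord f⁻¹ = -P.ord f := by
  rw [ord, ord, map_inv₀, WithZero.log_inv]

theorem ord_one (P : Place F K) : P.ord (1 : K) = 0 := by
  simp [ord]

theorem ord_zero (P : Place F K) : P.ord (0 : K) = 0 := by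
  simp [ord]

theorem ord_pow (P : Place F K) (f : K) (n : ℕ) : P.ord (f ^ n) = n * P.ord f := by
  simp [ord, WithZero.log_pow]

theorem ord_zpow (P : Place F K) (f : K) (n : ℤ) : P.ord (f ^ n) = n * P.ord f := by
  simp [ord, WithZero.log_zpow]

theorem mul_mem_stalk_iff (P : Place F K) {n : ℤ} {f g : K} (hg : g ≠ 0) :
    g * f ∈ P.stalk n ↔ f ∈ P.stalk (n + P.ord g) := by
  by_cases hf : f = 0
  · simp [hf]
  · rw [mem_stalk_iff_ord P (mul_ne_zero hg hf), mem_stalk_iff_ord P hf, P.ord_mul hg hf]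
    omega

theorem ord_algebraMap (P : Place F K) (c : F) : P.ord (algebraMap F K c) = 0 := by
  by_cases hc : c = 0
  · simp [hc, ord_zero]
  · have h1 : (0 : ℤ) ≤ P.ord (algebraMap F K c) := by
      have := (P.mem_stalk_iff_ord (n := 0) (by simpa using hc)).1
        (P.mem_stalk_zero.2 (P.algebraMap_mem c))
      simpa using this
    have h2 : (0 : ℤ) ≤ P.ord (algebraMap F K c⁻¹) := by
      have := (P.mem_stalk_iff_ord (n := 0) (by simpa using hc)).1
        (P.mem_stalk_zero.2 (P.algebraMap_mem c⁻¹))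
      simpa using this
    rw [map_inv₀, ord_inv] at h2
    omega

theorem val_algebraMap (P : Place F K) {c : F} (hc : c ≠ 0) : P.val (algebraMap F K c) = 1 := by
  rw [P.val_eq (by simpa using hc), ord_algebraMap, neg_zero, WithZero.exp_zero]

theorem ord_eq_of_val_sub_lt (P : Place F K) {f g : K} (h : P.val (f - g) < P.val g) :
    P.ord f = P.ord g := by
  rw [ord, ord, Valuation.map_eq_of_sub_lt _ h]

/-- A closed point is determined by any closed point whose local ring is larger. -/
theorem eq_of_le {P Q : Place F K} (h : P.O ≤ Q.O) : P = Q := by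
  ext1
  refine ValuationSubring.ext _ _ fun f => ⟨fun hf => h hf, fun hf => ?_⟩
  by_contra hfP
  -- otherwise a large power of the pole `f` of `P` absorbs an arbitrary function
  have hf0 : f ≠ 0 := by rintro rfl; exact hfP P.O.zero_mem
  have hneg : P.ord f < 0 := by
    rw [← P.mem_stalk_zero, P.mem_stalk_iff_ord hf0] at hfP
    omega
  obtain ⟨π, hπ⟩ := Q.exists_uniformizer
  have hπ0 := Q.ne_zero_of_val hπ
  obtain ⟨n, hn⟩ : ∃ n : ℕ, P.ord (π⁻¹) + n * (-P.ord f) ≥ 0 := by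
    refine ⟨(P.ord π⁻¹).natAbs, ?_⟩
    have : ((P.ord π⁻¹).natAbs : ℤ) ≥ - P.ord π⁻¹ := by omega
    nlinarith
  have hmem : π⁻¹ * (f⁻¹) ^ n ∈ P.O := by
    rw [← P.mem_stalk_zero, P.mem_stalk_iff_ord
      (mul_ne_zero (inv_ne_zero hπ0) (pow_ne_zero _ (inv_ne_zero hf0))),
      P.ord_mul (inv_ne_zero hπ0) (pow_ne_zero _ (inv_ne_zero hf0)), P.ord_pow, P.ord_inv f]
    simpa using hn
  have hmem2 : π⁻¹ ∈ Q.O := by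
    have := Q.O.mul_mem _ _ (h hmem) (pow_mem hf n)
    rwa [mul_assoc, ← mul_pow, inv_mul_cancel₀ hf0, one_pow, mul_one] at this
  rw [← Q.mem_stalk_zero, Q.mem_stalk_iff_ord (inv_ne_zero hπ0), Q.ord_inv,
    Q.ord_of_val hπ] at hmem2
  omega

/-- The order of vanishing is carried along by isomorphisms of fields. -/
theorem val_of_ringEquiv {F' K' : Type*} [Field F'] [Field K'] [Algebra F' K'] (P : Place F K)
    (Q : Place F' K') (σ : K ≃+* K') (h : ∀ f, f ∈ P.O ↔ σ f ∈ Q.O) (f : K) :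
    Q.val (σ f) = P.val f := by
  have hlt : ∀ f, P.val f < 1 ↔ Q.val (σ f) < 1 := fun f => by
    by_cases hf : f = 0
    · simp [hf]
    · rw [← not_iff_not, not_lt, not_lt, ← inv_le_one₀ (zero_lt_iff.2 (P.val_ne_zero hf)),
        ← map_inv₀, val_le_one_iff, h, ← val_le_one_iff, map_inv₀, map_inv₀,
        inv_le_one₀ (zero_lt_iff.2 (Q.val_ne_zero (by simpa using hf)))]
  have hle : ∀ f, P.val f ≤ 1 ↔ Q.val (σ f) ≤ 1 := fun f => by
    rw [val_le_one_iff, h, val_le_one_iff]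
  obtain ⟨π, hπ⟩ := P.exists_uniformizer
  have hπ0 := P.ne_zero_of_val hπ
  obtain ⟨ρ, hρ⟩ := Q.exists_uniformizer
  have hρ0 := Q.ne_zero_of_val hρ
  have hσπ0 : σ π ≠ 0 := by simpa using hπ0
  have key : Q.ord (σ π) = 1 := by
    have h1 : Q.val (σ π) < 1 := (hlt π).1 (by
      rw [hπ, ← WithZero.exp_zero, WithZero.exp_lt_exp]; norm_num)
    rw [← mem_stalk_neg_one, Q.mem_stalk_iff_ord hσπ0] at h1
    have h2 : P.val (σ.symm ρ) < 1 := by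
      rw [hlt, σ.apply_symm_apply, hρ, ← WithZero.exp_zero, WithZero.exp_lt_exp]; norm_num
    have h20 : σ.symm ρ ≠ 0 := by simpa using hρ0
    rw [← mem_stalk_neg_one, P.mem_stalk_iff_ord h20] at h2
    have h3 : P.val (σ.symm ρ * π⁻¹) ≤ 1 := by
      rw [← WithZero.exp_zero, ← P.mem_stalk,
        P.mem_stalk_iff_ord (mul_ne_zero h20 (inv_ne_zero hπ0)),
        P.ord_mul h20 (inv_ne_zero hπ0), P.ord_inv, P.ord_of_val hπ]
      omega
    rw [hle, map_mul, σ.apply_symm_apply, map_inv₀, ← WithZero.exp_zero, ← Q.mem_stalk,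
      Q.mem_stalk_iff_ord (mul_ne_zero hρ0 (inv_ne_zero hσπ0)),
      Q.ord_mul hρ0 (inv_ne_zero hσπ0), Q.ord_inv, Q.ord_of_val hρ] at h3
    omega
  by_cases hf : f = 0
  · simp [hf]
  have hu0 : f * π ^ (-P.ord f) ≠ 0 := mul_ne_zero hf (zpow_ne_zero _ hπ0)
  have hu : P.val (f * π ^ (-P.ord f)) = 1 := by
    rw [P.val_eq hu0, P.ord_mul hf (zpow_ne_zero _ hπ0), P.ord_zpow, P.ord_of_val hπ]
    simp
  have hu' : Q.val (σ (f * π ^ (-P.ord f))) = 1 :=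
    le_antisymm ((hle _).1 hu.le) (not_lt.1 fun h => hu.not_lt ((hlt _).2 h))
  have hσf : σ f ≠ 0 := by simpa using hf
  have : Q.ord (σ (f * π ^ (-P.ord f))) = 0 := by
    rw [ord, hu', WithZero.log_one, neg_zero]
  rw [map_mul, map_zpow₀, Q.ord_mul hσf (zpow_ne_zero _ hσπ0), Q.ord_zpow, key] at this
  rw [Q.val_eq hσf, P.val_eq hf]
  congr 1
  omega

theorem exists_ord_eq (P : Place F K) (n : ℤ) : ∃ f : K, f ≠ 0 ∧ P.ord f = n := by
  obtain ⟨π, hπ⟩ := P.exists_uniformizer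
  refine ⟨π ^ n, zpow_ne_zero _ (P.ne_zero_of_val hπ), ?_⟩
  rw [P.ord_zpow, P.ord_of_val hπ]
  ring

end Place

/-! ### Function fields of one variable: closed points and residue degrees -/

section FunctionField

open scoped IntermediateField.algebraAdjoinAdjoin

variable {F K : Type*} [Field F] [Field K] [Algebra F K]

/-- The field `K` is finite over `F(y)` for every transcendental `y`. -/
theorem IsCurveFunctionField.finiteDimensional_adjoin [IsCurveFunctionField F K] {y : K}
    (hy : Transcendental F y) : FiniteDimensional (IntermediateField.adjoin F {y}) K := by
  obtain ⟨x, hx, hfin⟩ := IsCurveFunctionField.exists_finite (k := F) (K := K)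
  have hess : Algebra.EssFiniteType F K := by
    have h1 : Algebra.EssFiniteType F (IntermediateField.adjoin F {x}) :=
      IntermediateField.essFiniteType_iff.2 ⟨{x}, by simp⟩
    exact Algebra.EssFiniteType.comp F (IntermediateField.adjoin F {x}) K
  have hbx : IsTranscendenceBasis F (fun _ : Unit => x) := by
    rw [isTranscendenceBasis_iff_algebraicIndependent_isAlgebraic]
    refine ⟨algebraicIndependent_unique_type_iff.2 hx, ?_⟩
    rw [Set.range_const]
    have : Algebra.IsAlgebraic (IntermediateField.adjoin F {x}) K := inferInstance
    exact (IsFractionRing.comap_isAlgebraic_iff (A := Algebra.adjoin F {x})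
      (K := IntermediateField.adjoin F {x}) (C := K)).2 this
  have hby : IsTranscendenceBasis F (fun _ : Unit => y) := by
    refine AlgebraicIndependent.isTranscendenceBasis_of_lift_trdeg_le_of_finite
      (algebraicIndependent_unique_type_iff.2 hy) ?_
    rw [← hbx.lift_cardinalMk_eq_trdeg]
  have halg := hby.isAlgebraic_field
  rw [Set.range_const] at halg
  have : Algebra.EssFiniteType (IntermediateField.adjoin F {y}) K :=
    Algebra.EssFiniteType.of_comp F _ K
  exact Algebra.finite_of_essFiniteType_of_isAlgebraic

/-- Functions in a subalgebra `V` which are linearly independent over `F` modulo `y V` are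
linearly independent over `F(y)`: clear denominators in a relation, divide it by the highest
possible power of `y`, and reduce it modulo `y`. -/
theorem linearIndependent_adjoin_of_mod {V : Subalgebra F K} {y : K} (hyV : y ∈ V)
    (hy : Transcendental F y) {ι : Type*} [Fintype ι] {z : ι → K} (hz : ∀ i, z i ∈ V)
    (h : ∀ c : ι → F, (∃ v ∈ V, ∑ i, c i • z i = y * v) → c = 0) :
    LinearIndependent (IntermediateField.adjoin F {y}) z := by
  have hmem : ∀ p : Polynomial F, Polynomial.aeval y p ∈ V := fun p => by
    have := (Polynomial.aeval (⟨y, hyV⟩ : V) p).2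
    rwa [Polynomial.coe_aeval_mk_apply] at this
  have key : ∀ (d : ℕ) (p : ι → Polynomial F), (∀ i, ∀ j ≥ d, (p i).coeff j = 0) →
      ∑ i, Polynomial.aeval y (p i) * z i = 0 → p = 0 := by
    intro d
    induction d with
    | zero => exact fun p hp _ => funext fun i => Polynomial.ext fun j => hp i j (Nat.zero_le _)
    | succ d ih =>
      intro p hp hsum
      have hsplit : ∀ i, Polynomial.aeval y (p i) * z i =
          y * (Polynomial.aeval y (p i).divX * z i) + (p i).coeff 0 • z i := fun i => by
        conv_lhs => rw [← Polynomial.X_mul_divX_add (p i)]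
        rw [map_add, map_mul, Polynomial.aeval_X, Polynomial.aeval_C, Algebra.smul_def]
        ring
      simp_rw [hsplit, Finset.sum_add_distrib, ← Finset.mul_sum] at hsum
      have hc := h (fun i => (p i).coeff 0)
        ⟨-∑ i, Polynomial.aeval y (p i).divX * z i,
          V.neg_mem (V.sum_mem fun i _ => V.mul_mem
            (hmem _) (hz i)), by linear_combination hsum⟩
      have hc' : ∀ i, (p i).coeff 0 = 0 := fun i => congrFun hc i
      simp only [hc', zero_smul, Finset.sum_const_zero, add_zero, mul_eq_zero] at hsum
      have hy0 : y ≠ 0 := by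
        rintro rfl
        exact hy isAlgebraic_zero
      have := ih (fun i => (p i).divX) (fun i j hj => by
        rw [Polynomial.coeff_divX]; exact hp i _ (by omega)) (hsum.resolve_left hy0)
      funext i
      ext j
      cases j with
      | zero => exact hc' i
      | succ j =>
        rw [← Polynomial.coeff_divX, congrFun this i]
        simp
  rw [← LinearIndependent.iff_fractionRing (Algebra.adjoin F {y}), Fintype.linearIndependent_iff]
  intro g hg
  have hg' : ∀ i, ∃ p : Polynomial F, Polynomial.aeval y p = (g i : K) := fun i => by
    exact SetLike.le_def.1 (Algebra.adjoin_singleton_eq_range_aeval F y).le (g i).2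
  choose p hp using hg'
  have hp0 := key ((Finset.univ.sup fun i => (p i).natDegree) + 1) p (fun i j hj =>
    Polynomial.coeff_eq_zero_of_natDegree_lt (lt_of_lt_of_le (Nat.lt_succ_of_le
      (Finset.le_sup (f := fun i => (p i).natDegree) (Finset.mem_univ i))) hj)) (by
      rw [← hg]
      exact Finset.sum_congr rfl fun i _ => by rw [hp, Algebra.smul_def]; rfl)
  intro i
  ext
  rw [← hp i, hp0]
  simp

/-- The dimension of `V / y V` is at most the degree of `K` over `F(y)`. -/
theorem rank_le_finrank_adjoin [IsCurveFunctionField F K] {V : Subalgebra F K} {y : K}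
    (hyV : y ∈ V) (hy : Transcendental F y) {M : Type*} [AddCommGroup M] [Module F M]
    (φ : V →ₗ[F] M) (hφ : Function.Surjective φ) (h0 : ∀ v : V, φ (⟨y, hyV⟩ * v) = 0) :
    Module.Finite F M ∧ Module.finrank F M ≤
      Module.finrank (IntermediateField.adjoin F {y}) K := by
  have := IsCurveFunctionField.finiteDimensional_adjoin hy
  have hr : Module.rank F M ≤ Module.finrank (IntermediateField.adjoin F {y}) K := by
    refine rank_le fun s hs => ?_
    choose z hz using hφ
    have hli := linearIndependent_adjoin_of_mod hyV hy (ι := s) (z := fun i => (z i : K))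
      (fun i => (z i).2) (fun c ⟨v, hv, hc⟩ => by
        have h1 : (∑ i, c i • z (i : M) : V) = ⟨y, hyV⟩ * ⟨v, hv⟩ := by
          ext
          simpa using hc
        have h2 := congrArg φ h1
        rw [h0, map_sum] at h2
        simp_rw [map_smul, hz] at h2
        exact funext (Fintype.linearIndependent_iff.1 hs c h2))
    simpa using hli.fintype_card_le_finrank
  have hfin : Module.Finite F M :=
    Module.rank_lt_aleph0_iff.1 (hr.trans_lt (Cardinal.natCast_lt_aleph0))
  exact ⟨hfin, Module.finrank_le_of_rank_le hr⟩

/-- A valuation ring of a function field of one variable which contains the constants and is not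
the whole field is discrete. -/
theorem isDiscreteValuationRing_of_ne_top [IsCurveFunctionField F K] (A : ValuationSubring K)
    (hF : ∀ c : F, algebraMap F K c ∈ A) (hA : A ≠ ⊤) : IsDiscreteValuationRing A := by
  let : Algebra F A := ((algebraMap F K).codRestrict A hF).toAlgebra
  have htrans : ∀ y : A, y ≠ 0 → ¬ IsUnit y → Transcendental F (y : K) := by
    intro y hy0 hyu halg
    apply hyu
    have hmem : (y : K)⁻¹ ∈ A := by
      let V : Subalgebra F K := { A.toSubring with algebraMap_mem' := hF }
      exact Subalgebra.inv_mem_of_algebraic (A := V) (x := ⟨y, y.2⟩) halg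
    exact IsUnit.of_mul_eq_one ⟨_, hmem⟩
      (Subtype.ext (mul_inv_cancel₀ fun h => hy0 (Subtype.ext h)))
  have hN : IsNoetherianRing A := by
    refine ⟨fun I => ?_⟩
    by_cases hbot : I = ⊥
    · rw [hbot]; exact Submodule.fg_bot
    by_cases htop : I = ⊤
    · rw [htop]; exact ⟨{1}, by simp⟩
    obtain ⟨y, hyI, hy0⟩ := Submodule.exists_mem_ne_zero_of_ne_bot hbot
    have hyu : ¬ IsUnit y := fun hu => htop (Ideal.eq_top_of_isUnit_mem _ hyI hu)
    let V : Subalgebra F K := { A.toSubring with algebraMap_mem' := hF }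
    let φ : V →ₗ[F] (A ⧸ Ideal.span {y}) :=
      { toFun := fun v => Ideal.Quotient.mk _ (⟨v.1, v.2⟩ : A)
        map_add' := fun v w => rfl
        map_smul' := fun c v => by
          rw [RingHom.id_apply, Algebra.smul_def]
          exact congrArg _ (Subtype.ext (Algebra.smul_def c (v : K))) }
    have hfin := (rank_le_finrank_adjoin (V := V) y.2 (htrans y hy0 hyu) φ
      (fun q => by
        obtain ⟨a, rfl⟩ := Ideal.Quotient.mk_surjective q
        exact ⟨⟨a.1, a.2⟩, rfl⟩)
      (fun v => Ideal.Quotient.eq_zero_iff_mem.2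
        (Ideal.mem_span_singleton.2 ⟨⟨v.1, v.2⟩, rfl⟩))).1
    have hNq : IsNoetherian A (A ⧸ Ideal.span {y}) := isNoetherian_of_tower F inferInstance
    refine Submodule.fg_of_fg_map_of_fg_inf_ker (Ideal.span {y}).mkQ (IsNoetherian.noetherian _) ?_
    rw [Submodule.ker_mkQ, inf_eq_right.2 ((Ideal.span_singleton_le_iff_mem _).2 hyI)]
    exact ⟨{y}, by simp⟩
  have hfield : ¬ IsField A := by
    intro hf
    apply hA
    refine eq_top_iff.2 fun x _ => ?_
    rcases A.mem_or_inv_mem x with h | h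
    · exact h
    · by_cases hx : x = 0
      · rw [hx]; exact A.zero_mem
      obtain ⟨b, hb⟩ := hf.mul_inv_cancel (a := (⟨x⁻¹, h⟩ : A)) fun h0 =>
        inv_ne_zero hx (congrArg Subtype.val h0)
      have hb' : x⁻¹ * (b : K) = 1 := congrArg Subtype.val hb
      have : x = b := by
        field_simp at hb'
        exact hb'.symm
      rw [this]; exact b.2
  have hiff : IsDiscreteValuationRing A ↔ ValuationRing A :=
    (IsDiscreteValuationRing.TFAE A hfield).out 0 1
  exact hiff.2 inferInstance

/-- The closed point given by a valuation ring which contains the constants. -/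
def Place.ofNeTop [IsCurveFunctionField F K] (A : ValuationSubring K)
    (hF : ∀ c : F, algebraMap F K c ∈ A) (hA : A ≠ ⊤) : Place F K where
  O := A
  algebraMap_mem := hF
  dvr := isDiscreteValuationRing_of_ne_top A hF hA

theorem transcendental_iff [IsCurveFunctionField F K] {f : K} :
    Transcendental F f ↔ f ∉ Set.range (algebraMap F K) := by
  have h := IsCurveFunctionField.algebraicClosure_eq_bot (k := F) (K := K)
  rw [Transcendental, not_iff_not, ← mem_algebraicClosure_iff, h, IntermediateField.mem_bot]

/-- A non-constant function has a pole. -/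
theorem exists_notMem_of_transcendental [IsCurveFunctionField F K] {f : K}
    (hf : Transcendental F f) : ∃ P : Place F K, f ∉ P.O := by
  have hn : f ∉ (integralClosure F K).toSubring := fun h =>
    hf (isAlgebraic_iff_isIntegral.2 h)
  have : IsIntegrallyClosedIn (integralClosure F K).toSubring K :=
    inferInstanceAs (IsIntegrallyClosedIn (integralClosure F K) K)
  obtain ⟨A, hA, hfA⟩ := Subring.exists_le_valuationSubring_of_isIntegrallyClosedIn hn
  exact ⟨Place.ofNeTop A (fun c => hA ((integralClosure F K).algebraMap_mem c))
    (by rintro rfl; exact hfA (ValuationSubring.mem_top _)), hfA⟩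

namespace Place

theorem transcendental_of_ord_ne_zero [IsCurveFunctionField F K] (P : Place F K) {f : K}
    (hf : P.ord f ≠ 0) : Transcendental F f := by
  rw [transcendental_iff]
  rintro ⟨c, rfl⟩
  exact hf (P.ord_algebraMap c)

/-- The local ring of a closed point as an algebra over the constants. -/
def toSubalgebra (P : Place F K) : Subalgebra F K :=
  { P.O.toSubring with algebraMap_mem' := P.algebraMap_mem }

theorem finite_residueField [IsCurveFunctionField F K] (P : Place F K) :
    Module.Finite F (IsLocalRing.ResidueField P.O) := by
  obtain ⟨π, hπ⟩ := P.exists_uniformizer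
  have hπ1 : P.ord π = 1 := by rw [P.ord_of_val hπ]; norm_num
  have hlt : P.val π < 1 := by
    rw [hπ, ← WithZero.exp_zero, WithZero.exp_lt_exp]; norm_num
  have hπO : π ∈ P.O := P.val_le_one_iff.1 hlt.le
  let φ : P.toSubalgebra →ₗ[F] IsLocalRing.ResidueField P.O :=
    { toFun := fun v => IsLocalRing.residue P.O (⟨v.1, v.2⟩ : P.O)
      map_add' := fun v w => rfl
      map_smul' := fun c v => by
        rw [Algebra.smul_def, RingHom.id_apply, Algebra.smul_def]
        rfl }
  refine (rank_le_finrank_adjoin (V := P.toSubalgebra) (y := π) hπO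
    (P.transcendental_of_ord_ne_zero (by rw [hπ1]; norm_num)) φ (fun q => ?_) fun v => ?_).1
  · obtain ⟨a, rfl⟩ := IsLocalRing.residue_surjective q
    exact ⟨⟨a.1, a.2⟩, rfl⟩
  · have hm := (P.val_lt_one_iff hπO).1 hlt
    exact (IsLocalRing.residue_eq_zero_iff _).2 (Ideal.mul_mem_right (⟨v.1, v.2⟩ : P.O) _ hm)

theorem degree_pos [IsCurveFunctionField F K] (P : Place F K) : 0 < P.degree := by
  have := P.finite_residueField
  exact Module.finrank_pos

end Place

end FunctionField

/-! ### Weak approximation -/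

section Approximation

variable {F K : Type*} [Field F] [Field K] [Algebra F K]

namespace Place

/-- The absolute value `2 ^ (-ord_P f)`. -/
def absVal (P : Place F K) : AbsoluteValue K ℝ :=
  (IsDiscreteValuationRing.maximalIdeal P.O).adicAbv (b := 2) (by norm_num)

theorem absVal_lt_one (P : Place F K) {f : K} : P.absVal f < 1 ↔ P.val f < 1 := by
  have h : P.absVal f = (WithZeroMulInt.toNNReal (e := 2) (by norm_num) (P.val f) : ℝ) := rfl
  rw [h, ← (WithZeroMulInt.toNNReal_strictMono (e := 2) (by norm_num)).lt_iff_lt, map_one]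
  norm_cast

theorem one_lt_absVal (P : Place F K) {f : K} : 1 < P.absVal f ↔ 1 < P.val f := by
  have h : P.absVal f = (WithZeroMulInt.toNNReal (e := 2) (by norm_num) (P.val f) : ℝ) := rfl
  rw [h, ← (WithZeroMulInt.toNNReal_strictMono (e := 2) (by norm_num)).lt_iff_lt, map_one]
  norm_cast

theorem absVal_isNontrivial (P : Place F K) : P.absVal.IsNontrivial := by
  obtain ⟨π, hπ⟩ := P.exists_uniformizer
  refine ⟨π, P.ne_zero_of_val hπ, ne_of_lt ?_⟩
  rw [absVal_lt_one, hπ, ← WithZero.exp_zero, WithZero.exp_lt_exp]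
  norm_num

theorem not_isEquiv_absVal {P Q : Place F K} (h : P ≠ Q) : ¬ P.absVal.IsEquiv Q.absVal := by
  intro he
  refine h (eq_of_le fun f hf => ?_)
  rw [← val_le_one_iff, ← not_lt, ← one_lt_absVal] at hf ⊢
  rwa [← he.one_lt_iff]

/-- There is a function with a pole at a given point and zeros at finitely many others. -/
theorem exists_pole_and_zeros (T : Finset (Place F K)) {P : Place F K} (hP : P ∈ T) :
    ∃ a : K, a ≠ 0 ∧ P.ord a ≤ -1 ∧ ∀ Q ∈ T, Q ≠ P → 1 ≤ Q.ord a := by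
  obtain ⟨a, ha, ha'⟩ := AbsoluteValue.exists_one_lt_lt_one_pi_of_not_isEquiv
    (v := fun Q : T => Q.1.absVal) (fun Q => Q.1.absVal_isNontrivial)
    (fun Q R hQR => not_isEquiv_absVal fun h => hQR (Subtype.ext h)) ⟨P, hP⟩
  have ha0 : a ≠ 0 := by
    rintro rfl
    rw [map_zero] at ha
    exact absurd ha (by norm_num)
  refine ⟨a, ha0, ?_, fun Q hQ hQP => ?_⟩
  · rw [one_lt_absVal, P.val_eq ha0, ← WithZero.exp_zero, WithZero.exp_lt_exp] at ha
    omega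
  · have := ha' ⟨Q, hQ⟩ fun h => hQP (congrArg Subtype.val h)
    rw [absVal_lt_one, Q.val_eq ha0, ← WithZero.exp_zero, WithZero.exp_lt_exp] at this
    omega

/-- There is a function close to `1` at a given point and close to `0` at finitely many others:
for `a` with a pole at the point and zeros at the others, one takes `aᵐ / (1 + aᵐ)`. -/
theorem exists_approx_indicator (T : Finset (Place F K)) {P : Place F K} (hP : P ∈ T) (m : ℕ) :
    ∃ e : K, e - 1 ∈ P.stalk (-m) ∧ ∀ Q ∈ T, Q ≠ P → e ∈ Q.stalk (-m) := by
  obtain ⟨a, ha0, haP, haQ⟩ := exists_pole_and_zeros T hP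
  have hk0 : a ^ (m + 1) ≠ 0 := pow_ne_zero _ ha0
  have hP' : P.ord (1 + a ^ (m + 1)) = (m + 1) * P.ord a := by
    rw [P.ord_eq_of_val_sub_lt (f := 1 + a ^ (m + 1)) (g := a ^ (m + 1)), P.ord_pow]
    · push_cast; ring
    · rw [add_sub_cancel_right, map_one, P.val_eq hk0, P.ord_pow, ← WithZero.exp_zero,
        WithZero.exp_lt_exp]
      push_cast
      nlinarith
  have h10 : 1 + a ^ (m + 1) ≠ 0 := by
    intro h
    rw [h, ord_zero] at hP'
    nlinarith
  refine ⟨a ^ (m + 1) * (1 + a ^ (m + 1))⁻¹, ?_, fun Q hQ hQP => ?_⟩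
  · have : a ^ (m + 1) * (1 + a ^ (m + 1))⁻¹ - 1 = -(1 + a ^ (m + 1))⁻¹ := by
      field_simp
      ring
    rw [this, Submodule.neg_mem_iff, P.mem_stalk_iff_ord (inv_ne_zero h10), P.ord_inv, hP']
    nlinarith
  · have hQ1 := haQ Q hQ hQP
    have hQ' : Q.ord (1 + a ^ (m + 1)) = 0 := by
      rw [Q.ord_eq_of_val_sub_lt (f := 1 + a ^ (m + 1)) (g := 1), Q.ord_one]
      rw [add_sub_cancel_left, map_one, Q.val_eq hk0, Q.ord_pow, ← WithZero.exp_zero,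
        WithZero.exp_lt_exp]
      push_cast
      nlinarith
    rw [Q.mem_stalk_iff_ord (mul_ne_zero hk0 (inv_ne_zero h10)),
      Q.ord_mul hk0 (inv_ne_zero h10), Q.ord_inv, hQ', Q.ord_pow]
    push_cast
    nlinarith

/-- Weak approximation. -/
theorem exists_approx (T : Finset (Place F K)) (r : Place F K → K) (n : ℕ) :
    ∃ f : K, ∀ P ∈ T, f - r P ∈ P.stalk (-n) := by
  classical
  set c : ℕ := T.sup fun P => T.sup fun Q => (Q.ord (r P)).natAbs with hc
  have hcr : ∀ P ∈ T, ∀ Q ∈ T, r P ∈ Q.stalk c := fun P hP Q hQ => by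
    by_cases h0 : r P = 0
    · rw [h0]; exact zero_mem _
    rw [Q.mem_stalk_iff_ord h0]
    have h1 : (Q.ord (r P)).natAbs ≤ c :=
      (Finset.le_sup (f := fun Q => (Q.ord (r P)).natAbs) hQ).trans
        (Finset.le_sup (f := fun P => T.sup fun Q => (Q.ord (r P)).natAbs) hP)
    omega
  have he : ∀ P : Place F K, ∃ e : K, P ∈ T → e - 1 ∈ P.stalk (-(n + c : ℕ)) ∧
      ∀ Q ∈ T, Q ≠ P → e ∈ Q.stalk (-(n + c : ℕ)) := fun P => by
    by_cases hP : P ∈ T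
    · obtain ⟨e, he⟩ := exists_approx_indicator T hP (n + c)
      exact ⟨e, fun _ => he⟩
    · exact ⟨0, fun h => absurd h hP⟩
  choose e he using he
  refine ⟨∑ P ∈ T, e P * r P, fun Q hQ => ?_⟩
  have hn : (-(n : ℤ)) = -(n + c : ℕ) + c := by push_cast; ring
  have : ∑ P ∈ T, e P * r P - r Q = (e Q - 1) * r Q + ∑ P ∈ T.erase Q, e P * r P := by
    rw [← Finset.add_sum_erase _ _ hQ]; ring
  rw [this, hn]
  refine Submodule.add_mem _ (Q.mul_mem_stalk (he Q hQ).1 (hcr Q hQ Q hQ))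
    (Submodule.sum_mem _ fun P hP => ?_)
  have hP' := Finset.mem_of_mem_erase hP
  exact Q.mul_mem_stalk ((he P hP').2 Q hQ (Finset.ne_of_mem_erase hP).symm) (hcr P hP' Q hQ)

end Place

end Approximation

/-! ### Relative lengths of submodules -/

section RelLength

variable {R M : Type*} [Ring R] [AddCommGroup M] [Module R M]

/-- The length of `B / (A ∩ B)` for submodules `A`, `B`, used for `A ≤ B`. -/
def relLength (A B : Submodule R M) : ℕ∞ := Module.length R (B ⧸ A.submoduleOf B)

theorem mem_submoduleOf {A B : Submodule R M} {b : B} : b ∈ A.submoduleOf B ↔ (b : M) ∈ A :=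
  Iff.rfl

theorem relLength_of_surjective {A B : Submodule R M} {N : Type*} [AddCommGroup N] [Module R N]
    (φ : B →ₗ[R] N) (hφ : Function.Surjective φ) (hker : ∀ b : B, φ b = 0 ↔ (b : M) ∈ A) :
    relLength A B = Module.length R N := by
  have : A.submoduleOf B = LinearMap.ker φ := by
    ext b
    rw [LinearMap.mem_ker, hker, mem_submoduleOf]
  rw [relLength, this]
  exact (φ.quotKerEquivOfSurjective hφ).length_eq

theorem relLength_eq_zero {A B : Submodule R M} : relLength A B = 0 ↔ B ≤ A := by
  rw [relLength, Module.length_eq_zero_iff, Submodule.Quotient.subsingleton_iff,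
    Submodule.submoduleOf_eq_top]

theorem relLength_add {A B C : Submodule R M} (hAB : A ≤ B) (hBC : B ≤ C) :
    relLength A C = relLength A B + relLength B C := by
  have h : A.submoduleOf C ≤ B.submoduleOf C := fun x hx => hAB hx
  have h' : A.submoduleOf B ≤ (A.submoduleOf C).comap (Submodule.inclusion hBC) := fun x hx => hx
  refine Module.length_eq_add_of_exact
    ((A.submoduleOf B).mapQ (A.submoduleOf C) (Submodule.inclusion hBC) h')
    (Submodule.factor h) ?_ (Submodule.factor_surjective h) ?_
  · refine (injective_iff_map_eq_zero _).2 fun x hx => ?_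
    obtain ⟨x, rfl⟩ := Submodule.mkQ_surjective _ x
    rw [Submodule.mkQ_apply, Submodule.mapQ_apply, Submodule.Quotient.mk_eq_zero] at hx
    exact (Submodule.Quotient.mk_eq_zero _).2 hx
  · intro x
    obtain ⟨x, rfl⟩ := Submodule.mkQ_surjective _ x
    have h1 : Submodule.factor h ((A.submoduleOf C).mkQ x) = (B.submoduleOf C).mkQ x := rfl
    rw [h1, Submodule.mkQ_apply, Submodule.Quotient.mk_eq_zero]
    constructor
    · intro hx
      exact ⟨Submodule.mkQ _ ⟨x, hx⟩, rfl⟩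
    · rintro ⟨y, hy⟩
      obtain ⟨y, rfl⟩ := Submodule.mkQ_surjective _ y
      have hy' : Submodule.Quotient.mk (p := A.submoduleOf C) (Submodule.inclusion hBC y) =
        Submodule.Quotient.mk x := hy
      rw [Submodule.Quotient.eq] at hy'
      have := B.sub_mem y.2 (hAB hy')
      rw [mem_submoduleOf]
      simpa using this

theorem relLength_inf (A B : Submodule R M) : relLength (A ⊓ B) B = relLength A (A ⊔ B) := by
  symm
  have hle : A ≤ A ⊔ B := le_sup_left
  have h := (LinearMap.quotientInfEquivSupQuotient B A).length_eq
  have h1 : (A ⊓ B).submoduleOf B = B.submoduleOf B ⊓ A.submoduleOf B := by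
    ext x
    simp [mem_submoduleOf]
  rw [relLength, relLength, h1, sup_comm A B]
  exact h.symm

/-- The length of `B / A` is the sum of those of its intersection with `C` and of its image
modulo `C`. -/
theorem relLength_eq_inf_add_sup {A B : Submodule R M} (h : A ≤ B) (C : Submodule R M) :
    relLength A B = relLength (A ⊓ C) (B ⊓ C) + relLength (A ⊔ C) (B ⊔ C) := by
  have hmod : A ⊔ (B ⊓ C) = (A ⊔ C) ⊓ B := by
    rw [inf_comm B C, sup_inf_assoc_of_le C h]
  have h1 : relLength (A ⊓ C) (B ⊓ C) = relLength A (A ⊔ (B ⊓ C)) := by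
    rw [← relLength_inf]
    congr 1
    rw [← inf_assoc, inf_eq_left.2 h]
  have h2 : relLength (A ⊔ C) (B ⊔ C) = relLength (A ⊔ (B ⊓ C)) B := by
    rw [hmod, relLength_inf]
    congr 1
    rw [sup_comm A C, sup_assoc, sup_eq_right.2 h, sup_comm]
  rw [h1, h2, ← relLength_add le_sup_left (sup_le h inf_le_left)]

end RelLength

/-! ### Degrees of divisors and the degree of the divisor of zeros -/

section Degree

variable {F K : Type*} [Field F] [Field K] [Algebra F K]

namespace Divisor

theorem deg_add (A B : Divisor F K) : (A + B).deg = A.deg + B.deg :=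
  Finsupp.sum_add_index' (fun _ => zero_mul _) (fun _ _ _ => add_mul _ _ _)

theorem deg_zero : (0 : Divisor F K).deg = 0 := Finsupp.sum_zero_index

theorem deg_single (P : Place F K) (n : ℤ) :
    Divisor.deg (Finsupp.single P n : Divisor F K) = n * P.degree :=
  Finsupp.sum_single_index (zero_mul _)

variable (F K) in
/-- The degree as a homomorphism. -/
def degHom : Divisor F K →+ ℤ where
  toFun := Divisor.deg
  map_zero' := deg_zero
  map_add' := deg_add

theorem deg_sub (A B : Divisor F K) : (A - B).deg = A.deg - B.deg := map_sub (degHom F K) A B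

theorem deg_nsmul (n : ℕ) (A : Divisor F K) : (n • A).deg = n * A.deg := by
  have := map_nsmul (degHom F K) n A
  rwa [nsmul_eq_mul] at this

theorem deg_sum {ι : Type*} (s : Finset ι) (A : ι → Divisor F K) :
    (∑ i ∈ s, A i).deg = ∑ i ∈ s, (A i).deg := map_sum (degHom F K) A s

theorem deg_nonneg {A : Divisor F K} (hA : 0 ≤ A) : 0 ≤ A.deg :=
  Finset.sum_nonneg fun P _ => mul_nonneg (hA P) (Int.natCast_nonneg _)

/-- Effective divisors are sums of points. -/
theorem effective_induction {p : Divisor F K → Prop} (h0 : p 0)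
    (hadd : ∀ A P, 0 ≤ A → p A → p (A + Finsupp.single P 1)) {A : Divisor F K} (hA : 0 ≤ A) :
    p A := by
  classical
  let μ : Divisor F K →+ ℤ := Finsupp.liftAddHom fun _ => AddMonoidHom.id ℤ
  have hμs : ∀ P : Place F K, μ (Finsupp.single P 1) = 1 := fun P => by simp [μ]
  have hμ0 : ∀ A : Divisor F K, 0 ≤ A → 0 ≤ μ A := fun A hA =>
    Finset.sum_nonneg fun P _ => hA P
  obtain ⟨n, hn⟩ : ∃ n : ℕ, (n : ℤ) = μ A := ⟨(μ A).toNat, Int.toNat_of_nonneg (hμ0 A hA)⟩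
  induction n generalizing A with
  | zero =>
    have : A = 0 := by
      by_contra hne
      obtain ⟨P, hP⟩ := Finsupp.ne_iff.1 hne
      have hsum : μ A = ∑ P ∈ A.support, A P := rfl
      have h1 := Finset.single_le_sum (f := fun P => A P) (fun P _ => hA P)
        (Finsupp.mem_support_iff.2 hP)
      have h2 := hA P
      simp only [Finsupp.coe_zero, Pi.zero_apply] at h1 h2 hP
      push_cast at hn
      omega
    rw [this]; exact h0
  | succ n ih =>
    have hne : A ≠ 0 := by
      rintro rfl
      rw [map_zero] at hn
      omega
    obtain ⟨P, hP⟩ := Finsupp.ne_iff.1 hne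
    have hA' : 0 ≤ A - Finsupp.single P 1 := fun Q => by
      have h2 := hA Q
      simp only [Finsupp.coe_zero, Pi.zero_apply, Finsupp.sub_apply] at h2 hP ⊢
      by_cases hQ : P = Q
      · subst hQ
        rw [Finsupp.single_eq_same]
        omega
      · rw [Finsupp.single_eq_of_ne (Ne.symm hQ)]
        omega
    have := hadd _ P hA' (ih hA' (by
      rw [map_sub, hμs, ← hn]; push_cast; ring))
    rwa [sub_add_cancel] at this

end Divisor

/-- Lengths along a family of submodules indexed by divisors, which grow by the degree of a
point when the point is added, are differences of degrees. -/
theorem relLength_of_step {M : Type*} [AddCommGroup M] [Module F M]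
    (S : Divisor F K → Submodule F M) (hS : Monotone S) (T : Set (Place F K))
    (step : ∀ E, ∀ P ∈ T, relLength (S E) (S (E + Finsupp.single P 1)) = P.degree)
    {A : Divisor F K} (hA : 0 ≤ A) (hT : ∀ P, A P ≠ 0 → P ∈ T) (E : Divisor F K) :
    relLength (S E) (S (E + A)) = (A.deg.toNat : ℕ∞) := by
  classical
  revert hT
  refine Divisor.effective_induction
    (p := fun A => (∀ P, A P ≠ 0 → P ∈ T) → relLength (S E) (S (E + A)) = (A.deg.toNat : ℕ∞))
    ?_ (fun A P hA ih hT => ?_) hA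
  · intro _
    rw [add_zero, Divisor.deg_zero, relLength_eq_zero.2 le_rfl]
    rfl
  · have hAP : ∀ Q, A Q ≠ 0 → Q ∈ T := fun Q hQ => hT Q fun h0 => hQ (by
      have h1 := hA Q
      have h2 : (0 : ℤ) ≤ (Finsupp.single P (1 : ℤ)) Q := by
        rw [Finsupp.single_apply]; split_ifs <;> norm_num
      simp only [Finsupp.add_apply, Finsupp.coe_zero, Pi.zero_apply] at h0 h1
      omega)
    have hP : P ∈ T := hT P (by
      have h1 := hA P
      simp only [Finsupp.add_apply, Finsupp.coe_zero, Pi.zero_apply,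
        Finsupp.single_eq_same] at h1 ⊢
      omega)
    have h1 : (0 : Divisor F K) ≤ Finsupp.single P 1 := Finsupp.single_nonneg.2 (by norm_num)
    rw [relLength_add (hS (le_add_of_nonneg_right hA)) (hS (add_le_add_right
      (le_add_of_nonneg_right h1) E)), ih hAP, ← add_assoc, step _ P hP, Divisor.deg_add,
      Divisor.deg_single, one_mul, Int.toNat_add (Divisor.deg_nonneg hA) (Int.natCast_nonneg _),
      Int.toNat_natCast, Nat.cast_add]

namespace Place

theorem exists_residue (P : Place F K) (n : ℤ) :
    ∃ φ : P.stalk n →ₗ[F] IsLocalRing.ResidueField P.O, Function.Surjective φ ∧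
      ∀ f, φ f = 0 ↔ (f : K) ∈ P.stalk (n - 1) := by
  obtain ⟨t, ht0, ht⟩ := P.exists_ord_eq n
  have hmem : ∀ f : P.stalk n, t * (f : K) ∈ P.O := fun f => by
    rw [← P.mem_stalk_zero, P.mul_mem_stalk_iff ht0, ht, zero_add]
    exact f.2
  let φ : P.stalk n →ₗ[F] IsLocalRing.ResidueField P.O :=
    { toFun := fun f => IsLocalRing.residue P.O ⟨t * f, hmem f⟩
      map_add' := fun f g => by
        rw [← map_add]
        exact congrArg _ (Subtype.ext (mul_add _ _ _))
      map_smul' := fun c f => by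
        rw [RingHom.id_apply, Algebra.smul_def]
        have : IsLocalRing.residue P.O ⟨t * (c • f : P.stalk n), hmem (c • f)⟩ =
          IsLocalRing.residue P.O (algebraMap F P.O c * ⟨t * f, hmem f⟩) := by
          refine congrArg _ (Subtype.ext ?_)
          change t * (c • (f : K)) = algebraMap F K c * (t * f)
          rw [Algebra.smul_def]; ring
        rw [this, map_mul]
        rfl }
  refine ⟨φ, fun q => ?_, fun f => ?_⟩
  · obtain ⟨a, rfl⟩ := IsLocalRing.residue_surjective q
    refine ⟨⟨t⁻¹ * a, ?_⟩, congrArg (IsLocalRing.residue P.O) (Subtype.ext ?_)⟩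
    · rw [P.mul_mem_stalk_iff (inv_ne_zero ht0), P.ord_inv, ht, add_neg_cancel, P.mem_stalk_zero]
      exact a.2
    · change t * (t⁻¹ * (a : K)) = a
      rw [mul_inv_cancel_left₀ ht0]
  · have h1 : φ f = 0 ↔ P.val (t * (f : K)) < 1 := by
      rw [P.val_lt_one_iff (hmem f)]
      exact IsLocalRing.residue_eq_zero_iff _
    rw [h1, ← mem_stalk_neg_one, P.mul_mem_stalk_iff ht0, ht, neg_add_eq_sub]

theorem length_residueField [IsCurveFunctionField F K] (P : Place F K) :
    Module.length F (IsLocalRing.ResidueField P.O) = P.degree := by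
  have := P.finite_residueField
  rw [Module.length_eq_finrank, degree]

end Place

/-- The functions which satisfy the conditions imposed by a divisor `E` at the points of a
set `T`. -/
def sectionsOn (T : Set (Place F K)) (E : Divisor F K) : Submodule F K :=
  ⨅ P ∈ T, P.stalk (E P)

theorem mem_sectionsOn {T : Set (Place F K)} {E : Divisor F K} {f : K} :
    f ∈ sectionsOn T E ↔ ∀ P ∈ T, f ∈ P.stalk (E P) := by
  simp [sectionsOn]

theorem sectionsOn_mono (T : Set (Place F K)) : Monotone (sectionsOn T) := fun _ _ h _ hf =>
  mem_sectionsOn.2 fun P hP => P.stalk_mono (h P) (mem_sectionsOn.1 hf P hP)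

theorem add_single_apply_of_ne {E : Divisor F K} {P Q : Place F K} (h : Q ≠ P) :
    (E + Finsupp.single P 1 : Divisor F K) Q = E Q := by
  classical
  rw [Finsupp.add_apply, Finsupp.single_eq_of_ne h, add_zero]

theorem add_single_apply_self {E : Divisor F K} {P : Place F K} :
    (E + Finsupp.single P 1 : Divisor F K) P = E P + 1 := by
  rw [Finsupp.add_apply, Finsupp.single_eq_same]

theorem relLength_sectionsOn_add_single [IsCurveFunctionField F K] (T : Finset (Place F K))
    (E : Divisor F K) (P : Place F K) (hP : P ∈ (T : Set (Place F K))) :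
    relLength (sectionsOn T E) (sectionsOn T (E + Finsupp.single P 1)) = P.degree := by
  classical
  obtain ⟨φ, hφ, hker⟩ := P.exists_residue (E P + 1)
  have hle : sectionsOn T (E + Finsupp.single P 1) ≤ P.stalk (E P + 1) := fun f hf => by
    have := mem_sectionsOn.1 hf P hP
    rwa [add_single_apply_self] at this
  rw [relLength_of_surjective (φ ∘ₗ Submodule.inclusion hle), P.length_residueField]
  · intro q
    obtain ⟨f, rfl⟩ := hφ q
    obtain ⟨g, hg⟩ := Place.exists_approx T (fun Q => if Q = P then (f : K) else 0)
      ((E P).natAbs + T.sup fun Q => (E Q).natAbs)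
    have hgP := hg P hP
    rw [if_pos rfl] at hgP
    have hgP' : g - f ∈ P.stalk (E P) := P.stalk_mono (by rw [Nat.cast_add]; omega) hgP
    have hg' : g ∈ sectionsOn T (E + Finsupp.single P 1) := by
      refine mem_sectionsOn.2 fun Q hQ => ?_
      by_cases hQP : Q = P
      · subst hQP
        rw [add_single_apply_self, ← sub_add_cancel g (f : K)]
        exact add_mem (Q.stalk_mono (by omega) hgP') f.2
      · have hgQ := hg Q hQ
        rw [if_neg hQP, sub_zero] at hgQ
        rw [add_single_apply_of_ne hQP]
        have h2 : (E Q).natAbs ≤ T.sup fun Q => (E Q).natAbs :=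
          Finset.le_sup (f := fun Q => (E Q).natAbs) hQ
        exact Q.stalk_mono (by rw [Nat.cast_add]; omega) hgQ
    refine ⟨⟨g, hg'⟩, ?_⟩
    rw [LinearMap.comp_apply, ← sub_eq_zero, ← map_sub, hker]
    simpa using hgP'
  · intro f
    rw [LinearMap.comp_apply, hker, add_sub_cancel_right, mem_sectionsOn]
    constructor
    · intro hf Q hQ
      by_cases hQP : Q = P
      · subst hQP; exact hf
      · have := mem_sectionsOn.1 f.2 Q hQ
        rwa [add_single_apply_of_ne hQP] at this
    · intro h
      exact h P hP

/-- The divisor of zeros of `y`, restricted to a finite set of points, has degree at most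
the degree of `K` over `F(y)`. -/
theorem sum_ord_mul_degree_le [IsCurveFunctionField F K] {y : K} (hy : Transcendental F y)
    (T : Finset (Place F K)) (hT : ∀ P ∈ T, 0 < P.ord y) :
    ∑ P ∈ T, P.ord y * P.degree ≤ Module.finrank (IntermediateField.adjoin F {y}) K := by
  classical
  have hy0 : y ≠ 0 := by
    rintro rfl
    exact hy isAlgebraic_zero
  let A : Divisor F K := ∑ P ∈ T, Finsupp.single P (P.ord y)
  have hAT : ∀ P ∈ T, A P = P.ord y := fun P hP => by
    rw [Finsupp.finsetSum_apply, Finset.sum_eq_single P, Finsupp.single_eq_same]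
    · exact fun Q _ hQ => Finsupp.single_eq_of_ne hQ.symm
    · exact fun h => absurd hP h
  have hAnT : ∀ P ∉ T, A P = 0 := fun P hP => by
    rw [Finsupp.finsetSum_apply]
    exact Finset.sum_eq_zero fun Q hQ => Finsupp.single_eq_of_ne fun h => hP (h ▸ hQ)
  have hA0 : 0 ≤ A := fun P => by
    by_cases hP : P ∈ T
    · rw [hAT P hP]; exact (hT P hP).le
    · rw [hAnT P hP]; rfl
  have hdeg : A.deg = ∑ P ∈ T, P.ord y * P.degree := by
    rw [Divisor.deg_sum]
    exact Finset.sum_congr rfl fun P _ => Divisor.deg_single _ _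
  have hlen := relLength_of_step (sectionsOn (T : Set (Place F K))) (sectionsOn_mono _) T
    (relLength_sectionsOn_add_single T) hA0 (fun P hP => by
      by_contra h
      exact hP (hAnT P h)) (-A)
  rw [neg_add_cancel] at hlen
  let V : Subalgebra F K :=
    { carrier := {f | ∀ P ∈ T, f ∈ P.O}
      mul_mem' := fun hf hg P hP => P.O.mul_mem _ _ (hf P hP) (hg P hP)
      add_mem' := fun hf hg P hP => P.O.add_mem _ _ (hf P hP) (hg P hP)
      algebraMap_mem' := fun c P _ => P.algebraMap_mem c }
  have hV : ∀ f, f ∈ V ↔ f ∈ sectionsOn (T : Set (Place F K)) 0 := fun f => by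
    rw [mem_sectionsOn]
    exact forall₂_congr fun P _ => P.mem_stalk_zero.symm
  have hyV : y ∈ V := fun P hP => by
    rw [← P.mem_stalk_zero, P.mem_stalk_iff_ord hy0]
    have := hT P hP
    omega
  let ι : V →ₗ[F] sectionsOn (T : Set (Place F K)) 0 :=
    { toFun := fun v => ⟨v, (hV v).1 v.2⟩
      map_add' := fun _ _ => rfl
      map_smul' := fun _ _ => rfl }
  obtain ⟨hfin, hrank⟩ := rank_le_finrank_adjoin hyV hy
    (((sectionsOn (T : Set (Place F K)) (-A)).submoduleOf (sectionsOn T 0)).mkQ ∘ₗ ι)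
    ((Submodule.mkQ_surjective _).comp fun f => ⟨⟨f, (hV f).2 f.2⟩, rfl⟩) (fun v => by
      rw [LinearMap.comp_apply, Submodule.mkQ_apply, Submodule.Quotient.mk_eq_zero]
      refine mem_sectionsOn.2 fun P hP => ?_
      change y * (v : K) ∈ _
      rw [P.mul_mem_stalk_iff hy0, Finsupp.neg_apply, hAT P hP, neg_add_cancel, P.mem_stalk_zero]
      exact v.2 P hP)
  rw [relLength, Module.length_eq_finrank] at hlen
  have hnat : Module.finrank F (sectionsOn (T : Set (Place F K)) 0 ⧸
    (sectionsOn (T : Set (Place F K)) (-A)).submoduleOf (sectionsOn T 0)) = A.deg.toNat := by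
    exact_mod_cast hlen
  have h0 := Divisor.deg_nonneg hA0
  rw [← hdeg]
  omega

/-- The number of zeros is bounded by the degree of `K` over `F(y)`. -/
theorem finite_zeros [IsCurveFunctionField F K] (y : K) : {P : Place F K | 0 < P.ord y}.Finite := by
  by_cases hy : Transcendental F y
  · by_contra hinf
    obtain ⟨T, hT, hcard⟩ := Set.Infinite.exists_subset_card_eq hinf
      (Module.finrank (IntermediateField.adjoin F {y}) K + 1)
    have h1 := sum_ord_mul_degree_le hy T fun P hP => hT hP
    have h2 : ∑ P ∈ T, (1 : ℤ) ≤ ∑ P ∈ T, P.ord y * P.degree :=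
      Finset.sum_le_sum fun P hP => by
        have h3 : 0 < P.ord y := hT hP
        have h4 : (0 : ℤ) < P.degree := by exact_mod_cast P.degree_pos
        nlinarith
    rw [Finset.sum_const, hcard, nsmul_eq_mul] at h2
    push_cast at h2
    omega
  · convert Set.finite_empty
    ext P
    simp only [Set.mem_ofPred_eq, Set.mem_empty_iff_false, iff_false, not_lt]
    by_contra hP
    exact hy (P.transcendental_of_ord_ne_zero (by omega))

theorem finite_ord_ne_zero [IsCurveFunctionField F K] (y : K) :
    {P : Place F K | P.ord y ≠ 0}.Finite := by
  refine ((finite_zeros y).union (finite_zeros y⁻¹)).subset fun P hP => ?_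
  simp only [Set.mem_union, Set.mem_ofPred_eq, P.ord_inv] at hP ⊢
  omega

/-- The divisor of a function, with the value `0` for the zero function. -/
def Divisor.div [IsCurveFunctionField F K] (f : K) : Divisor F K :=
  Finsupp.ofSupportFinite (fun P => P.ord f) (finite_ord_ne_zero f)

theorem Divisor.div_apply [IsCurveFunctionField F K] (f : K) (P : Place F K) :
    Divisor.div f P = P.ord f := rfl

theorem deg_div_sup_zero_le [IsCurveFunctionField F K] {y : K} (hy : Transcendental F y) :
    (Divisor.div y ⊔ 0 : Divisor F K).deg ≤ Module.finrank (IntermediateField.adjoin F {y}) K := by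
  refine le_trans (le_of_eq ?_) (sum_ord_mul_degree_le hy
    (Divisor.div y ⊔ 0 : Divisor F K).support fun P hP => ?_)
  · refine Finset.sum_congr rfl fun P hP => ?_
    rw [Finsupp.mem_support_iff, Finsupp.sup_apply, Divisor.div_apply, Finsupp.coe_zero,
      Pi.zero_apply] at hP
    rw [Finsupp.sup_apply, Divisor.div_apply, Finsupp.coe_zero, Pi.zero_apply]
    congr 1
    rcases le_total (P.ord y) 0 with h | h
    · rw [sup_eq_right.2 h] at hP; exact absurd rfl hP
    · exact sup_eq_left.2 h
  · rw [Finsupp.mem_support_iff, Finsupp.sup_apply, Divisor.div_apply, Finsupp.coe_zero,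
      Pi.zero_apply] at hP
    by_contra h
    exact hP (sup_eq_right.2 (not_lt.1 h))

end Degree

/-! ### Riemann-Roch spaces -/

section RiemannRoch

theorem relLength_bot {R M : Type*} [Ring R] [AddCommGroup M] [Module R M] (B : Submodule R M) :
    relLength ⊥ B = Module.length R B :=
  relLength_of_surjective LinearMap.id Function.surjective_id fun b => by simp

theorem relLength_map {R M N : Type*} [Ring R] [AddCommGroup M] [Module R M] [AddCommGroup N]
    [Module R N] {f : M →ₗ[R] N} (hf : Function.Injective f) (A B : Submodule R M) :
    relLength (A.map f) (B.map f) = relLength A B := by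
  let e := B.equivMapOfInjective f hf
  refine relLength_of_surjective ((A.submoduleOf B).mkQ ∘ₗ e.symm.toLinearMap)
    ((Submodule.mkQ_surjective _).comp e.symm.surjective) fun b => ?_
  obtain ⟨b, rfl⟩ := e.surjective b
  rw [LinearMap.comp_apply, LinearEquiv.coe_coe, LinearEquiv.symm_apply_apply, Submodule.mkQ_apply,
    Submodule.Quotient.mk_eq_zero, mem_submoduleOf, Submodule.coe_equivMapOfInjective_apply]
  exact (hf.mem_set_image (s := (A : Set M)) (a := (b : M))).symm

theorem finite_of_length_ne_top {F M : Type*} [Field F] [AddCommGroup M] [Module F M]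
    (h : Module.length F M ≠ ⊤) : Module.Finite F M := by
  have := (isFiniteLength_iff_isNoetherian_isArtinian.1 (Module.length_ne_top_iff.1 h)).1
  infer_instance

variable {F K : Type*} [Field F] [Field K] [Algebra F K]

theorem mem_H0 {E : Divisor F K} {f : K} : f ∈ H0 E ↔ ∀ P : Place F K, f ∈ P.stalk (E P) := by
  simp [H0]

theorem H0_mono : Monotone (H0 : Divisor F K → Submodule F K) := fun _ _ h _ hf =>
  mem_H0.2 fun P => P.stalk_mono (h P) (mem_H0.1 hf P)

/-- The families of functions, indexed by the closed points, with the `P`-th member in the stalk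
of `O(E)` at `P`. -/
def adele (E : Divisor F K) : Submodule F (Place F K → K) :=
  Submodule.pi Set.univ fun P => P.stalk (E P)

theorem mem_adele {E : Divisor F K} {r : Place F K → K} :
    r ∈ adele E ↔ ∀ P : Place F K, r P ∈ P.stalk (E P) := by
  simp [adele]

theorem adele_mono : Monotone (adele : Divisor F K → Submodule F (Place F K → K)) :=
  fun _ _ h _ hf => mem_adele.2 fun P => P.stalk_mono (h P) (mem_adele.1 hf P)

variable (F K) in
/-- The map which sends a function to the constant family. -/
def diagonal : K →ₗ[F] (Place F K → K) := LinearMap.pi fun _ => LinearMap.id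

theorem diagonal_apply (f : K) (P : Place F K) : diagonal F K f P = f := rfl

theorem map_diagonal_H0 (E : Divisor F K) :
    (H0 E).map (diagonal F K) = adele E ⊓ LinearMap.range (diagonal F K) := by
  ext r
  constructor
  · rintro ⟨f, hf, rfl⟩
    exact ⟨mem_adele.2 (mem_H0.1 hf), f, rfl⟩
  · rintro ⟨hf, f, rfl⟩
    exact ⟨f, mem_H0.2 (mem_adele.1 hf), rfl⟩

/-- The constants are the functions without poles. -/
theorem mem_H0_zero [IsCurveFunctionField F K] {f : K} :
    f ∈ H0 (0 : Divisor F K) ↔ f ∈ Set.range (algebraMap F K) := by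
  constructor
  · intro hf
    by_contra h
    obtain ⟨P, hP⟩ := exists_notMem_of_transcendental (transcendental_iff.2 h)
    exact hP (P.mem_stalk_zero.1 (mem_H0.1 hf P))
  · rintro ⟨c, rfl⟩
    exact mem_H0.2 fun P => P.mem_stalk_zero.2 (P.algebraMap_mem c)

variable (F K) in
theorem length_H0_zero [IsCurveFunctionField F K] : Module.length F (H0 (0 : Divisor F K)) = 1 := by
  let φ : F →ₗ[F] H0 (0 : Divisor F K) :=
    (Algebra.linearMap F K).codRestrict _ fun c => mem_H0_zero.2 ⟨c, rfl⟩
  have hφ : Function.Bijective φ := by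
    constructor
    · intro a b h
      exact (algebraMap F K).injective (congrArg Subtype.val h)
    · rintro ⟨f, hf⟩
      obtain ⟨c, rfl⟩ := mem_H0_zero.1 hf
      exact ⟨c, rfl⟩
  rw [← (LinearEquiv.ofBijective φ hφ).length_eq, Module.length_eq_finrank, Module.finrank_self]
  rfl

variable (F K) in
theorem exists_place [IsCurveFunctionField F K] : Nonempty (Place F K) := by
  obtain ⟨x, hx, -⟩ := IsCurveFunctionField.exists_finite (k := F) (K := K)
  exact ⟨(exists_notMem_of_transcendental hx).choose⟩

theorem relLength_adele_add_single [IsCurveFunctionField F K] (E : Divisor F K) (P : Place F K) :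
    relLength (adele E) (adele (E + Finsupp.single P 1)) = P.degree := by
  classical
  obtain ⟨φ, hφ, hker⟩ := P.exists_residue (E P + 1)
  have hmem : ∀ r : adele (E + Finsupp.single P 1 : Divisor F K),
      (r : Place F K → K) P ∈ P.stalk (E P + 1) := fun r => by
    have := mem_adele.1 r.2 P
    rwa [add_single_apply_self] at this
  let ev : adele (E + Finsupp.single P 1 : Divisor F K) →ₗ[F] P.stalk (E P + 1) :=
    { toFun := fun r => ⟨_, hmem r⟩
      map_add' := fun _ _ => rfl
      map_smul' := fun _ _ => rfl }
  rw [relLength_of_surjective (φ ∘ₗ ev), P.length_residueField]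
  · refine hφ.comp fun f => ⟨⟨Pi.single P (f : K), mem_adele.2 fun Q => ?_⟩, Subtype.ext ?_⟩
    · by_cases hQ : Q = P
      · subst hQ
        rw [Pi.single_eq_same, add_single_apply_self]
        exact f.2
      · rw [Pi.single_eq_of_ne hQ]
        exact zero_mem _
    · exact Pi.single_eq_same (M := fun _ : Place F K => K) P (f : K)
  · intro r
    rw [LinearMap.comp_apply, hker, add_sub_cancel_right, mem_adele]
    constructor
    · intro hr Q
      by_cases hQ : Q = P
      · subst hQ; exact hr
      · have := mem_adele.1 r.2 Q
        rwa [add_single_apply_of_ne hQ] at this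
    · exact fun h => h P

theorem relLength_adele [IsCurveFunctionField F K] {E E' : Divisor F K} (h : E ≤ E') :
    relLength (adele E) (adele E') = ((E'.deg - E.deg).toNat : ℕ∞) := by
  have := relLength_of_step (adele : Divisor F K → _) adele_mono Set.univ
    (fun E P _ => relLength_adele_add_single E P) (sub_nonneg.2 h) (fun P _ => Set.mem_univ P) E
  rwa [add_sub_cancel, Divisor.deg_sub] at this

theorem deg_mono {E E' : Divisor F K} (h : E ≤ E') : E.deg ≤ E'.deg := by
  have := Divisor.deg_nonneg (sub_nonneg.2 h)
  rw [Divisor.deg_sub] at this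
  omega

theorem relLength_adele_inf_add_sup [IsCurveFunctionField F K] {E E' : Divisor F K} (h : E ≤ E') :
    ((E'.deg - E.deg).toNat : ℕ∞) = relLength (H0 E) (H0 E') +
      relLength (adele E ⊔ LinearMap.range (diagonal F K))
        (adele E' ⊔ LinearMap.range (diagonal F K)) := by
  obtain ⟨P⟩ := exists_place F K
  have hinj : Function.Injective (diagonal F K) := fun f g hfg => congrFun hfg P
  rw [← relLength_adele h, relLength_eq_inf_add_sup (adele_mono h) (LinearMap.range (diagonal F K)),
    ← map_diagonal_H0, ← map_diagonal_H0, relLength_map hinj]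

theorem length_H0_add [IsCurveFunctionField F K] {E E' : Divisor F K} (h : E ≤ E') :
    Module.length F (H0 E') = Module.length F (H0 E) + relLength (H0 E) (H0 E') := by
  rw [← relLength_bot, ← relLength_bot, relLength_add bot_le (H0_mono h)]

instance finite_H0 [IsCurveFunctionField F K] (E : Divisor F K) : Module.Finite F (H0 E) := by
  have h1 := relLength_adele_inf_add_sup (le_sup_right : 0 ≤ E ⊔ 0)
  have h2 := length_H0_add (le_sup_right : 0 ≤ E ⊔ 0)
  have h3 := length_H0_add (le_sup_left : E ≤ E ⊔ 0)
  rw [length_H0_zero] at h2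
  refine finite_of_length_ne_top fun htop => ?_
  rw [htop, top_add, h2] at h3
  have h4 : relLength (H0 (0 : Divisor F K)) (H0 (E ⊔ 0)) ≠ ⊤ := fun h5 => by
    rw [h5, top_add] at h1
    exact ENat.natCast_ne_top _ h1
  exact (ENat.add_eq_top.1 h3).elim ENat.one_ne_top h4

/-- The dimension of `H⁰(O(E))`. -/
def h0 (E : Divisor F K) : ℕ := Module.finrank F (H0 E)

theorem length_H0 [IsCurveFunctionField F K] (E : Divisor F K) :
    Module.length F (H0 E) = h0 E := Module.length_eq_finrank _ _

variable (F K) in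
theorem h0_zero [IsCurveFunctionField F K] : h0 (0 : Divisor F K) = 1 := by
  have := length_H0_zero F K
  rw [length_H0] at this
  exact_mod_cast this

theorem exists_relLength_H0 [IsCurveFunctionField F K] {E E' : Divisor F K} (h : E ≤ E') :
    ∃ a b : ℕ, relLength (H0 E) (H0 E') = a ∧
      relLength (adele E ⊔ LinearMap.range (diagonal F K))
        (adele E' ⊔ LinearMap.range (diagonal F K)) = b ∧
      (h0 E' : ℤ) = h0 E + a ∧ E'.deg - E.deg = a + b := by
  have h1 := relLength_adele_inf_add_sup h
  have h2 := length_H0_add h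
  have h3 : relLength (H0 E) (H0 E') ≠ ⊤ := fun h5 => by
    rw [h5, top_add] at h1
    exact ENat.natCast_ne_top _ h1
  have h4 : relLength (adele E ⊔ LinearMap.range (diagonal F K))
      (adele E' ⊔ LinearMap.range (diagonal F K)) ≠ ⊤ := fun h5 => by
    rw [h5, add_top] at h1
    exact ENat.natCast_ne_top _ h1
  obtain ⟨a, ha⟩ := ENat.ne_top_iff_exists.1 h3
  obtain ⟨b, hb⟩ := ENat.ne_top_iff_exists.1 h4
  refine ⟨a, b, ha.symm, hb.symm, ?_, ?_⟩
  · rw [length_H0, length_H0, ← ha] at h2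
    exact_mod_cast h2
  · rw [← ha, ← hb] at h1
    have h5 : (E'.deg - E.deg).toNat = a + b := by exact_mod_cast h1
    have := deg_mono h
    omega

theorem h0_le_h0_add_deg [IsCurveFunctionField F K] {E E' : Divisor F K} (h : E ≤ E') :
    (h0 E' : ℤ) ≤ h0 E + (E'.deg - E.deg) := by
  obtain ⟨a, b, -, -, h1, h2⟩ := exists_relLength_H0 h
  omega

theorem mul_mem_H0_iff [IsCurveFunctionField F K] {f g : K} (hf : f ≠ 0) {E : Divisor F K} :
    f * g ∈ H0 E ↔ g ∈ H0 (E + Divisor.div f) := by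
  rw [mem_H0, mem_H0]
  exact forall_congr' fun P => P.mul_mem_stalk_iff hf

theorem h0_add_div [IsCurveFunctionField F K] {f : K} (hf : f ≠ 0) (E : Divisor F K) :
    h0 (E + Divisor.div f) = h0 E := by
  let φ : H0 (E + Divisor.div f) →ₗ[F] H0 E :=
    { toFun := fun g => ⟨f * g, (mul_mem_H0_iff hf).2 g.2⟩
      map_add' := fun _ _ => Subtype.ext (mul_add _ _ _)
      map_smul' := fun _ _ => Subtype.ext (mul_smul_comm _ _ _) }
  refine (LinearEquiv.ofBijective φ ⟨fun a b h => ?_, fun g => ?_⟩).finrank_eq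
  · exact Subtype.ext (mul_left_cancel₀ hf (congrArg Subtype.val h))
  · refine ⟨⟨f⁻¹ * g, ?_⟩, Subtype.ext ?_⟩
    · rw [← mul_mem_H0_iff hf, mul_inv_cancel_left₀ hf]
      exact g.2
    · exact mul_inv_cancel_left₀ hf _

theorem div_inv [IsCurveFunctionField F K] (f : K) :
    Divisor.div f⁻¹ = -(Divisor.div f : Divisor F K) := by
  ext P
  exact P.ord_inv f

theorem div_sup_zero_sub [IsCurveFunctionField F K] (f : K) :
    (Divisor.div f ⊔ 0 : Divisor F K) - (Divisor.div f⁻¹ ⊔ 0) = Divisor.div f := by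
  ext P
  rw [div_inv, Finsupp.sub_apply, Finsupp.sup_apply, Finsupp.sup_apply, Finsupp.neg_apply,
    Finsupp.coe_zero, Pi.zero_apply]
  omega

/-! ### The degree of a principal divisor -/

theorem Place.mem_of_isIntegral_adjoin (P : Place F K) {x b : K} (hxP : x ∈ P.O)
    (hb : IsIntegral (Algebra.adjoin F {x}) b) : b ∈ P.O := by
  have hle : ∀ a ∈ Algebra.adjoin F {x}, a ∈ P.O := fun a ha =>
    (Algebra.adjoin_le (S := P.toSubalgebra) (Set.singleton_subset_iff.2 hxP)) ha
  obtain ⟨p, hp, hp0⟩ := hb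
  have hint : IsIntegral P.O b := by
    refine ⟨p.map (Subring.inclusion (S := (Algebra.adjoin F {x}).toSubring)
      (T := P.O.toSubring) hle), hp.map _, ?_⟩
    rw [Polynomial.eval₂_map]
    exact hp0
  obtain ⟨a, ha⟩ := IsIntegrallyClosed.isIntegral_iff.1 hint
  rw [← ha]
  exact a.2

theorem linearIndependent_gen_pow {x : K} (hx : Transcendental F x) (l : ℕ) :
    LinearIndependent F fun j : Fin l =>
      (IntermediateField.AdjoinSimple.gen F x) ^ (j : ℕ) := by
  classical
  rw [Fintype.linearIndependent_iff]
  intro c hc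
  have h1 : Polynomial.aeval x (∑ j : Fin l, Polynomial.monomial (j : ℕ) (c j)) = 0 := by
    have := congrArg (algebraMap (IntermediateField.adjoin F {x}) K) hc
    rw [map_sum, map_zero] at this
    rw [map_sum, ← this]
    refine Finset.sum_congr rfl fun j _ => ?_
    rw [Polynomial.aeval_monomial, ← Algebra.smul_def]
    rfl
  have h2 : ∑ j : Fin l, Polynomial.monomial (j : ℕ) (c j) = 0 := by
    by_contra hne
    exact hx ⟨_, hne, h1⟩
  intro j
  have h3 := congrArg (fun p => Polynomial.coeff p (j : ℕ)) h2
  simpa [Polynomial.finsetSum_coeff, Polynomial.coeff_monomial, Fin.val_inj] using h3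

open scoped IntermediateField.algebraAdjoinAdjoin in
/-- The spaces `H⁰(O(m B))`, for `B` the divisor of poles of `x`, grow at least with the slope
`[K : F(x)]`: they contain the products of powers of `x` with the members of a basis of `K` over
`F(x)` which is integral over `F[x]`. -/
theorem exists_le_h0_poles [IsCurveFunctionField F K] {x : K} (hx : Transcendental F x) :
    ∃ m : ℕ, ∀ l : ℕ, Module.finrank (IntermediateField.adjoin F {x}) K * (l + 1) ≤
      h0 ((m + l) • (Divisor.div x⁻¹ ⊔ 0 : Divisor F K)) := by
  classical
  have hx0 : x ≠ 0 := by
    rintro rfl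
    exact hx isAlgebraic_zero
  have := IsCurveFunctionField.finiteDimensional_adjoin hx
  obtain ⟨s, b, hb⟩ := FiniteDimensional.exists_is_basis_integral (Algebra.adjoin F {x})
    (IntermediateField.adjoin F {x}) K
  set B : Divisor F K := Divisor.div x⁻¹ ⊔ 0 with hB
  have hBP : ∀ P : Place F K, B P = max (-P.ord x) 0 := fun P => by
    rw [hB, Finsupp.sup_apply, Divisor.div_apply, P.ord_inv]
    rfl
  set m : ℕ := B.support.sup fun P => Finset.univ.sup fun i => (P.ord (b i)).natAbs with hm
  refine ⟨m, fun l => ?_⟩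
  have hreg : ∀ i, ∀ P : Place F K, x ∈ P.O → b i ∈ P.O := fun i P hxP =>
    P.mem_of_isIntegral_adjoin hxP (hb i)
  let z : Fin (l + 1) × s → K := fun p => x ^ (p.1 : ℕ) * b p.2
  have hz : ∀ p, z p ∈ H0 ((m + l) • B) := fun p => by
    rw [mem_H0]
    intro P
    rw [P.mem_stalk_iff_ord (mul_ne_zero (pow_ne_zero _ hx0) (b.ne_zero _)),
      P.ord_mul (pow_ne_zero _ hx0) (b.ne_zero _), P.ord_pow, Finsupp.smul_apply, hBP,
      nsmul_eq_mul]
    push_cast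
    have hp1 : ((p.1 : ℕ) : ℤ) ≤ l := by
      have := p.1.2
      omega
    rcases le_or_gt 0 (P.ord x) with h0 | h0
    · have h1 := hreg p.2 P (by
        rw [← P.mem_stalk_zero, P.mem_stalk_iff_ord hx0]
        simpa using h0)
      rw [← P.mem_stalk_zero, P.mem_stalk_iff_ord (b.ne_zero _)] at h1
      rw [max_eq_right (by omega)]
      have : 0 ≤ ((p.1 : ℕ) : ℤ) * P.ord x := mul_nonneg (Int.natCast_nonneg _) h0
      omega
    · have hP : P ∈ B.support := by
        rw [Finsupp.mem_support_iff, hBP]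
        omega
      have h1 : (P.ord (b p.2)).natAbs ≤ m :=
        (Finset.le_sup (f := fun i => (P.ord (b i)).natAbs) (Finset.mem_univ p.2)).trans
          (Finset.le_sup (f := fun P => Finset.univ.sup fun i => (P.ord (b i)).natAbs) hP)
      rw [max_eq_left (by omega)]
      have h2 : -(m : ℤ) ≤ P.ord (b p.2) := by omega
      nlinarith
  have hpow := linearIndependent_gen_pow hx (l + 1)
  have hli : LinearIndependent F z := linearIndependent_smul hpow b.linearIndependent
  have hli' : LinearIndependent F fun p => (⟨z p, hz p⟩ : H0 ((m + l) • B)) :=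
    LinearIndependent.of_comp (H0 ((m + l) • B)).subtype hli
  have hcard := hli'.fintype_card_le_finrank
  rw [Fintype.card_prod, Fintype.card_fin, ← Module.finrank_eq_card_basis b, mul_comm] at hcard
  exact hcard

/-- The divisor of poles of `x` has degree `[K : F(x)]`. -/
theorem deg_poles [IsCurveFunctionField F K] {x : K} (hx : Transcendental F x) :
    (Divisor.div x⁻¹ ⊔ 0 : Divisor F K).deg =
      Module.finrank (IntermediateField.adjoin F {x}) K := by
  have hinv : IntermediateField.adjoin F {x⁻¹} = IntermediateField.adjoin F {x} := by
    refine le_antisymm (IntermediateField.adjoin_simple_le_iff.2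
      (inv_mem (IntermediateField.mem_adjoin_simple_self F x)))
      (IntermediateField.adjoin_simple_le_iff.2 ?_)
    have := inv_mem (IntermediateField.mem_adjoin_simple_self F x⁻¹)
    rwa [inv_inv] at this
  have hx' : Transcendental F x⁻¹ := fun h => hx (by simpa using h.inv)
  have h1 := deg_div_sup_zero_le hx'
  rw [hinv] at h1
  refine le_antisymm h1 ?_
  obtain ⟨m, hm⟩ := exists_le_h0_poles hx
  set n := Module.finrank (IntermediateField.adjoin F {x}) K
  set B : Divisor F K := Divisor.div x⁻¹ ⊔ 0
  by_contra hlt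
  have hB : 0 ≤ B := le_sup_right
  -- compare the slopes at a large multiple of `B`
  have h2 := hm (1 + m * n)
  have h3 := h0_le_h0_add_deg (nsmul_nonneg hB (m + (1 + m * n)))
  rw [h0_zero, Divisor.deg_zero, Divisor.deg_nsmul] at h3
  have h4 : B.deg ≤ n - 1 := by omega
  have h5 : (n : ℤ) * (1 + m * n + 1) ≤ 1 + (m + (1 + m * n)) * (n - 1) := by
    have h6 : ((n * (1 + m * n + 1) : ℕ) : ℤ) ≤ 1 + ((m + (1 + m * n) : ℕ) : ℤ) * (n - 1) := by
      refine le_trans (by exact_mod_cast h2) (h3.trans ?_)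
      push_cast
      rw [sub_zero]
      have : (0 : ℤ) ≤ m + (1 + m * n) := by positivity
      nlinarith
    push_cast at h6
    exact h6
  have := IsCurveFunctionField.finiteDimensional_adjoin hx
  have hn : (0 : ℤ) < n := by exact_mod_cast Module.finrank_pos
  have hm0 : (0 : ℤ) ≤ m := Int.natCast_nonneg _
  nlinarith

theorem div_eq_zero_of_not_transcendental [IsCurveFunctionField F K] {f : K}
    (hf : ¬ Transcendental F f) : (Divisor.div f : Divisor F K) = 0 := by
  ext P
  rw [transcendental_iff, not_not] at hf
  obtain ⟨c, rfl⟩ := hf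
  exact P.ord_algebraMap c

/-- A principal divisor has degree zero. -/
theorem deg_div [IsCurveFunctionField F K] (f : K) : (Divisor.div f : Divisor F K).deg = 0 := by
  by_cases hf : Transcendental F f
  · have hf' : Transcendental F f⁻¹ := fun h => hf (by simpa using h.inv)
    have hinv : IntermediateField.adjoin F {f⁻¹} = IntermediateField.adjoin F {f} := by
      refine le_antisymm (IntermediateField.adjoin_simple_le_iff.2
        (inv_mem (IntermediateField.mem_adjoin_simple_self F f)))
        (IntermediateField.adjoin_simple_le_iff.2 ?_)
      have := inv_mem (IntermediateField.mem_adjoin_simple_self F f⁻¹)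
      rwa [inv_inv] at this
    have h1 := deg_poles hf
    have h2 := deg_poles hf'
    rw [inv_inv, hinv] at h2
    rw [← div_sup_zero_sub, Divisor.deg_sub, h1, h2, sub_self]
  · rw [div_eq_zero_of_not_transcendental hf, Divisor.deg_zero]

end RiemannRoch

/-! ### Finiteness of cohomology and the Riemann-Roch formula -/

section Cohomology

variable {F K : Type*} [Field F] [Field K] [Algebra F K]

theorem mem_repartitions {r : Place F K → K} :
    r ∈ Repartitions F K ↔ {P : Place F K | r P ∉ P.stalk 0}.Finite := Iff.rfl

theorem adele_le_repartitions (E : Divisor F K) : adele E ≤ Repartitions F K := fun r hr => by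
  refine E.support.finite_toSet.subset fun P hP => ?_
  by_contra h
  rw [Finset.mem_coe, Finsupp.notMem_support_iff] at h
  have := mem_adele.1 hr P
  rw [h] at this
  exact hP this

theorem exists_mem_adele {r : Place F K → K} (hr : r ∈ Repartitions F K) :
    ∃ E : Divisor F K, 0 ≤ E ∧ r ∈ adele E := by
  classical
  refine ⟨Finsupp.ofSupportFinite (fun P => max (-P.ord (r P)) 0)
    ((mem_repartitions.1 hr).subset fun P hP hrP => hP ?_), fun P => le_max_right _ _,
    mem_adele.2 fun P => ?_⟩
  · by_cases h0 : r P = 0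
    · change max (-P.ord (r P)) 0 = 0
      rw [h0, P.ord_zero]; rfl
    · rw [P.mem_stalk_iff_ord h0] at hrP
      exact max_eq_right (by omega)
  · by_cases h0 : r P = 0
    · rw [h0]; exact zero_mem _
    · rw [P.mem_stalk_iff_ord h0]
      have := le_max_left (-P.ord (r P)) 0
      change -max (-P.ord (r P)) 0 ≤ P.ord (r P)
      omega

theorem diagonal_le_repartitions [IsCurveFunctionField F K] :
    LinearMap.range (diagonal F K) ≤ Repartitions F K := by
  rintro _ ⟨f, rfl⟩
  refine (finite_ord_ne_zero f).subset fun P hP => ?_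
  rw [Set.mem_ofPred_eq] at hP ⊢
  rw [diagonal_apply] at hP
  intro h
  apply hP
  by_cases h0 : f = 0
  · rw [h0]; exact zero_mem _
  · rw [P.mem_stalk_iff_ord h0, h]
    simp

/-- The sum of the families which are regular up to `E` and of the constant families. -/
def adeleAddDiagonal (E : Divisor F K) : Submodule F (Place F K → K) :=
  adele E ⊔ LinearMap.range (diagonal F K)

theorem adeleAddDiagonal_mono : Monotone (adeleAddDiagonal : Divisor F K → _) :=
  fun _ _ h => sup_le_sup_right (adele_mono h) _

theorem adeleAddDiagonal_le_repartitions [IsCurveFunctionField F K] (E : Divisor F K) :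
    adeleAddDiagonal E ≤ Repartitions F K :=
  sup_le (adele_le_repartitions E) diagonal_le_repartitions

variable (F K) in
/-- The defect `deg E - h⁰(O(E))` is bounded: `E` is at most a multiple of the divisor of poles of
a fixed function plus a principal divisor. -/
theorem exists_deg_sub_h0_le [IsCurveFunctionField F K] :
    ∃ c : ℕ, ∀ E : Divisor F K, 0 ≤ E → E.deg - h0 E ≤ c := by
  obtain ⟨x, hx, -⟩ := IsCurveFunctionField.exists_finite (k := F) (K := K)
  obtain ⟨m, hm⟩ := exists_le_h0_poles hx
  have hdeg := deg_poles hx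
  have := IsCurveFunctionField.finiteDimensional_adjoin hx
  set n := Module.finrank (IntermediateField.adjoin F {x}) K
  set B : Divisor F K := Divisor.div x⁻¹ ⊔ 0
  have hn : (0 : ℤ) < n := by exact_mod_cast Module.finrank_pos
  refine ⟨m * n, fun E hE => ?_⟩
  have hE0 := Divisor.deg_nonneg hE
  set l := E.deg.toNat
  have hl : (l : ℤ) = E.deg := Int.toNat_of_nonneg hE0
  have h1 : (n : ℤ) * (l + 1) ≤ h0 ((m + l) • B) := by exact_mod_cast hm l
  have h2 := h0_le_h0_add_deg (sub_le_self ((m + l) • B) hE)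
  rw [Divisor.deg_sub] at h2
  have h3 : 0 < h0 ((m + l) • B - E) := by
    have : (l : ℤ) + 1 ≤ n * (l + 1) := by nlinarith
    omega
  have : Nontrivial (H0 ((m + l) • B - E)) := Module.finrank_pos_iff.1 h3
  obtain ⟨f, hf⟩ := exists_ne (0 : H0 ((m + l) • B - E))
  have hf0 : (f : K) ≠ 0 := fun h => hf (Subtype.ext h)
  have hle : E ≤ (m + l) • B + Divisor.div (f : K) := fun P => by
    have := mem_H0.1 f.2 P
    rw [P.mem_stalk_iff_ord hf0, Finsupp.sub_apply] at this
    rw [Finsupp.add_apply, Divisor.div_apply]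
    omega
  have h4 := h0_le_h0_add_deg hle
  rw [h0_add_div hf0, Divisor.deg_add, deg_div, Divisor.deg_nsmul, hdeg] at h4
  push_cast at h4 ⊢
  nlinarith

variable (F K) in
theorem finite_quotient_repartitions_zero [IsCurveFunctionField F K] : Module.Finite F
    (Repartitions F K ⧸ (adeleAddDiagonal (0 : Divisor F K)).submoduleOf (Repartitions F K)) := by
  obtain ⟨c, hc⟩ := exists_deg_sub_h0_le F K
  refine Module.rank_lt_aleph0_iff.1 (lt_of_le_of_lt (b := ((c + 1 : ℕ) : Cardinal)) ?_
    Cardinal.natCast_lt_aleph0)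
  refine rank_le fun s hs => ?_
  classical
  choose r hr using Submodule.mkQ_surjective
    ((adeleAddDiagonal (0 : Divisor F K)).submoduleOf (Repartitions F K))
  choose A hA0 hA using fun q => exists_mem_adele (r q).2
  set E : Divisor F K := ∑ q ∈ s, A q
  have hE : 0 ≤ E := Finset.sum_nonneg fun q _ => hA0 q
  have hrE : ∀ q ∈ s, (r q : Place F K → K) ∈ adeleAddDiagonal E := fun q hq =>
    (le_sup_left : adele E ≤ _) (adele_mono
      (Finset.single_le_sum (f := A) (fun q _ => hA0 q) hq) (hA q))
  obtain ⟨a, b, -, hb, h1, h2⟩ := exists_relLength_H0 hE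
  rw [h0_zero, Divisor.deg_zero] at *
  have hbc : b ≤ c + 1 := by
    have := hc E hE
    omega
  refine le_trans ?_ hbc
  have hb' : Module.length F (adeleAddDiagonal E ⧸
    (adeleAddDiagonal (0 : Divisor F K)).submoduleOf (adeleAddDiagonal E)) = b := hb
  have hfin := finite_of_length_ne_top (hb' ▸ ENat.natCast_ne_top b)
  rw [Module.length_eq_finrank] at hb'
  have hle : (adeleAddDiagonal (0 : Divisor F K)).submoduleOf (adeleAddDiagonal E) ≤
      ((adeleAddDiagonal (0 : Divisor F K)).submoduleOf (Repartitions F K)).comap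
        (Submodule.inclusion (adeleAddDiagonal_le_repartitions E)) := fun x hx => hx
  let ψ := Submodule.mapQ _ _ _ hle
  have hli : LinearIndependent F fun q : s =>
      Submodule.mkQ ((adeleAddDiagonal (0 : Divisor F K)).submoduleOf (adeleAddDiagonal E))
        ⟨r q, hrE q q.2⟩ := by
    refine LinearIndependent.of_comp ψ ?_
    convert hs using 1
    funext q
    exact hr q
  have hcard := hli.fintype_card_le_finrank
  rw [Fintype.card_coe] at hcard
  have hb'' : Module.finrank F (adeleAddDiagonal E ⧸
    (adeleAddDiagonal (0 : Divisor F K)).submoduleOf (adeleAddDiagonal E)) = b := by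
    exact_mod_cast hb'
  omega

variable (F K) in
/-- The space `H¹(O)` is finite dimensional. -/
instance finite_H1 [IsCurveFunctionField F K] : Module.Finite F (H1 F K) :=
  finite_quotient_repartitions_zero F K

/-- The dimension of `H¹(O(E))`, as the quotient of the repartitions by the sum of those which are
regular up to `E` and of the constant families. -/
def h1 (E : Divisor F K) : ℕ :=
  Module.finrank F (Repartitions F K ⧸ (adeleAddDiagonal E).submoduleOf (Repartitions F K))

variable (F K) in
theorem h1_zero : h1 (0 : Divisor F K) = genus F K := rfl

theorem relLength_zero_repartitions [IsCurveFunctionField F K] :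
    relLength (adeleAddDiagonal (0 : Divisor F K)) (Repartitions F K) = genus F K :=
  Module.length_eq_finrank F (H1 F K)

theorem relLength_repartitions_ne_top [IsCurveFunctionField F K] (E : Divisor F K) :
    relLength (adeleAddDiagonal E) (Repartitions F K) ≠ ⊤ := by
  have hle : relLength (adeleAddDiagonal E) (Repartitions F K) ≤
      relLength (adeleAddDiagonal (E ⊓ 0)) (Repartitions F K) := by
    rw [relLength_add (adeleAddDiagonal_mono (inf_le_left : E ⊓ 0 ≤ E))
      (adeleAddDiagonal_le_repartitions E)]
    exact le_add_self
  obtain ⟨a, b, -, hb, -, -⟩ := exists_relLength_H0 (inf_le_right : E ⊓ 0 ≤ 0)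
  refine ne_top_of_le_ne_top ?_ hle
  rw [relLength_add (adeleAddDiagonal_mono (inf_le_right : E ⊓ 0 ≤ 0))
    (adeleAddDiagonal_le_repartitions 0), relLength_zero_repartitions]
  refine fun h => (ENat.add_eq_top.1 h).elim (fun h => ?_) (ENat.natCast_ne_top _)
  have := hb.symm.trans h
  exact ENat.natCast_ne_top _ this

instance finite_quotient_repartitions [IsCurveFunctionField F K] (E : Divisor F K) :
    Module.Finite F (Repartitions F K ⧸ (adeleAddDiagonal E).submoduleOf (Repartitions F K)) :=
  finite_of_length_ne_top (relLength_repartitions_ne_top E)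

theorem relLength_repartitions [IsCurveFunctionField F K] (E : Divisor F K) :
    relLength (adeleAddDiagonal E) (Repartitions F K) = h1 E :=
  Module.length_eq_finrank _ _

/-- The Riemann-Roch formula without duality, for the difference of two divisors. -/
theorem h0_sub_h1_of_le [IsCurveFunctionField F K] {E E' : Divisor F K} (h : E ≤ E') :
    (h0 E' : ℤ) - h1 E' - E'.deg = h0 E - h1 E - E.deg := by
  obtain ⟨a, b, -, hb, hh, hd⟩ := exists_relLength_H0 h
  have h3 := relLength_add (adeleAddDiagonal_mono h) (adeleAddDiagonal_le_repartitions E')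
  rw [relLength_repartitions, relLength_repartitions] at h3
  have h4 : (h1 E : ℕ∞) = b + h1 E' := by
    rw [h3]
    exact congrArg (· + (h1 E' : ℕ∞)) hb
  have h5 : h1 E = b + h1 E' := by exact_mod_cast h4
  omega

/-- The Riemann-Roch formula without duality. -/
theorem h0_sub_h1 [IsCurveFunctionField F K] (E : Divisor F K) :
    (h0 E : ℤ) - h1 E = E.deg + 1 - genus F K := by
  have h2 := h0_sub_h1_of_le (inf_le_left : E ⊓ 0 ≤ E)
  have h3 := h0_sub_h1_of_le (inf_le_right : E ⊓ 0 ≤ 0)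
  rw [h0_zero, h1_zero, Divisor.deg_zero] at h3
  omega

theorem mul_mem_repartitions [IsCurveFunctionField F K] (s : K) {r : Place F K → K}
    (hr : r ∈ Repartitions F K) : (fun P => s * r P) ∈ Repartitions F K := by
  refine (Set.Finite.union (mem_repartitions.1 hr) (finite_ord_ne_zero s)).subset fun P hP => ?_
  by_contra h
  simp only [Set.mem_union, Set.mem_ofPred_eq, not_or, not_not] at h
  apply hP
  by_cases hs : s = 0
  · change s * r P ∈ P.stalk 0
    rw [hs, zero_mul]; exact zero_mem _
  · change s * r P ∈ P.stalk 0
    rw [P.mul_mem_stalk_iff hs, h.2]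
    exact h.1

/-- `H¹(O(E))` vanishes for `deg E > 2 g - 2`. A nonzero linear form on it would give an injection
of `H⁰(O(E))` into the dual of `H¹(O)`, since the multiplication by a section `s ≠ 0` maps `H¹(O)`
onto `H¹(O(E))`; but `H⁰(O(E))` then has dimension greater than `g` by Riemann-Roch. -/
theorem h1_eq_zero [IsCurveFunctionField F K] {E : Divisor F K}
    (hE : 2 * (genus F K : ℤ) - 2 < E.deg) : h1 E = 0 := by
  by_contra hne
  have hnt : Nontrivial (Repartitions F K ⧸
      (adeleAddDiagonal E).submoduleOf (Repartitions F K)) :=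
    Module.finrank_pos_iff.1 (Nat.pos_of_ne_zero hne)
  obtain ⟨w', hw'⟩ := exists_ne (0 : Module.Dual F (Repartitions F K ⧸
      (adeleAddDiagonal E).submoduleOf (Repartitions F K)))
  let w : Module.Dual F (Repartitions F K) := w' ∘ₗ Submodule.mkQ _
  have hw : w ≠ 0 := fun h => hw' (by
    ext q
    exact LinearMap.congr_fun h q)
  have hwE : ∀ r : Repartitions F K, (r : Place F K → K) ∈ adeleAddDiagonal E → w r = 0 :=
    fun r hr => by
      have h0 : Submodule.mkQ ((adeleAddDiagonal E).submoduleOf (Repartitions F K)) r = 0 :=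
        (Submodule.Quotient.mk_eq_zero _).2 hr
      change w' (Submodule.mkQ _ r) = 0
      rw [h0, map_zero]
  let mulL (s : K) : Repartitions F K →ₗ[F] Repartitions F K :=
    { toFun := fun r => ⟨fun P => s * r.1 P, mul_mem_repartitions s r.2⟩
      map_add' := fun r t => Subtype.ext (funext fun P => mul_add _ _ _)
      map_smul' := fun c r => Subtype.ext (funext fun P => mul_smul_comm _ _ _) }
  let T : H0 E →ₗ[F] ((adeleAddDiagonal (0 : Divisor F K)).submoduleOf
      (Repartitions F K)).dualAnnihilator :=
    { toFun := fun s => ⟨w ∘ₗ mulL s, by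
        rw [Submodule.mem_dualAnnihilator]
        intro r hr
        refine hwE _ ?_
        obtain ⟨a, ha, _, ⟨f, rfl⟩, hsum⟩ := Submodule.mem_sup.1 (mem_submoduleOf.1 hr)
        refine Submodule.mem_sup.2 ⟨fun P => s * a P, mem_adele.2 fun P => ?_, _,
          ⟨s * f, rfl⟩, ?_⟩
        · have := P.mul_mem_stalk (mem_H0.1 s.2 P) (mem_adele.1 ha P)
          rwa [Finsupp.coe_zero, Pi.zero_apply, add_zero] at this
        · funext P
          change (s : K) * a P + s * f = s * r.1 P
          rw [← hsum, ← mul_add]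
          rfl⟩
      map_add' := fun s t => by
        refine Subtype.ext (LinearMap.ext fun r => ?_)
        change w (mulL (s + t) r) = w (mulL s r) + w (mulL t r)
        rw [← map_add]
        exact congrArg w (Subtype.ext (funext fun P => add_mul _ _ _))
      map_smul' := fun c s => by
        refine Subtype.ext (LinearMap.ext fun r => ?_)
        change w (mulL (c • (s : K)) r) = c • w (mulL s r)
        rw [← map_smul]
        exact congrArg w (Subtype.ext (funext fun P => smul_mul_assoc _ _ _)) }
  have hT : Function.Injective T := by
    refine (injective_iff_map_eq_zero T).2 fun s hs => ?_
    by_contra hs0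
    have hs0' : (s : K) ≠ 0 := fun h => hs0 (Subtype.ext h)
    apply hw
    ext r
    have h1 : w (mulL s (mulL (s : K)⁻¹ r)) = 0 :=
      LinearMap.congr_fun (congrArg Subtype.val hs) (mulL (s : K)⁻¹ r)
    have h2 : mulL s (mulL (s : K)⁻¹ r) = r :=
      Subtype.ext (funext fun P => mul_inv_cancel_left₀ hs0' _)
    rw [h2] at h1
    exact h1
  have hdim : Module.finrank F ((adeleAddDiagonal (0 : Divisor F K)).submoduleOf
      (Repartitions F K)).dualAnnihilator = genus F K := by
    rw [← (Submodule.dualQuotEquivDualAnnihilator _).finrank_eq, Subspace.dual_finrank_eq]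
    rfl
  have hfin : Module.Finite F ((adeleAddDiagonal (0 : Divisor F K)).submoduleOf
      (Repartitions F K)).dualAnnihilator :=
    Module.Finite.equiv (Submodule.dualQuotEquivDualAnnihilator
      ((adeleAddDiagonal (0 : Divisor F K)).submoduleOf (Repartitions F K)))
  have hle : h0 E ≤ genus F K := by
    rw [← hdim]
    exact LinearMap.finrank_le_finrank_of_injective hT
  have := h0_sub_h1 E
  omega

theorem h0_eq [IsCurveFunctionField F K] {E : Divisor F K}
    (hE : 2 * (genus F K : ℤ) - 2 < E.deg) : (h0 E : ℤ) = E.deg + 1 - genus F K := by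
  have := h0_sub_h1 E
  rw [h1_eq_zero hE] at this
  omega

/-- For `deg E > 2 g - 2`, finitely many principal parts are those of a function, up to functions
in the stalks of `O(E)`. -/
theorem exists_sub_mem_stalk [IsCurveFunctionField F K] {E : Divisor F K}
    (hE : 2 * (genus F K : ℤ) - 2 < E.deg) {r : Place F K → K} (hr : r ∈ Repartitions F K) :
    ∃ f : K, ∀ P : Place F K, f - r P ∈ P.stalk (E P) := by
  have h := Module.finrank_zero_iff.1 (h1_eq_zero hE)
  have htop := Submodule.Quotient.subsingleton_iff.1 h
  have hmem : (⟨r, hr⟩ : Repartitions F K) ∈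
      (adeleAddDiagonal E).submoduleOf (Repartitions F K) := htop ▸ Submodule.mem_top
  obtain ⟨a, ha, _, ⟨f, rfl⟩, hsum⟩ := Submodule.mem_sup.1 (mem_submoduleOf.1 hmem)
  refine ⟨f, fun P => ?_⟩
  have : f - r P = -a P := by
    have := congrFun hsum P
    change a P + f = r P at this
    rw [← this]; ring
  rw [this, Submodule.neg_mem_iff]
  exact mem_adele.1 ha P

end Cohomology

/-! ### Frobenius-semilinear endomorphisms -/

section Lang

/-- The recursion for the coefficients of a fixed vector. For given `a₀, …, a_m` it yields
polynomials `p_m` in the last coefficient `t`, and `p_m = X² s` with `s ≠ 0` unless all `a_j`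
vanish. -/
theorem exists_fixed_coefficients {W : Type*} [Field W] [IsAlgClosed W] {q : ℕ} (hq2 : 2 ≤ q)
    (a : ℕ → W) (m : ℕ) (ha : ∃ j ≤ m, a j ≠ 0) :
    ∃ c : ℕ → W, c m ≠ 0 ∧ c 0 = a 0 * c m ^ q ∧
      ∀ i, c (i + 1) = c i ^ q + a (i + 1) * c m ^ q := by
  let p : ℕ → Polynomial W := fun i => Nat.rec (Polynomial.C (a 0) * Polynomial.X ^ q)
    (fun i r => r ^ q + Polynomial.C (a (i + 1)) * Polynomial.X ^ q) i
  have hp0 : p 0 = Polynomial.C (a 0) * Polynomial.X ^ q := rfl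
  have hps : ∀ i, p (i + 1) = p i ^ q + Polynomial.C (a (i + 1)) * Polynomial.X ^ q :=
    fun i => rfl
  have hdvd : ∀ i, Polynomial.X ^ q ∣ p i := fun i => by
    induction i with
    | zero => exact Dvd.intro_left _ rfl
    | succ i ih =>
      rw [hps]
      exact dvd_add (ih.trans (dvd_pow_self _ (by omega))) (Dvd.intro_left _ rfl)
  have hne : ∀ i, (∃ j ≤ i, a j ≠ 0) → p i ≠ 0 := fun i => by
    induction i with
    | zero =>
      rintro ⟨j, hj, hj0⟩
      obtain rfl : j = 0 := by omega
      rw [hp0]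
      exact mul_ne_zero (Polynomial.C_ne_zero.2 hj0) (pow_ne_zero _ Polynomial.X_ne_zero)
    | succ i ih =>
      rintro ⟨j, hj, hj0⟩ h
      -- the first term is divisible by a higher power of `X` than the second one
      have hd : Polynomial.X ^ (q * q) ∣ p i ^ q := by
        rw [pow_mul]; exact pow_dvd_pow_of_dvd (hdvd i) q
      have hc : a (i + 1) = 0 := by
        have h1 := congrArg (fun r => Polynomial.coeff r q) (hps i)
        simp only [h, Polynomial.coeff_zero, Polynomial.coeff_add, Polynomial.coeff_C_mul,
          Polynomial.coeff_X_pow, if_true, mul_one] at h1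
        rw [Polynomial.X_pow_dvd_iff.1 hd q (by nlinarith), zero_add] at h1
        exact h1.symm
      have hi : p i ≠ 0 := ih ⟨j, by
        rcases Nat.lt_or_ge i j with h2 | h2
        · obtain rfl : j = i + 1 := by omega
          exact absurd hc hj0
        · exact h2, hj0⟩
      rw [hps, hc, map_zero, zero_mul, add_zero] at h
      exact pow_ne_zero q hi h
  obtain ⟨s, hs⟩ : Polynomial.X ^ 2 ∣ p m := (pow_dvd_pow _ hq2).trans (hdvd m)
  have hs0 : s ≠ 0 := by
    rintro rfl
    rw [mul_zero] at hs
    exact hne m ha hs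
  obtain ⟨t, ht⟩ : ∃ t, (Polynomial.X * s - 1).IsRoot t := by
    refine IsAlgClosed.exists_root _ ?_
    have h1 : (1 : Polynomial W).degree < (Polynomial.X * s).degree := by
      rw [Polynomial.degree_one, mul_comm, Polynomial.degree_mul_X,
        Polynomial.degree_eq_natDegree hs0]
      exact_mod_cast Nat.succ_pos _
    rw [Polynomial.degree_sub_eq_left_of_degree_lt h1, mul_comm, Polynomial.degree_mul_X,
      Polynomial.degree_eq_natDegree hs0]
    exact ne_of_gt (by exact_mod_cast Nat.succ_pos s.natDegree)
  have ht1 : t * s.eval t = 1 := by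
    rw [Polynomial.IsRoot, Polynomial.eval_sub, Polynomial.eval_mul, Polynomial.eval_X,
      Polynomial.eval_one, sub_eq_zero] at ht
    exact ht
  have hpm : (p m).eval t = t := by
    rw [hs, Polynomial.eval_mul, Polynomial.eval_pow, Polynomial.eval_X, pow_two, mul_assoc, ht1,
      mul_one]
  refine ⟨fun i => (p i).eval t, ?_, ?_, fun i => ?_⟩
  · change (p m).eval t ≠ 0
    rw [hpm]
    rintro rfl
    rw [zero_mul] at ht1
    exact zero_ne_one ht1
  · change (p 0).eval t = a 0 * (p m).eval t ^ q
    rw [hpm, hp0]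
    simp
  · change (p (i + 1)).eval t = (p i).eval t ^ q + a (i + 1) * (p m).eval t ^ q
    rw [hpm, hps]
    simp

variable {k W : Type*} [Field k] [Fintype k] [Field W] [Algebra k W]

variable (k) in
/-- An element of `W` which is fixed by the `q`-th power map lies in the field with `q`
elements. -/
theorem exists_algebraMap_eq_of_pow_card_eq {w : W} (hw : w ^ Fintype.card k = w) :
    ∃ c : k, algebraMap k W c = w := by
  classical
  by_contra h
  have hne : (Polynomial.X ^ Fintype.card k - Polynomial.X : Polynomial W) ≠ 0 :=
    FiniteField.X_pow_card_sub_X_ne_zero W Fintype.one_lt_card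
  have hdeg : (Polynomial.X ^ Fintype.card k - Polynomial.X : Polynomial W).natDegree =
    Fintype.card k := FiniteField.X_pow_card_sub_X_natDegree_eq W Fintype.one_lt_card
  have hsub : (insert w (Finset.univ.image (algebraMap k W))).val ⊆
      (Polynomial.X ^ Fintype.card k - Polynomial.X : Polynomial W).roots := fun z hz => by
    rw [Polynomial.mem_roots hne, Polynomial.IsRoot, Polynomial.eval_sub, Polynomial.eval_pow,
      Polynomial.eval_X, sub_eq_zero]
    rw [Finset.mem_val, Finset.mem_insert, Finset.mem_image] at hz
    rcases hz with rfl | ⟨c, -, rfl⟩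
    · exact hw
    · rw [← map_pow, FiniteField.pow_card]
  have h1 := (Multiset.card_le_card ((Multiset.le_iff_subset (Finset.nodup _)).2 hsub)).trans
    (Polynomial.card_roots' _)
  rw [hdeg, Finset.card_val, Finset.card_insert_of_notMem (by simpa using h),
    Finset.card_image_of_injective _ (algebraMap k W).injective, Finset.card_univ] at h1
  omega

variable (k W) in
/-- The `q`-th power endomorphism of `W`. -/
abbrev frobHom : W →+* W := (FiniteField.frobeniusAlgHom k W).toRingHom

theorem frobHom_apply (w : W) : frobHom k W w = w ^ Fintype.card k := rfl

variable {V : Type*} [AddCommGroup V] [Module W V]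

/-- An injective Frobenius-semilinear endomorphism of a nonzero finite dimensional space over an
algebraically closed field has a nonzero fixed vector. -/
theorem exists_fixed_ne_zero [IsAlgClosed W] [FiniteDimensional W V] [Nontrivial V]
    (φ : V →ₛₗ[frobHom k W] V) (hφ : Function.Injective φ) : ∃ v, v ≠ 0 ∧ φ v = v := by
  classical
  obtain ⟨v, hv⟩ := exists_ne (0 : V)
  let f : ℕ → V := fun i => φ^[i] v
  have hfs : ∀ i, f (i + 1) = φ (f i) := fun i => Function.iterate_succ_apply' _ _ _
  have hf0 : ∀ i, f i ≠ 0 := fun i => by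
    induction i with
    | zero => exact hv
    | succ i ih => rw [hfs]; exact fun h => ih (hφ (h.trans (map_zero φ).symm))
  have hex : ∃ n, ¬ LinearIndependent W fun i : Fin (n + 1) => f i := by
    refine ⟨Module.finrank W V, fun h => ?_⟩
    have := h.fintype_card_le_finrank
    rw [Fintype.card_fin] at this
    omega
  have hmin : ∀ m < Nat.find hex, LinearIndependent W fun i : Fin (m + 1) => f i :=
    fun m hm => not_not.1 (Nat.find_min hex hm)
  have hspec := Nat.find_spec hex
  obtain ⟨m, hm⟩ : ∃ m, Nat.find hex = m + 1 := by
    refine Nat.exists_eq_succ_of_ne_zero fun h0 => ?_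
    rw [h0] at hspec
    have : Subsingleton (Fin (0 + 1)) := inferInstanceAs (Subsingleton (Fin 1))
    exact hspec ((linearIndependent_subsingleton_index_iff _).2 fun i => hf0 i)
  rw [hm] at hspec
  have hli := hmin m (by omega)
  have hmem : f (m + 1) ∈ Submodule.span W (Set.range fun i : Fin (m + 1) => f i) := by
    by_contra h
    apply hspec
    have := linearIndependent_finSnoc.2 ⟨hli, h⟩
    convert this using 1
    funext i
    refine Fin.lastCases ?_ (fun i => ?_) i
    · simp
    · simp
  obtain ⟨a', ha'⟩ := (Submodule.mem_span_range_iff_exists_fun W).1 hmem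
  let a : ℕ → W := fun i => if h : i < m + 1 then a' ⟨i, h⟩ else 0
  have ha : ∑ i ∈ Finset.range (m + 1), a i • f i = f (m + 1) := by
    rw [← ha', Finset.sum_range]
    refine Finset.sum_congr rfl fun i _ => ?_
    simp only [a, dif_pos i.2]
  obtain ⟨c, hcm, hc0, hcs⟩ := exists_fixed_coefficients
    (Fintype.one_lt_card : 2 ≤ Fintype.card k) a m (by
    by_contra h
    push Not at h
    apply hf0 (m + 1)
    rw [← ha]
    exact Finset.sum_eq_zero fun i hi => by
      rw [h i (by have := Finset.mem_range.1 hi; omega), zero_smul])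
  refine ⟨∑ i ∈ Finset.range (m + 1), c i • f i, fun h => ?_, ?_⟩
  · rw [Finset.sum_range] at h
    exact hcm (Fintype.linearIndependent_iff.1 hli (fun i => c i) h (Fin.last m))
  · have h1 : ∀ i, φ (c i • f i) = c i ^ Fintype.card k • f (i + 1) := fun i => by
      rw [map_smulₛₗ, frobHom_apply, hfs]
    have h2 : ∀ i, c (i + 1) • f (i + 1) = c i ^ Fintype.card k • f (i + 1) +
        c m ^ Fintype.card k • (a (i + 1) • f (i + 1)) := fun i => by
      rw [hcs, add_smul, mul_comm, mul_smul]
    have h3 : c 0 • f 0 = c m ^ Fintype.card k • (a 0 • f 0) := by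
      rw [hc0, mul_comm, mul_smul]
    rw [map_sum, Finset.sum_congr rfl fun i _ => h1 i, Finset.sum_range_succ,
      Finset.sum_range_succ' (fun i => c i • f i), Finset.sum_congr rfl fun i _ => h2 i,
      Finset.sum_add_distrib, h3, ← Finset.smul_sum, add_assoc, ← smul_add,
      ← Finset.sum_range_succ' (fun i => a i • f i), ha]

/-- If the fixed vectors of a Frobenius-semilinear `φ` span, then `φ - 1` is surjective. -/
theorem exists_sub_eq_of_mem_span_fixed [IsAlgClosed W] (φ : V →ₛₗ[frobHom k W] V) {u : V}
    (hu : u ∈ Submodule.span W {v | φ v = v}) :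
    ∃ v ∈ Submodule.span W {v | φ v = v}, φ v - v = u := by
  induction hu using Submodule.closure_induction with
  | zero => exact ⟨0, zero_mem _, by rw [map_zero, sub_zero]⟩
  | add x y _ _ hx hy =>
    obtain ⟨v, hv, rfl⟩ := hx
    obtain ⟨w, hw, rfl⟩ := hy
    exact ⟨v + w, add_mem hv hw, by rw [map_add]; abel⟩
  | smul_mem c v hv =>
    obtain ⟨w, hw⟩ : ∃ w : W, w ^ Fintype.card k - w = c := by
      have hc : 1 < Fintype.card k := Fintype.one_lt_card
      have h2 : (Polynomial.X ^ Fintype.card k - Polynomial.X : Polynomial W).degree =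
          (Fintype.card k : ℕ) := by
        rw [Polynomial.degree_eq_natDegree (FiniteField.X_pow_card_sub_X_ne_zero W hc),
          FiniteField.X_pow_card_sub_X_natDegree_eq W hc]
      obtain ⟨w, hw⟩ := IsAlgClosed.exists_root
        (Polynomial.X ^ Fintype.card k - Polynomial.X - Polynomial.C c : Polynomial W) (by
          rw [Polynomial.degree_sub_eq_left_of_degree_lt, h2]
          · exact_mod_cast Fintype.card_ne_zero
          · rw [h2]
            exact Polynomial.degree_C_le.trans_lt (by exact_mod_cast Fintype.card_pos))
      refine ⟨w, ?_⟩
      rw [Polynomial.IsRoot, Polynomial.eval_sub, Polynomial.eval_sub, Polynomial.eval_pow,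
        Polynomial.eval_X, Polynomial.eval_C, sub_eq_zero] at hw
      exact hw
    refine ⟨w • v, Submodule.smul_mem _ _ (Submodule.subset_span hv), ?_⟩
    have hv' : φ v = v := hv
    rw [map_smulₛₗ, hv', frobHom_apply, ← sub_smul, hw]

/-- Lang's theorem for vector spaces: the fixed vectors of an injective Frobenius-semilinear
endomorphism of a finite dimensional space over an algebraically closed field span the space.
Otherwise the quotient by their span has a nonzero fixed vector, and it lifts to a fixed vector. -/
theorem span_fixed_eq_top [IsAlgClosed W] [FiniteDimensional W V] (φ : V →ₛₗ[frobHom k W] V)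
    (hφ : Function.Injective φ) : Submodule.span W {v | φ v = v} = ⊤ := by
  set U := Submodule.span W {v | φ v = v} with hU
  by_contra hne
  have hmap : U ≤ U.comap φ := by
    rw [hU, Submodule.span_le]
    intro v hv
    have hv' : φ v = v := hv
    change φ v ∈ U
    rw [hv']
    exact Submodule.subset_span hv
  have hsurj : ∀ u ∈ U, ∃ v ∈ U, φ v = u := fun u hu => by
    induction hu using Submodule.closure_induction with
    | zero => exact ⟨0, zero_mem _, map_zero _⟩
    | add x y _ _ hx hy =>
      obtain ⟨v, hv, rfl⟩ := hx
      obtain ⟨w, hw, rfl⟩ := hy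
      exact ⟨v + w, add_mem hv hw, map_add _ _ _⟩
    | smul_mem c v hv =>
      obtain ⟨w, hw⟩ := IsAlgClosed.exists_pow_nat_eq c (Fintype.card_pos (α := k))
      have hv' : φ v = v := hv
      exact ⟨w • v, Submodule.smul_mem _ _ (Submodule.subset_span hv), by
        rw [map_smulₛₗ, hv', frobHom_apply, hw]⟩
  have : Nontrivial (V ⧸ U) := Submodule.Quotient.nontrivial_iff.2 hne
  obtain ⟨x', hx0, hx⟩ := exists_fixed_ne_zero (U.mapQ U φ hmap) (by
    refine (injective_iff_map_eq_zero _).2 fun x hx => ?_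
    obtain ⟨x, rfl⟩ := Submodule.mkQ_surjective _ x
    rw [Submodule.mkQ_apply, Submodule.mapQ_apply, Submodule.Quotient.mk_eq_zero] at hx
    obtain ⟨v, hv, hvx⟩ := hsurj _ hx
    rw [← hφ hvx]
    exact (Submodule.Quotient.mk_eq_zero _).2 hv)
  obtain ⟨x, rfl⟩ := Submodule.mkQ_surjective _ x'
  rw [Submodule.mkQ_apply, Submodule.mapQ_apply, Submodule.Quotient.eq] at hx
  obtain ⟨v, hv, hvx⟩ := exists_sub_eq_of_mem_span_fixed φ hx
  apply hx0
  rw [Submodule.mkQ_apply, Submodule.Quotient.mk_eq_zero]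
  have hfix : x - v ∈ U := Submodule.subset_span (by
    change φ (x - v) = x - v
    rw [map_sub]
    have h2 : φ x = x + (φ v - v) := by rw [hvx]; abel
    rw [h2]
    abel)
  have := add_mem hfix hv
  rwa [sub_add_cancel] at this

end Lang

/-! ### The function field of the base change -/

section TwistIncl

variable {k K W L : Type*} [Field k] [Fintype k] [Field K] [Algebra k K] [Field W] [Algebra k W]
  [IsAlgClosed W] [Field L] [Algebra (W ⊗[k] K) L] [IsFractionRing (W ⊗[k] K) L]

theorem twistFun_incl (n : ℤ) (a : K) : twistFun k K W L n (incl k K W L a) = incl k K W L a := by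
  have h : incl k K W L a = algebraMap (W ⊗[k] K) L (1 ⊗ₜ a) := rfl
  rw [h, twistFun, IsFractionRing.ringEquivOfRingEquiv_algebraMap]
  simp

end TwistIncl

section BaseChangeField

variable {k K W L : Type*} [Field k] [Field K] [Algebra k K] [Field W] [Algebra k W]
  [Field L] [Algebra W L] [Algebra (W ⊗[k] K) L] [IsScalarTower W (W ⊗[k] K) L]

theorem algebraMap_tmul (w : W) (a : K) :
    algebraMap (W ⊗[k] K) L (w ⊗ₜ a) = algebraMap W L w * incl k K W L a := by
  have h : (w ⊗ₜ[k] a : W ⊗[k] K) = algebraMap W (W ⊗[k] K) w * (1 ⊗ₜ a) := by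
    rw [Algebra.TensorProduct.algebraMap_apply, Algebra.TensorProduct.tmul_mul_tmul, mul_one,
      one_mul]
    rfl
  rw [h, map_mul, ← IsScalarTower.algebraMap_apply]
  rfl

theorem incl_algebraMap (c : k) :
    incl k K W L (algebraMap k K c) = algebraMap W L (algebraMap k W c) := by
  have h1 : incl k K W L (algebraMap k K c) =
      algebraMap (W ⊗[k] K) L (1 ⊗ₜ algebraMap k K c) := rfl
  have h2 : (1 ⊗ₜ algebraMap k K c : W ⊗[k] K) = algebraMap k W c ⊗ₜ 1 := by
    rw [Algebra.algebraMap_eq_smul_one, Algebra.algebraMap_eq_smul_one, TensorProduct.smul_tmul]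
  rw [h1, h2, algebraMap_tmul, map_one, mul_one]

variable [IsFractionRing (W ⊗[k] K) L]

variable (k K) in
theorem mem_of_subfield (S : Subfield L) (hW : ∀ w : W, algebraMap W L w ∈ S)
    (hK : ∀ a : K, incl k K W L a ∈ S) (z : L) : z ∈ S := by
  have hT : ∀ t : W ⊗[k] K, algebraMap (W ⊗[k] K) L t ∈ S := fun t => by
    induction t using TensorProduct.induction_on with
    | zero => rw [map_zero]; exact zero_mem _
    | tmul w a => rw [algebraMap_tmul]; exact mul_mem (hW w) (hK a)
    | add x y hx hy => rw [map_add]; exact add_mem hx hy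
  obtain ⟨s, t, -, rfl⟩ := IsFractionRing.div_surjective (A := W ⊗[k] K) z
  exact div_mem (hT s) (hT t)

variable (k K) in
theorem ringHom_ext_of_incl {R : Type*} [Field R] {f g : L →+* R}
    (hW : ∀ w : W, f (algebraMap W L w) = g (algebraMap W L w))
    (hK : ∀ a : K, f (incl k K W L a) = g (incl k K W L a)) : f = g := by
  ext z
  exact mem_of_subfield k K (f.eqLocusField g) hW hK z

variable [Fintype k] [IsAlgClosed W]

theorem twistFun_add (m n : ℤ) (z : L) :
    twistFun k K W L (m + n) z = twistFun k K W L m (twistFun k K W L n z) := by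
  have h : (twistFun k K W L (m + n) : L →+* L) =
      (twistFun k K W L m : L →+* L).comp (twistFun k K W L n : L →+* L) := by
    refine ringHom_ext_of_incl (W := W) k K (fun w => ?_) (fun a => ?_)
    · simp only [RingHom.comp_apply, RingHom.coe_coe, twistFun_algebraMap, zpow_add]
      rfl
    · simp only [RingHom.comp_apply, RingHom.coe_coe, twistFun_incl]
  exact RingHom.congr_fun h z

theorem twistFun_zero (z : L) : twistFun k K W L 0 z = z := by
  have h : (twistFun k K W L 0 : L →+* L) = RingHom.id L := by
    refine ringHom_ext_of_incl (W := W) k K (fun w => ?_) (fun a => ?_)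
    · simp only [RingHom.coe_coe, twistFun_algebraMap, zpow_zero]
      rfl
    · simp only [RingHom.coe_coe, twistFun_incl]
      rfl
  exact RingHom.congr_fun h z

theorem frob_apply (w : W) : frob k W w = w ^ Fintype.card k := rfl

theorem frob_pow_apply (n : ℕ) (w : W) : (frob k W ^ (n : ℤ)) w = w ^ Fintype.card k ^ n := by
  rw [zpow_natCast]
  induction n with
  | zero => simp
  | succ n ih =>
    rw [pow_succ', AlgEquiv.mul_apply, ih, frob_apply, ← pow_mul, pow_succ]

theorem twistFun_one_algebraMap (w : W) :
    twistFun k K W L 1 (algebraMap W L w) = algebraMap W L (w ^ Fintype.card k) := by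
  rw [twistFun_algebraMap, zpow_one, frob_apply]

/-- Functions which are fixed by the twist and linearly independent over `k` are linearly
independent over `W`. In a relation with as few terms as possible and one coefficient equal to `1`,
comparison with its twist shows that all coefficients are fixed by Frobenius. -/
theorem eq_zero_of_sum_algebraMap_mul_eq_zero {ι : Type*} (s : Finset ι) (z : ι → L)
    (hz : ∀ i ∈ s, twistFun k K W L 1 (z i) = z i)
    (hli : ∀ c : ι → k, ∑ i ∈ s, algebraMap W L (algebraMap k W (c i)) * z i = 0 →
      ∀ i ∈ s, c i = 0)
    (w : ι → W) (hw : ∑ i ∈ s, algebraMap W L (w i) * z i = 0) : ∀ i ∈ s, w i = 0 := by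
  classical
  induction s using Finset.induction_on generalizing w with
  | empty => simp
  | insert j s hj ih =>
    have hz' : ∀ i ∈ s, twistFun k K W L 1 (z i) = z i := fun i hi =>
      hz i (Finset.mem_insert_of_mem hi)
    have ih' := ih hz' (fun c hc i hi => by
      have hij : ∀ i ∈ s, i ≠ j := fun i hi h => hj (h ▸ hi)
      have := hli (fun i => if i = j then 0 else c i) (by
        rw [Finset.sum_insert hj, if_pos rfl, map_zero, map_zero, zero_mul, zero_add, ← hc]
        exact Finset.sum_congr rfl fun i hi => by rw [if_neg (hij i hi)]) i
        (Finset.mem_insert_of_mem hi)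
      rwa [if_neg (hij i hi)] at this)
    by_cases hwj : w j = 0
    · rw [Finset.sum_insert hj, hwj, map_zero, zero_mul, zero_add] at hw
      intro i hi
      rcases Finset.mem_insert.1 hi with rfl | hi
      · exact hwj
      · exact ih' w hw i hi
    · exfalso
      have hu : ∑ i ∈ insert j s, algebraMap W L (w i / w j) * z i = 0 := by
        have h1 : ∀ i, algebraMap W L (w i / w j) * z i =
            algebraMap W L (w j)⁻¹ * (algebraMap W L (w i) * z i) := fun i => by
          rw [div_eq_mul_inv, map_mul]; ring
        rw [Finset.sum_congr rfl fun i _ => h1 i, ← Finset.mul_sum, hw, mul_zero]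
      have hu' := congrArg (twistFun k K W L 1) hu
      rw [map_sum, map_zero, Finset.sum_congr rfl fun i hi => by
        rw [map_mul, twistFun_one_algebraMap, hz i hi], ← hu, Finset.sum_insert hj,
        Finset.sum_insert hj, div_self hwj, one_pow, add_right_inj, ← sub_eq_zero,
        ← Finset.sum_sub_distrib] at hu'
      have h2 := ih' (fun i => (w i / w j) ^ Fintype.card k - w i / w j) (by
        rw [← hu']
        exact Finset.sum_congr rfl fun i _ => by rw [map_sub, sub_mul])
      have h3 : ∀ i, ∃ c : k, i ∈ insert j s → algebraMap k W c = w i / w j := fun i => by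
        by_cases hi : i ∈ insert j s
        · rcases Finset.mem_insert.1 hi with rfl | hi
          · exact ⟨1, fun _ => by rw [map_one, div_self hwj]⟩
          · obtain ⟨c, hc⟩ := exists_algebraMap_eq_of_pow_card_eq k (sub_eq_zero.1 (h2 i hi))
            exact ⟨c, fun _ => hc⟩
        · exact ⟨0, fun h => absurd h hi⟩
      choose c hc using h3
      have h4 := hli c (by
        rw [← hu]
        exact Finset.sum_congr rfl fun i hi => by rw [hc i hi]) j (Finset.mem_insert_self _ _)
      have h5 := hc j (Finset.mem_insert_self _ _)
      rw [h4, map_zero, div_self hwj] at h5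
      exact zero_ne_one h5

/-- Functions on the curve which are linearly independent over `k` remain so over `W`. -/
theorem linearIndependent_incl {ι : Type*} {e : ι → K} (he : LinearIndependent k e) :
    LinearIndependent W fun i => incl k K W L (e i) := by
  rw [linearIndependent_iff']
  intro s w hw
  refine eq_zero_of_sum_algebraMap_mul_eq_zero (W := W) (L := L) (k := k) (K := K) s
    (fun i => incl k K W L (e i)) (fun i _ => twistFun_incl 1 _)
    (fun c hc => ?_) w ?_
  · refine linearIndependent_iff'.1 he s c ?_
    apply (incl k K W L).injective
    rw [map_zero, ← hc, map_sum]
    exact Finset.sum_congr rfl fun i _ => by rw [Algebra.smul_def, map_mul, incl_algebraMap]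
  · rw [← hw]
    exact Finset.sum_congr rfl fun i _ => by rw [Algebra.smul_def]

/-- The functions which are fixed by the twist are those of the curve over `k`. -/
theorem exists_incl_eq_of_twistFun_eq {z : L} (hz : twistFun k K W L 1 z = z) :
    ∃ a : K, incl k K W L a = z := by
  classical
  obtain ⟨s, t, ht, hst⟩ := IsFractionRing.div_surjective (A := W ⊗[k] K) z
  let b := Module.Free.chooseBasis k K
  let bW := Algebra.TensorProduct.basis W b
  have hexp : ∀ u : W ⊗[k] K, ∀ S : Finset (Module.Free.ChooseBasisIndex k K),
      (bW.repr u).support ⊆ S → algebraMap (W ⊗[k] K) L u =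
        ∑ i ∈ S, algebraMap W L (bW.repr u i) * incl k K W L (b i) := fun u S hS => by
    conv_lhs => rw [← bW.linearCombination_repr u]
    rw [Finsupp.linearCombination_apply, Finsupp.sum_of_support_subset _ hS _ (by simp), map_sum]
    refine Finset.sum_congr rfl fun i _ => ?_
    rw [Algebra.TensorProduct.basis_apply, TensorProduct.smul_tmul', smul_eq_mul, mul_one,
      algebraMap_tmul]
  set S := (bW.repr s).support ∪ (bW.repr t).support with hS
  have ht0 : algebraMap (W ⊗[k] K) L t ≠ 0 :=
    IsFractionRing.to_map_ne_zero_of_mem_nonZeroDivisors ht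
  have hrel : z * algebraMap (W ⊗[k] K) L t = algebraMap (W ⊗[k] K) L s := by
    rw [← hst, div_mul_cancel₀ _ ht0]
  rw [hexp s S Finset.subset_union_left, hexp t S Finset.subset_union_right] at hrel
  -- the functions `b i` and `z * b i` are dependent over `W`, hence over `k`
  by_contra hno
  have key := eq_zero_of_sum_algebraMap_mul_eq_zero (k := k) (K := K) (S.disjSum S)
    (Sum.elim (fun i => incl k K W L (b i)) fun i => z * incl k K W L (b i))
    (fun i _ => by
      rcases i with i | i
      · exact twistFun_incl 1 _
      · change twistFun k K W L 1 (z * incl k K W L (b i)) = z * incl k K W L (b i)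
        rw [map_mul, hz, twistFun_incl])
    (fun c hc => by
      rw [Finset.sum_disjSum] at hc
      simp only [Sum.elim_inl, Sum.elim_inr, ← incl_algebraMap (L := L) (K := K)] at hc
      have hc' : incl k K W L (∑ i ∈ S, c (Sum.inl i) • b i) +
          z * incl k K W L (∑ i ∈ S, c (Sum.inr i) • b i) = 0 := by
        rw [← hc, map_sum, map_sum, Finset.mul_sum]
        congr 1
        · exact Finset.sum_congr rfl fun i _ => by rw [Algebra.smul_def, map_mul]
        · exact Finset.sum_congr rfl fun i _ => by rw [Algebra.smul_def, map_mul]; ring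
      have hr : ∑ i ∈ S, c (Sum.inr i) • b i = 0 := by
        by_contra hr
        refine hno ⟨-(∑ i ∈ S, c (Sum.inl i) • b i) / ∑ i ∈ S, c (Sum.inr i) • b i, ?_⟩
        rw [map_div₀, map_neg, div_eq_iff ((map_ne_zero _).2 hr)]
        linear_combination -hc'
      rw [hr, map_zero, mul_zero, add_zero, map_eq_zero] at hc'
      have hr' := linearIndependent_iff'.1 b.linearIndependent S _ hr
      have hl' := linearIndependent_iff'.1 b.linearIndependent S _ hc'
      intro i hi
      rcases i with i | i
      · exact hl' i (by simpa using hi)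
      · exact hr' i (by simpa using hi))
    (Sum.elim (fun i => bW.repr s i) fun i => -bW.repr t i) (by
      rw [Finset.sum_disjSum]
      simp only [Sum.elim_inl, Sum.elim_inr]
      rw [← hrel, Finset.mul_sum, ← Finset.sum_add_distrib]
      exact Finset.sum_eq_zero fun i _ => by rw [map_neg]; ring)
  apply ht0
  rw [hexp t S Finset.subset_union_right]
  refine Finset.sum_eq_zero fun i hi => ?_
  have := key (Sum.inr i) (by simpa using hi)
  simp only [Sum.elim_inr, neg_eq_zero] at this
  rw [this, map_zero, zero_mul]

theorem transcendental_incl {x : K} (hx : Transcendental k x) :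
    Transcendental W (incl k K W L x) := by
  have h1 : LinearIndependent k fun i : ℕ => x ^ i := by
    rw [linearIndependent_iff']
    intro s c hc i hi
    by_contra hci
    refine hx ⟨∑ j ∈ s, Polynomial.monomial j (c j), fun h => hci ?_, ?_⟩
    · have := congrArg (fun p => Polynomial.coeff p i) h
      simpa [Polynomial.finsetSum_coeff, Polynomial.coeff_monomial, hi] using this
    · rw [map_sum, ← hc]
      exact Finset.sum_congr rfl fun j _ => by
        rw [Polynomial.aeval_monomial, ← Algebra.smul_def]
  have h2 := linearIndependent_incl (W := W) (L := L) h1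
  rintro ⟨p, hp, hp0⟩
  apply hp
  ext i
  by_cases hi : i ∈ p.support
  · rw [Polynomial.coeff_zero]
    refine linearIndependent_iff'.1 h2 p.support p.coeff ?_ i hi
    rw [← hp0, Polynomial.aeval_eq_sum_range' (Nat.lt_succ_self _)]
    simp only [map_pow]
    exact Finset.sum_subset Polynomial.supp_subset_range_natDegree_succ fun j _ hj => by
      rw [Polynomial.notMem_support_iff.1 hj, zero_smul]
  · rw [Polynomial.notMem_support_iff.1 hi, Polynomial.coeff_zero]

variable (k K W L) in
/-- The base change of a curve is a curve. -/
theorem isCurveFunctionField_baseChange [IsCurveFunctionField k K] :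
    IsCurveFunctionField W L := by
  obtain ⟨x, hx, hfin⟩ := IsCurveFunctionField.exists_finite (k := k) (K := K)
  refine ⟨⟨incl k K W L x, transcendental_incl hx, ?_⟩, ?_⟩
  · have hess : Algebra.EssFiniteType k K := by
      have h1 : Algebra.EssFiniteType k (IntermediateField.adjoin k {x}) :=
        IntermediateField.essFiniteType_iff.2 ⟨{x}, by simp⟩
      exact Algebra.EssFiniteType.comp k (IntermediateField.adjoin k {x}) K
    have hessL : Algebra.EssFiniteType (W ⊗[k] K) L :=
      Algebra.EssFiniteType.of_isLocalization L (nonZeroDivisors (W ⊗[k] K))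
    have hessW : Algebra.EssFiniteType W L := Algebra.EssFiniteType.comp W (W ⊗[k] K) L
    set Wx := IntermediateField.adjoin W {incl k K W L x} with hWx
    have hessx : Algebra.EssFiniteType Wx L := Algebra.EssFiniteType.of_comp W Wx L
    let S : IntermediateField k K := (Wx.toSubfield.comap (incl k K W L)).toIntermediateField
      fun c => by
        change incl k K W L (algebraMap k K c) ∈ Wx
        rw [incl_algebraMap]
        exact Wx.algebraMap_mem _
    have hxS : IntermediateField.adjoin k {x} ≤ S :=
      IntermediateField.adjoin_simple_le_iff.2 (IntermediateField.mem_adjoin_simple_self W _)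
    let ι : IntermediateField.adjoin k {x} →+* Wx :=
      { toFun := fun z => ⟨incl k K W L z, hxS z.2⟩
        map_one' := Subtype.ext (map_one _)
        map_mul' := fun _ _ => Subtype.ext (map_mul _ _ _)
        map_zero' := Subtype.ext (map_zero _)
        map_add' := fun _ _ => Subtype.ext (map_add _ _ _) }
    have halg : Algebra.IsAlgebraic Wx L := by
      refine ⟨fun z => ?_⟩
      have := mem_of_subfield (W := W) (L := L) k K (algebraicClosure Wx L).toSubfield
        (fun w => (algebraicClosure Wx L).algebraMap_mem (algebraMap W Wx w)) (fun a => by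
          have ha : IsAlgebraic (IntermediateField.adjoin k {x}) a :=
            Algebra.IsAlgebraic.isAlgebraic a
          exact mem_algebraicClosure_iff.2
            (ha.ringHom_of_comp_eq ι (incl k K W L) ι.injective rfl)) z
      exact mem_algebraicClosure_iff.1 this
    exact Algebra.finite_of_essFiniteType_of_isAlgebraic
  · rw [eq_bot_iff]
    intro z hz
    have h1 : IsIntegral W z := hz
    obtain ⟨w, hw⟩ := minpoly.mem_range_of_degree_eq_one W z
      (IsAlgClosed.degree_eq_one_of_irreducible W (minpoly.irreducible h1))
    exact IntermediateField.mem_bot.2 ⟨w, hw⟩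

end BaseChangeField

/-! ### Points over an algebraically closed field -/

section AlgClosed

variable {W L : Type*} [Field W] [IsAlgClosed W] [Field L] [Algebra W L] [IsCurveFunctionField W L]

namespace Place

theorem algebraMap_residueField_bijective (Q : Place W L) :
    Function.Bijective (algebraMap W (IsLocalRing.ResidueField Q.O)) := by
  have := Q.finite_residueField
  exact IsAlgClosed.algebraMap_bijective_of_isIntegral

theorem degree_eq_one (Q : Place W L) : Q.degree = 1 := by
  have e : W ≃ₗ[W] IsLocalRing.ResidueField Q.O :=
    LinearEquiv.ofBijective (Algebra.linearMap W _) Q.algebraMap_residueField_bijective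
  rw [degree, ← e.finrank_eq, Module.finrank_self]

/-- The value of a regular function at a point of a curve over an algebraically closed field, as the
ring homomorphism which inverts the bijection of the constants with the residue field. -/
theorem exists_eval (Q : Place W L) : ∃ ev : Q.O →+* W,
    ∀ f : Q.O, Q.val ((f : L) - algebraMap W L (ev f)) < 1 := by
  let e := RingEquiv.ofBijective (algebraMap W (IsLocalRing.ResidueField Q.O))
    Q.algebraMap_residueField_bijective
  refine ⟨(e.symm : _ →+* W).comp (IsLocalRing.residue Q.O), fun f => ?_⟩
  set c := ((e.symm : _ →+* W).comp (IsLocalRing.residue Q.O)) f with hc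
  have h : e c = IsLocalRing.residue Q.O f := e.apply_symm_apply _
  have hmem : (f : L) - algebraMap W L c ∈ Q.O := sub_mem f.2 (Q.algebraMap_mem c)
  rw [Q.val_lt_one_iff hmem]
  have h2 : (⟨(f : L) - algebraMap W L c, hmem⟩ : Q.O) = f - algebraMap W Q.O c := rfl
  rw [h2, ← IsLocalRing.residue_eq_zero_iff, map_sub, ← h, sub_eq_zero]
  rfl

end Place

end AlgClosed

section Eval

variable {F K : Type*} [Field F] [Field K] [Algebra F K]

theorem Place.eq_of_val_sub_lt_one (P : Place F K) {f : K} {c d : F}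
    (hc : P.val (f - algebraMap F K c) < 1) (hd : P.val (f - algebraMap F K d) < 1) : c = d := by
  by_contra h
  have h1 := P.val_algebraMap (sub_ne_zero.2 h)
  have h2 : algebraMap F K (c - d) = (f - algebraMap F K d) - (f - algebraMap F K c) := by
    rw [map_sub]; ring
  rw [h2] at h1
  exact absurd h1 (ne_of_lt ((P.val.map_sub _ _).trans_lt (max_lt hd hc)))

theorem Place.eval_eq (P : Place F K) {f : K} {c : F}
    (hc : P.val (f - algebraMap F K c) < 1) : P.eval f = c := by
  have h : ∃ c : F, P.val (f - algebraMap F K c) < 1 := ⟨c, hc⟩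
  rw [Place.eval, dif_pos h]
  exact P.eq_of_val_sub_lt_one h.choose_spec hc

end Eval

/-! ### Twists of points and divisors -/

section Twist

variable {k K W L : Type*} [Field k] [Fintype k] [Field K] [Algebra k K] [Field W] [Algebra k W]
  [IsAlgClosed W] [Field L] [Algebra W L] [Algebra (W ⊗[k] K) L] [IsScalarTower W (W ⊗[k] K) L]
  [IsFractionRing (W ⊗[k] K) L]

theorem twistFun_symm_apply (n : ℤ) (z : L) :
    (twistFun k K W L n).symm z = twistFun k K W L (-n) z := by
  rw [RingEquiv.symm_apply_eq, ← twistFun_add, add_neg_cancel, twistFun_zero]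

theorem mem_twist_O (n : ℤ) (Q : Place W L) (f : L) :
    f ∈ (twist k K n Q).O ↔ twistFun k K W L (-n) f ∈ Q.O := by
  rw [← twistFun_symm_apply]
  rfl

theorem val_twist (n : ℤ) (Q : Place W L) (f : L) :
    (twist k K n Q).val (twistFun k K W L n f) = Q.val f :=
  Q.val_of_ringEquiv (twist k K n Q) (twistFun k K W L n) (fun f => by
    rw [mem_twist_O, ← twistFun_add, neg_add_cancel, twistFun_zero]) f

theorem ord_twist (n : ℤ) (Q : Place W L) (f : L) :
    (twist k K n Q).ord (twistFun k K W L n f) = Q.ord f := by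
  rw [Place.ord, val_twist, Place.ord]

theorem twist_add (m n : ℤ) (Q : Place W L) :
    twist k K (m + n) Q = twist k K m (twist k K n Q) := by
  refine Place.ext (SetLike.ext fun f => ?_)
  rw [mem_twist_O, mem_twist_O, mem_twist_O, ← twistFun_add, neg_add_rev]

theorem twist_zero (Q : Place W L) : twist k K 0 Q = Q := by
  refine Place.ext (SetLike.ext fun f => ?_)
  rw [mem_twist_O, neg_zero, twistFun_zero]

theorem twist_neg_twist (n : ℤ) (Q : Place W L) : twist k K (-n) (twist k K n Q) = Q := by
  rw [← twist_add, neg_add_cancel, twist_zero]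

theorem twist_twist_neg (n : ℤ) (Q : Place W L) : twist k K n (twist k K (-n) Q) = Q := by
  rw [← twist_add, add_neg_cancel, twist_zero]

variable (k K) in
theorem twist_injective (n : ℤ) : Function.Injective (twist k K n : Place W L → Place W L) :=
  Function.LeftInverse.injective (twist_neg_twist n)

theorem twistDiv_twist (n : ℤ) (E : Divisor W L) (Q : Place W L) :
    twistDiv k K n E (twist k K n Q) = E Q :=
  Finsupp.mapDomain_apply (twist_injective k K n) E Q

theorem twistDiv_add (n : ℤ) (E E' : Divisor W L) :
    twistDiv k K n (E + E') = twistDiv k K n E + twistDiv k K n E' := Finsupp.mapDomain_add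

theorem twistDiv_sum {ι : Type*} (n : ℤ) (s : Finset ι) (E : ι → Divisor W L) :
    twistDiv k K n (∑ i ∈ s, E i) = ∑ i ∈ s, twistDiv k K n (E i) :=
  Finsupp.mapDomain_finsetSum

theorem twistDiv_single (n : ℤ) (Q : Place W L) (m : ℤ) :
    twistDiv k K n (Finsupp.single Q m) = Finsupp.single (twist k K n Q) m :=
  Finsupp.mapDomain_single

theorem twistFun_mem_H0_iff (n : ℤ) {E : Divisor W L} {f : L} :
    twistFun k K W L n f ∈ H0 (twistDiv k K n E) ↔ f ∈ H0 E := by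
  rw [mem_H0, mem_H0]
  constructor
  · intro h Q
    have := h (twist k K n Q)
    rwa [twistDiv_twist, Place.mem_stalk, val_twist] at this
  · intro h Q
    rw [← twist_twist_neg (k := k) (K := K) n Q, twistDiv_twist, Place.mem_stalk, val_twist]
    exact h _

/-- The function `f ↦ u f⁽¹⁾`, as a Frobenius-semilinear map. -/
def mulTwist (u : L) : L →ₛₗ[frobHom k W] L where
  toFun f := u * twistFun k K W L 1 f
  map_add' f g := by rw [map_add, mul_add]
  map_smul' c f := by
    rw [Algebra.smul_def, Algebra.smul_def, map_mul, twistFun_one_algebraMap, frobHom_apply]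
    ring

end Twist

/-! ### Points in general position and points over closed points -/

theorem infinite_of_isCurveFunctionField (k K : Type*) [Field k] [Field K] [Algebra k K]
    [IsCurveFunctionField k K] : Infinite K := by
  obtain ⟨x, hx, -⟩ := IsCurveFunctionField.exists_finite (k := k) (K := K)
  refine Infinite.of_injective (fun p : Polynomial k => Polynomial.aeval x p) ?_
  exact transcendental_iff_injective.1 hx

section LiesOver

variable {k K W L : Type*} [Field k] [Field K] [Algebra k K] [Field W] [Algebra k W]
  [Field L] [Algebra W L] [Algebra (W ⊗[k] K) L]

theorem Place.LiesOver.mem_iff {Q : Place W L} {P : Place k K} (h : Q.LiesOver P) (a : K) :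
    incl k K W L a ∈ Q.O ↔ a ∈ P.O := by
  rw [← h]
  rfl

theorem Place.LiesOver.eq {Q : Place W L} {P P' : Place k K} (h : Q.LiesOver P)
    (h' : Q.LiesOver P') : P = P' :=
  Place.ext (h.symm.trans h')

theorem Place.LiesOver.ord_pos {Q : Place W L} {P : Place k K} (h : Q.LiesOver P) {a : K}
    (ha : 0 < P.ord a) : 0 < Q.ord (incl k K W L a) := by
  have ha0 : a ≠ 0 := by
    rintro rfl
    rw [Place.ord_zero] at ha
    exact lt_irrefl _ ha
  have h1 : a⁻¹ ∉ P.O := by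
    rw [← Place.mem_stalk_zero, Place.mem_stalk_iff_ord _ (inv_ne_zero ha0), Place.ord_inv]
    omega
  rw [← h.mem_iff, map_inv₀, ← Place.mem_stalk_zero,
    Place.mem_stalk_iff_ord _ (inv_ne_zero ((map_ne_zero _).2 ha0)), Place.ord_inv] at h1
  omega

theorem Place.LiesOver.not_forall_mem {Q : Place W L} {P : Place k K} (h : Q.LiesOver P) :
    ¬ ∀ a : K, incl k K W L a ∈ Q.O := by
  intro hall
  obtain ⟨a, ha, ha1⟩ := P.exists_ord_eq (-1)
  have := (h.mem_iff a).1 (hall a)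
  rw [← Place.mem_stalk_zero, Place.mem_stalk_iff_ord _ ha] at this
  omega

variable (W L) in
theorem finite_liesOver [IsCurveFunctionField W L] (P : Place k K) :
    {Q : Place W L | Q.LiesOver P}.Finite := by
  obtain ⟨a, -, ha1⟩ := P.exists_ord_eq 1
  exact (finite_zeros (incl k K W L a)).subset fun Q hQ =>
    Place.LiesOver.ord_pos hQ (by rw [ha1]; exact one_pos)

variable (W L) in
theorem Divisor.baseChange_add [IsCurveFunctionField W L] (A B : Divisor k K) :
    (A + B).baseChange W L = A.baseChange W L + B.baseChange W L := by
  classical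
  refine Finsupp.sum_add_index' (fun P => by simp) fun P m n => ?_
  rw [← finsum_mem_add_distrib (finite_liesOver W L P)]
  simp only [Finsupp.single_add]

/-- The multiplicity of `Q` in a base change; the inner sum is `n` if `Q` lies over `P`, and `0`
otherwise. -/
theorem Divisor.baseChange_apply_eq_sum [IsCurveFunctionField W L] (D : Divisor k K)
    (Q : Place W L) : D.baseChange W L Q = D.sum fun P n => ∑ᶠ _ : Q.LiesOver P, n := by
  classical
  rw [Divisor.baseChange, Finsupp.sum, Finsupp.sum, Finsupp.finsetSum_apply]
  refine Finset.sum_congr rfl fun P _ => ?_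
  rw [finsum_mem_eq_finite_toFinset_sum _ (finite_liesOver W L P), Finsupp.finsetSum_apply]
  simp only [Finsupp.single_apply, Finset.sum_ite_eq', Set.Finite.mem_toFinset,
    Set.mem_ofPred_eq]
  by_cases h : Q.LiesOver P
  · rw [if_pos h, finsum_eq_if, if_pos h]
  · rw [if_neg h, finsum_eq_if, if_neg h]

theorem Place.LiesOver.baseChange_apply [IsCurveFunctionField W L] {Q : Place W L} {P : Place k K}
    (h : Q.LiesOver P) (D : Divisor k K) : D.baseChange W L Q = D P := by
  classical
  rw [Divisor.baseChange_apply_eq_sum, Finsupp.sum, Finset.sum_eq_single P]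
  · rw [finsum_eq_if, if_pos h]
  · intro P' _ hP'
    rw [finsum_eq_if, if_neg fun h' => hP' (h'.eq h)]
  · intro hP
    rw [finsum_eq_if, if_pos h, Finsupp.notMem_support_iff.1 hP]

theorem Divisor.baseChange_apply_of_forall_mem [IsCurveFunctionField W L] {Q : Place W L}
    (h : ∀ a : K, incl k K W L a ∈ Q.O) (D : Divisor k K) : D.baseChange W L Q = 0 := by
  classical
  rw [Divisor.baseChange_apply_eq_sum]
  refine Finset.sum_eq_zero fun P _ => ?_
  dsimp only
  rw [finsum_eq_if, if_neg fun h' => h'.not_forall_mem h]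

end LiesOver

section Generic

variable {k K W L : Type*} [Field k] [Field K] [Algebra k K] [Field W] [Algebra k W]
  [Field L] [Algebra W L] [Algebra (W ⊗[k] K) L] [IsScalarTower W (W ⊗[k] K) L]

variable (k K) in
/-- A point of the base change lies over a closed point, or all functions on the curve over `k` are
regular at it. -/
theorem Place.exists_liesOver_or [IsCurveFunctionField k K] (Q : Place W L) :
    (∃ P : Place k K, Q.LiesOver P) ∨ ∀ a : K, incl k K W L a ∈ Q.O := by
  by_cases h : Q.O.comap (incl k K W L) = ⊤
  · right
    intro a
    have : a ∈ Q.O.comap (incl k K W L) := h ▸ ValuationSubring.mem_top a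
    exact this
  · left
    exact ⟨Place.ofNeTop (Q.O.comap (incl k K W L)) (fun c => by
      rw [ValuationSubring.mem_comap, incl_algebraMap]
      exact Q.algebraMap_mem _) h, rfl⟩

theorem Divisor.mem_support_baseChange [IsCurveFunctionField k K] [IsCurveFunctionField W L]
    {D : Divisor k K} {Q : Place W L} :
    Q ∈ (D.baseChange W L).support ↔ ∃ P ∈ D.support, Q.LiesOver P := by
  rw [Finsupp.mem_support_iff]
  rcases Q.exists_liesOver_or k K with ⟨P, hP⟩ | h
  · rw [hP.baseChange_apply]
    constructor
    · exact fun h => ⟨P, Finsupp.mem_support_iff.2 h, hP⟩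
    · rintro ⟨P', hP', h'⟩
      rw [hP.eq h']
      exact Finsupp.mem_support_iff.1 hP'
  · rw [Divisor.baseChange_apply_of_forall_mem h]
    refine ⟨fun h => absurd rfl h, ?_⟩
    rintro ⟨P, _, hP⟩
    exact absurd h hP.not_forall_mem

theorem Divisor.baseChange_nonneg [IsCurveFunctionField k K] [IsCurveFunctionField W L]
    {D : Divisor k K} (hD : 0 ≤ D) : 0 ≤ D.baseChange W L := by
  intro Q
  rcases Q.exists_liesOver_or k K with ⟨P, hP⟩ | h
  · rw [hP.baseChange_apply]
    exact hD P
  · rw [Divisor.baseChange_apply_of_forall_mem h]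
    exact le_rfl

/-- All functions on the curve over `k` are regular at a generic point. Otherwise its coordinates
would lie in the residue field of a closed point, hence would be algebraic over `k`. -/
theorem IsGeneric.incl_mem [IsCurveFunctionField k K] {ξ : Place W L} (hξ : IsGeneric k K ξ)
    (a : K) : incl k K W L a ∈ ξ.O := by
  rcases ξ.exists_liesOver_or k K with ⟨P, hP⟩ | h
  swap
  · exact h a
  exfalso
  have hfin := P.finite_residueField
  have hle : coordField k K ξ ≤ algebraicClosure k W := by
    refine IntermediateField.adjoin_le_iff.2 ?_
    rintro c ⟨f, hf⟩
    have hfξ : incl k K W L f ∈ ξ.O := by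
      have h1 : incl k K W L f = (incl k K W L f - algebraMap W L c) + algebraMap W L c := by ring
      rw [h1]
      exact add_mem ((ξ.val_le_one_iff).1 hf.le) (ξ.algebraMap_mem c)
    have hfP : f ∈ P.O := (hP.mem_iff f).1 hfξ
    obtain ⟨p, hp0, hp⟩ : IsAlgebraic k (IsLocalRing.residue P.O ⟨f, hfP⟩) :=
      Algebra.IsAlgebraic.isAlgebraic _
    refine mem_algebraicClosure_iff.2 ⟨p, hp0, ?_⟩
    have h2 : Polynomial.aeval (IsLocalRing.residue P.O ⟨f, hfP⟩) p =
        IsLocalRing.residue P.O (Polynomial.aeval (⟨f, hfP⟩ : P.O) p) := by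
      rw [Polynomial.aeval_def, Polynomial.aeval_def, Polynomial.hom_eval₂]
      rfl
    rw [h2, IsLocalRing.residue_eq_zero_iff] at hp
    have h3 : ((Polynomial.aeval (⟨f, hfP⟩ : P.O) p : P.O) : K) = Polynomial.aeval f p := by
      rw [Polynomial.aeval_def, Polynomial.aeval_def,
        ← ValuationSubring.subtype_apply, Polynomial.hom_eval₂]
      rfl
    have h4 : P.val (Polynomial.aeval f p) < 1 := by
      rw [← h3]
      exact (P.val_lt_one_iff (Subtype.mem _)).2 hp
    have h5 : ξ.val (incl k K W L (Polynomial.aeval f p)) < 1 := by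
      by_cases h0 : Polynomial.aeval f p = 0
      · rw [h0, map_zero, map_zero]; exact zero_lt_one
      · rw [← Place.mem_stalk_neg_one, Place.mem_stalk_iff_ord _ h0] at h4
        rw [← Place.mem_stalk_neg_one, Place.mem_stalk_iff_ord _ ((map_ne_zero _).2 h0)]
        have := hP.ord_pos (a := Polynomial.aeval f p) (by omega)
        omega
    have h6 : ξ.val (incl k K W L (Polynomial.aeval f p) -
        algebraMap W L (Polynomial.aeval c p)) < 1 := by
      have h7 : incl k K W L (Polynomial.aeval f p) = p.eval₂
          ((algebraMap W L).comp (algebraMap k W)) (incl k K W L f) := by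
        rw [Polynomial.aeval_def, Polynomial.hom_eval₂]
        congr 1
        ext c
        exact incl_algebraMap c
      have h8 : algebraMap W L (Polynomial.aeval c p) = p.eval₂
          ((algebraMap W L).comp (algebraMap k W)) (algebraMap W L c) := by
        rw [Polynomial.aeval_def, Polynomial.hom_eval₂]
      let p' : Polynomial ξ.O := p.map ((algebraMap W ξ.O).comp (algebraMap k W))
      have h9 : ∀ z : ξ.O, p.eval₂ ((algebraMap W L).comp (algebraMap k W)) (z : L) =
          ((p'.eval z : ξ.O) : L) := fun z => by
        rw [Polynomial.eval_map, ← ValuationSubring.subtype_apply,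
          ← ValuationSubring.subtype_apply, Polynomial.hom_eval₂]
        rfl
      obtain ⟨d, hd⟩ := Polynomial.sub_dvd_eval_sub (⟨_, hfξ⟩ : ξ.O)
        (⟨_, ξ.algebraMap_mem c⟩ : ξ.O) p'
      have h10 := congrArg (fun z : ξ.O => (z : L)) hd
      rw [h7, h8, h9 ⟨_, hfξ⟩, h9 ⟨_, ξ.algebraMap_mem c⟩]
      have h11 : ((p'.eval (⟨_, hfξ⟩ : ξ.O) : ξ.O) : L) -
          ((p'.eval (⟨_, ξ.algebraMap_mem c⟩ : ξ.O) : ξ.O) : L) =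
          (incl k K W L f - algebraMap W L c) * (d : L) := h10
      rw [h11, map_mul]
      exact mul_lt_one_of_lt_of_le hf ((ξ.val_le_one_iff).2 d.2)
    by_contra h7
    have h8 := ξ.val_algebraMap h7
    have h9 : algebraMap W L (Polynomial.aeval c p) = incl k K W L (Polynomial.aeval f p) -
      (incl k K W L (Polynomial.aeval f p) - algebraMap W L (Polynomial.aeval c p)) := by ring
    rw [h9] at h8
    exact absurd h8 (ne_of_lt ((ξ.val.map_sub _ _).trans_lt (max_lt h5 h6)))
  obtain ⟨e⟩ := hξ
  obtain ⟨x, hx, -⟩ := IsCurveFunctionField.exists_finite (k := k) (K := K)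
  apply hx
  have h1 : IsAlgebraic k ((e.symm x : coordField k K ξ) : W) :=
    mem_algebraicClosure_iff.1 (hle (e.symm x).2)
  have h2 : IsAlgebraic k (e.symm x) :=
    (isAlgebraic_algHom_iff (coordField k K ξ).val Subtype.val_injective).1 h1
  exact (isAlgebraic_algHom_iff (e.symm : K →ₐ[k] coordField k K ξ) e.symm.injective).1 h2

variable [Fintype k] [IsAlgClosed W] [IsFractionRing (W ⊗[k] K) L]

theorem forall_incl_mem_twist {Q : Place W L} (h : ∀ a : K, incl k K W L a ∈ Q.O) (n : ℤ) (a : K) :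
    incl k K W L a ∈ (twist k K n Q).O := by
  rw [mem_twist_O, twistFun_incl]
  exact h a

/-- The evaluation of the functions on the curve over `k` at a point of the base change at which
they are all regular, and at the twists of that point. -/
theorem exists_eval_incl [IsCurveFunctionField W L] {Q : Place W L}
    (h : ∀ a : K, incl k K W L a ∈ Q.O) :
    ∃ ev : K →+* W, (∀ c : k, ev (algebraMap k K c) = algebraMap k W c) ∧
      ∀ (n : ℤ) (a : K), (twist k K n Q).val
        (incl k K W L a - algebraMap W L ((frob k W ^ n) (ev a))) < 1 := by
  obtain ⟨ev, hev⟩ := Q.exists_eval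
  let φ : K →+* Q.O := (incl k K W L).codRestrict Q.O.toSubring h
  refine ⟨ev.comp φ, fun c => ?_, fun n a => ?_⟩
  · refine Q.eq_of_val_sub_lt_one (f := incl k K W L (algebraMap k K c))
      (hev (φ (algebraMap k K c))) ?_
    rw [incl_algebraMap, sub_self, map_zero]
    exact zero_lt_one
  · have h1 : incl k K W L a - algebraMap W L ((frob k W ^ n) ((ev.comp φ) a)) =
        twistFun k K W L n (incl k K W L a - algebraMap W L (ev (φ a))) := by
      rw [map_sub, twistFun_incl, twistFun_algebraMap]
      rfl
    rw [h1, val_twist]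
    exact hev (φ a)

/-- The twists of a point which does not lie over a closed point are distinct: the values at a
fixed point of a twist would all lie in one finite field. -/
theorem twist_eq_twist_iff [IsCurveFunctionField k K] [IsCurveFunctionField W L] {Q : Place W L}
    (h : ∀ a : K, incl k K W L a ∈ Q.O) {m n : ℤ} :
    twist k K m Q = twist k K n Q ↔ m = n := by
  refine ⟨fun hmn => ?_, fun hmn => by rw [hmn]⟩
  wlog hlt : m < n generalizing m n
  · rcases lt_trichotomy m n with h1 | h1 | h1
    · exact absurd h1 hlt
    · exact h1
    · exact (this hmn.symm h1).symm
  exfalso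
  obtain ⟨d, hd⟩ := Int.eq_ofNat_of_zero_le (sub_nonneg.2 hlt.le)
  have hd0 : d ≠ 0 := by rintro rfl; simp at hd; omega
  have hfix : twist k K d Q = Q := by
    have := congrArg (twist k K (-m)) hmn
    rw [twist_neg_twist, ← twist_add] at this
    rw [← hd, show n - m = -m + n by ring]
    exact this.symm
  obtain ⟨ev, -, hev⟩ := exists_eval_incl h
  have h1 : ∀ a : K, ev a ^ Fintype.card k ^ d = ev a := fun a => by
    have h2 := hev d a
    have h3 := hev 0 a
    rw [hfix, frob_pow_apply] at h2
    rw [twist_zero, zpow_zero] at h3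
    exact Q.eq_of_val_sub_lt_one h2 h3
  have hq : 1 < Fintype.card k ^ d := Nat.one_lt_pow hd0 Fintype.one_lt_card
  have hinf := infinite_of_isCurveFunctionField k K
  have hsub : Set.range ev ⊆
      {w | (Polynomial.X ^ Fintype.card k ^ d - Polynomial.X : Polynomial W).IsRoot w} := by
    rintro _ ⟨a, rfl⟩
    simp [Polynomial.IsRoot, h1]
  exact Set.infinite_range_of_injective ev.injective
    ((Polynomial.finite_setOfPred_isRoot (FiniteField.X_pow_card_sub_X_ne_zero W hq)).subset hsub)

theorem liesOver_twist_iff {n : ℤ} {Q : Place W L} {P : Place k K} :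
    (twist k K n Q).LiesOver P ↔ Q.LiesOver P := by
  have h : (twist k K n Q).O.comap (incl k K W L) = Q.O.comap (incl k K W L) := by
    ext a
    rw [ValuationSubring.mem_comap, ValuationSubring.mem_comap, mem_twist_O, twistFun_incl]
  rw [Place.LiesOver, Place.LiesOver, h]

theorem Divisor.baseChange_twist [IsCurveFunctionField k K] [IsCurveFunctionField W L]
    (D : Divisor k K) (n : ℤ) (Q : Place W L) :
    D.baseChange W L (twist k K n Q) = D.baseChange W L Q := by
  rcases Q.exists_liesOver_or k K with ⟨P, hP⟩ | h
  · rw [hP.baseChange_apply, (liesOver_twist_iff.2 hP).baseChange_apply]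
  · rw [Divisor.baseChange_apply_of_forall_mem h,
      Divisor.baseChange_apply_of_forall_mem (forall_incl_mem_twist h n)]

end Generic

/-! ### Descent of sections and divisors -/

section SinglePole

variable {k K : Type*} [Field k] [Field K] [Algebra k K] [IsCurveFunctionField k K]

/-- For every closed point there is a nonconstant function without other poles. -/
theorem exists_transcendental_regular_away (P : Place k K) :
    ∃ f : K, Transcendental k f ∧ ∀ P' : Place k K, P' ≠ P → f ∈ P'.O := by
  have hpos : (1 : ℤ) ≤ P.degree := by exact_mod_cast P.degree_pos
  have hdeg : Divisor.deg (Finsupp.single P (2 * (genus k K : ℤ) + 1) : Divisor k K) =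
    (2 * (genus k K : ℤ) + 1) * P.degree := Divisor.deg_single _ _
  have h1 : 2 * (genus k K : ℤ) + 1 ≤ (2 * (genus k K : ℤ) + 1) * P.degree := by nlinarith
  have h2 := h0_eq (E := (Finsupp.single P (2 * (genus k K : ℤ) + 1) : Divisor k K)) (by omega)
  obtain ⟨f, hf, hf0⟩ : ∃ f ∈ H0 (Finsupp.single P (2 * (genus k K : ℤ) + 1) : Divisor k K),
      f ∉ H0 (0 : Divisor k K) := by
    by_contra! hle
    have h3 := Submodule.finrank_mono (R := k) (M := K)
      (s := H0 (Finsupp.single P (2 * (genus k K : ℤ) + 1) : Divisor k K)) hle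
    have h4 := h0_zero k K
    rw [h0] at h2 h4
    omega
  refine ⟨f, transcendental_iff.2 fun h => hf0 (mem_H0_zero.2 h), fun P' hP' => ?_⟩
  have h5 := mem_H0.1 hf P'
  rwa [Finsupp.single_eq_of_ne hP', Place.mem_stalk_zero] at h5

end SinglePole

section Descent

variable {k K W L : Type*} [Field k] [Fintype k] [Field K] [Algebra k K] [Field W] [Algebra k W]
  [IsAlgClosed W] [Field L] [Algebra W L] [Algebra (W ⊗[k] K) L] [IsScalarTower W (W ⊗[k] K) L]
  [IsFractionRing (W ⊗[k] K) L]

theorem exists_restrict_mulTwist {u : L} (hu : u ≠ 0) {V : Submodule W L}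
    (hV : ∀ f ∈ V, u * twistFun k K W L 1 f ∈ V) :
    ∃ φ : V →ₛₗ[frobHom k W] V, Function.Injective φ ∧
      ∀ f : V, (φ f : L) = u * twistFun k K W L 1 f :=
  ⟨((mulTwist (k := k) (K := K) u).domRestrict V).codRestrict V fun f => hV f f.2,
    fun f g hfg => by
      have h1 : u * twistFun k K W L 1 (f : L) = u * twistFun k K W L 1 (g : L) :=
        congrArg Subtype.val hfg
      exact Subtype.ext ((twistFun k K W L 1).injective (mul_left_cancel₀ hu h1)),
    fun _ => rfl⟩

/-- Lang's theorem for a space of functions which is stable under `f ↦ u f⁽¹⁾`. -/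
theorem mem_span_fixed_of_stable {u : L} (hu : u ≠ 0) {V : Submodule W L} [FiniteDimensional W V]
    (hV : ∀ f ∈ V, u * twistFun k K W L 1 f ∈ V) {f : L} (hf : f ∈ V) :
    f ∈ Submodule.span W {f | f ∈ V ∧ u * twistFun k K W L 1 f = f} := by
  obtain ⟨φ, hφ, hφu⟩ := exists_restrict_mulTwist hu hV
  have h := Submodule.mem_map_of_mem (f := V.subtype)
    (show (⟨f, hf⟩ : V) ∈ Submodule.span W {v | φ v = v} by
      rw [span_fixed_eq_top φ hφ]; exact Submodule.mem_top)
  rw [Submodule.map_span] at h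
  refine Submodule.span_mono ?_ h
  rintro _ ⟨v, hv, rfl⟩
  have hv' : φ v = v := hv
  exact ⟨v.2, by rw [Submodule.subtype_apply, ← hφu, hv']⟩

theorem exists_sub_eq_of_stable {u : L} (hu : u ≠ 0) {V : Submodule W L} [FiniteDimensional W V]
    (hV : ∀ f ∈ V, u * twistFun k K W L 1 f ∈ V) {f : L} (hf : f ∈ V) :
    ∃ g ∈ V, u * twistFun k K W L 1 g - g = f := by
  obtain ⟨φ, hφ, hφu⟩ := exists_restrict_mulTwist hu hV
  obtain ⟨g, -, hg⟩ := exists_sub_eq_of_mem_span_fixed φ (u := ⟨f, hf⟩)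
    (by rw [span_fixed_eq_top φ hφ]; exact Submodule.mem_top)
  refine ⟨g, g.2, ?_⟩
  rw [← hφu]
  exact congrArg Subtype.val hg

variable (k K) in
theorem twistDiv_eq_self_iff {E : Divisor W L} :
    twistDiv k K 1 E = E ↔ ∀ Q, E (twist k K 1 Q) = E Q := by
  constructor
  · intro h Q
    conv_lhs => rw [← h]
    exact twistDiv_twist _ _ _
  · intro h
    ext Q
    rw [← twist_twist_neg (k := k) (K := K) 1 Q, twistDiv_twist, h]

theorem twistDiv_eq_self_twist {E : Divisor W L} (hE : twistDiv k K 1 E = E) (n : ℤ)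
    (Q : Place W L) : E (twist k K n Q) = E Q := by
  rw [twistDiv_eq_self_iff] at hE
  induction n using Int.induction_on with
  | zero => rw [twist_zero]
  | succ n ih => rw [add_comm, twist_add, hE, ih]
  | pred n ih =>
    rw [← ih, ← hE, ← twist_add]
    congr 2
    ring

variable [IsCurveFunctionField W L]

/-- The sections of a divisor which is invariant under the twist are spanned over `W` by functions
on the curve over `k`. -/
theorem mem_span_incl_of_mem_H0 {E : Divisor W L} (hE : twistDiv k K 1 E = E) {f : L}
    (hf : f ∈ H0 E) :
    f ∈ Submodule.span W (incl k K W L '' {a | incl k K W L a ∈ H0 E}) := by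
  have h := mem_span_fixed_of_stable (k := k) (K := K) (one_ne_zero (α := L)) (V := H0 E)
    (fun f hf => by
      rw [one_mul]
      have := (twistFun_mem_H0_iff (k := k) (K := K) 1).2 hf
      rwa [hE] at this) hf
  refine Submodule.span_mono ?_ h
  rintro g ⟨hg, hg1⟩
  rw [one_mul] at hg1
  obtain ⟨a, rfl⟩ := exists_incl_eq_of_twistFun_eq hg1
  exact ⟨a, hg, rfl⟩

/-- A divisor of large degree which is invariant under the twist has a section which is a function
on the curve over `k` and generates it at a given point. -/
theorem exists_incl_ord_eq {E : Divisor W L} (hE : twistDiv k K 1 E = E) (Q : Place W L)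
    (hdeg : 2 * (genus W L : ℤ) - 1 < E.deg) :
    ∃ a : K, a ≠ 0 ∧ incl k K W L a ∈ H0 E ∧ Q.ord (incl k K W L a) = -E Q := by
  have hd : (E - Finsupp.single Q 1).deg = E.deg - 1 := by
    rw [Divisor.deg_sub, Divisor.deg_single, Q.degree_eq_one, Nat.cast_one, one_mul]
  obtain ⟨a, ha, ha'⟩ : ∃ a : K, incl k K W L a ∈ H0 E ∧
      incl k K W L a ∉ H0 (E - Finsupp.single Q 1) := by
    by_contra! hall
    have hle : H0 E ≤ H0 (E - Finsupp.single Q 1) := fun f hf => by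
      refine Submodule.span_le.2 ?_ (mem_span_incl_of_mem_H0 hE hf)
      rintro _ ⟨a, ha, rfl⟩
      exact hall a ha
    have h1 := Submodule.finrank_mono hle
    have h2 := h0_eq (E := E) (by omega)
    have h3 := h0_eq (E := E - Finsupp.single Q 1) (by omega)
    rw [h0] at h2 h3
    omega
  have ha0 : a ≠ 0 := by
    rintro rfl
    exact ha' (by rw [map_zero]; exact zero_mem _)
  have hia : incl k K W L a ≠ 0 := (map_ne_zero _).2 ha0
  refine ⟨a, ha0, ha, ?_⟩
  have h1 := (Q.mem_stalk_iff_ord hia).1 (mem_H0.1 ha Q)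
  by_contra hne
  apply ha'
  rw [mem_H0]
  intro R
  rcases eq_or_ne R Q with rfl | hR
  · rw [R.mem_stalk_iff_ord hia, Finsupp.sub_apply, Finsupp.single_eq_same]
    omega
  · rw [Finsupp.sub_apply, Finsupp.single_eq_of_ne hR, sub_zero]
    exact mem_H0.1 ha R

variable [IsCurveFunctionField k K]

variable (W L) in
theorem exists_liesOver (P : Place k K) : ∃ Q : Place W L, Q.LiesOver P := by
  obtain ⟨f, hf, hreg⟩ := exists_transcendental_regular_away P
  obtain ⟨Q, hQ⟩ := exists_notMem_of_transcendental (transcendental_incl (W := W) (L := L) hf)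
  rcases Q.exists_liesOver_or k K with ⟨P', hP'⟩ | h
  · by_cases hPP : P' = P
    · exact ⟨Q, hPP ▸ hP'⟩
    · exact absurd ((hP'.mem_iff f).2 (hreg P' hPP)) hQ
  · exact absurd (h f) hQ

theorem twistDiv_baseChange (D : Divisor k K) :
    twistDiv k K 1 (D.baseChange W L) = D.baseChange W L :=
  (twistDiv_eq_self_iff k K).2 fun Q => D.baseChange_twist 1 Q

variable (k K W L) in
/-- Base change of divisors as a homomorphism. -/
def Divisor.baseChangeHom : Divisor k K →+ Divisor W L where
  toFun := Divisor.baseChange W L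
  map_zero' := Finsupp.sum_zero_index
  map_add' := Divisor.baseChange_add W L

variable (W L) in
theorem Divisor.one_le_deg_baseChange_single (P : Place k K) :
    1 ≤ (Divisor.baseChange W L (Finsupp.single P 1 : Divisor k K)).deg := by
  obtain ⟨Q, hQ⟩ := exists_liesOver W L P
  have h1 : (Finsupp.single Q 1 : Divisor W L) ≤
      Divisor.baseChange W L (Finsupp.single P 1 : Divisor k K) := fun R => by
    rcases eq_or_ne R Q with rfl | hR
    · rw [hQ.baseChange_apply, Finsupp.single_eq_same, Finsupp.single_eq_same]
    · rw [Finsupp.single_eq_of_ne hR]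
      exact Divisor.baseChange_nonneg (by simp) R
  have h2 := deg_mono h1
  rwa [Divisor.deg_single, Q.degree_eq_one, Nat.cast_one, one_mul] at h2

/-- The base change is unramified. The order at `Q` of functions on the curve over `k` is a
multiple `e` of that at `P`, and both `-m` and `-(m + 1)` occur as orders at `Q`, for the generating
sections of multiples of the fibre of `P`. -/
theorem Place.LiesOver.ord_incl {Q : Place W L} {P : Place k K} (h : Q.LiesOver P) (a : K) :
    Q.ord (incl k K W L a) = P.ord a := by
  obtain ⟨π, hπ0, hπ⟩ := P.exists_ord_eq 1
  set e := Q.ord (incl k K W L π) with he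
  have he0 : 0 < e := h.ord_pos (by rw [hπ]; exact one_pos)
  have hunit : ∀ u : K, u ≠ 0 → P.ord u = 0 → Q.ord (incl k K W L u) = 0 := fun u hu0 hu => by
    have h1 : u ∈ P.O := by
      rw [← Place.mem_stalk_zero, Place.mem_stalk_iff_ord _ hu0]; omega
    have h2 : u⁻¹ ∈ P.O := by
      rw [← Place.mem_stalk_zero, Place.mem_stalk_iff_ord _ (inv_ne_zero hu0), Place.ord_inv]
      omega
    have hi0 : incl k K W L u ≠ 0 := (map_ne_zero _).2 hu0
    rw [← h.mem_iff, ← Place.mem_stalk_zero, Place.mem_stalk_iff_ord _ hi0] at h1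
    rw [← h.mem_iff, map_inv₀, ← Place.mem_stalk_zero,
      Place.mem_stalk_iff_ord _ (inv_ne_zero hi0), Place.ord_inv] at h2
    omega
  have hmul : ∀ a : K, a ≠ 0 → Q.ord (incl k K W L a) = e * P.ord a := fun a ha => by
    have hz : π ^ (-P.ord a) ≠ 0 := zpow_ne_zero _ hπ0
    have h1 := hunit (a * π ^ (-P.ord a)) (mul_ne_zero ha hz) (by
      rw [Place.ord_mul _ ha hz, Place.ord_zpow, hπ]; ring)
    rw [map_mul, map_zpow₀, Place.ord_mul _ ((map_ne_zero _).2 ha)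
      (zpow_ne_zero _ ((map_ne_zero _).2 hπ0)), Place.ord_zpow, ← he] at h1
    linarith
  set T := Divisor.baseChange W L (Finsupp.single P 1 : Divisor k K) with hT
  have hTdeg : 1 ≤ T.deg := Divisor.one_le_deg_baseChange_single W L P
  have hTQ : T Q = 1 := by rw [hT, h.baseChange_apply, Finsupp.single_eq_same]
  have key : ∀ m : ℕ, 2 * genus W L ≤ m → e ∣ (m : ℤ) := fun m hm => by
    have hinv : twistDiv k K 1 (m • T) = m • T := (twistDiv_eq_self_iff k K).2 fun R => by
      rw [Finsupp.smul_apply, Finsupp.smul_apply, hT, Divisor.baseChange_twist]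
    obtain ⟨a, ha0, -, ha⟩ := exists_incl_ord_eq hinv Q (by
      rw [Divisor.deg_nsmul]
      have : (m : ℤ) ≤ m * T.deg := by nlinarith
      omega)
    rw [hmul a ha0, Finsupp.smul_apply, hTQ] at ha
    refine (dvd_neg (α := ℤ)).1 ⟨P.ord a, ?_⟩
    rw [ha]
    simp
  have h1 : e ∣ 1 := by
    have h2 := key (2 * genus W L) le_rfl
    have h3 := key (2 * genus W L + 1) (by omega)
    have := dvd_sub h3 h2
    push_cast at this
    simpa using this
  have he1 : e = 1 := Int.eq_one_of_dvd_one he0.le h1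
  by_cases ha : a = 0
  · rw [ha, map_zero, Place.ord_zero, Place.ord_zero]
  · rw [hmul a ha, he1, one_mul]

theorem Place.LiesOver.incl_mem_stalk_iff {Q : Place W L} {P : Place k K} (h : Q.LiesOver P)
    {n : ℤ} {a : K} : incl k K W L a ∈ Q.stalk n ↔ a ∈ P.stalk n := by
  by_cases ha : a = 0
  · rw [ha, map_zero]
    exact ⟨fun _ => zero_mem _, fun _ => zero_mem _⟩
  · rw [Place.mem_stalk_iff_ord _ ha, Place.mem_stalk_iff_ord _ ((map_ne_zero _).2 ha), h.ord_incl]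

theorem incl_mem_H0_baseChange {E : Divisor k K} {a : K} :
    incl k K W L a ∈ H0 (E.baseChange W L) ↔ a ∈ H0 E := by
  rw [mem_H0, mem_H0]
  constructor
  · intro h P
    obtain ⟨Q, hQ⟩ := exists_liesOver W L P
    have := h Q
    rwa [hQ.baseChange_apply, hQ.incl_mem_stalk_iff] at this
  · intro h Q
    rcases Q.exists_liesOver_or k K with ⟨P, hP⟩ | hQ
    · rw [hP.baseChange_apply, hP.incl_mem_stalk_iff]
      exact h P
    · rw [Divisor.baseChange_apply_of_forall_mem hQ, Place.mem_stalk_zero]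
      exact hQ a

/-- The twist permutes the points over a closed point transitively. A generating section at `Q'`
for the multiple of the fibre of `P`, diminished by the orbit of `Q`, would have different
orders at `Q` and `Q'` if `Q'` were not in that orbit. -/
theorem Place.LiesOver.exists_twist_eq {Q Q' : Place W L} {P : Place k K} (h : Q.LiesOver P)
    (h' : Q'.LiesOver P) : ∃ n : ℤ, twist k K n Q = Q' := by
  classical
  by_contra hno
  set S : Set (Place W L) := Set.range fun n : ℤ => twist k K n Q with hS
  have hSfin : S.Finite := (finite_liesOver W L P).subset (by
    rintro _ ⟨n, rfl⟩
    exact liesOver_twist_iff.2 h)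
  set A : Divisor W L := ∑ R ∈ hSfin.toFinset, Finsupp.single R 1 with hA
  have hAR : ∀ R, A R = if R ∈ S then 1 else 0 := fun R => by
    rw [hA, Finsupp.finsetSum_apply]
    simp [Finsupp.single_apply]
  have hSt : ∀ R, twist k K 1 R ∈ S ↔ R ∈ S := fun R => by
    constructor
    · rintro ⟨n, hn⟩
      refine ⟨-1 + n, ?_⟩
      dsimp only at hn ⊢
      rw [twist_add, hn, twist_neg_twist]
    · rintro ⟨n, rfl⟩
      exact ⟨1 + n, twist_add _ _ _⟩
  set T := Divisor.baseChange W L (Finsupp.single P 1 : Divisor k K) with hT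
  have hTdeg : 1 ≤ T.deg := Divisor.one_le_deg_baseChange_single W L P
  set m : ℕ := 2 * genus W L + A.deg.toNat with hm
  have hinv : twistDiv k K 1 (m • T - A) = m • T - A := (twistDiv_eq_self_iff k K).2 fun R => by
    rw [Finsupp.sub_apply, Finsupp.sub_apply, Finsupp.smul_apply, Finsupp.smul_apply, hT,
      Divisor.baseChange_twist, hAR, hAR, hSt]
  obtain ⟨a, ha0, ha, haQ⟩ := exists_incl_ord_eq hinv Q' (by
    rw [Divisor.deg_sub, Divisor.deg_nsmul]
    have : (m : ℤ) ≤ m * T.deg := by nlinarith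
    omega)
  have h1 := (Q.mem_stalk_iff_ord ((map_ne_zero _).2 ha0)).1 (mem_H0.1 ha Q)
  rw [Finsupp.sub_apply, hAR, if_neg (fun ⟨n, hn⟩ => hno ⟨n, hn⟩), sub_zero, Finsupp.smul_apply,
    hT, h'.baseChange_apply, h'.ord_incl] at haQ
  rw [Finsupp.sub_apply, hAR, if_pos ⟨0, twist_zero Q⟩, Finsupp.smul_apply,
    hT, h.baseChange_apply, h.ord_incl] at h1
  omega

variable (k K) in
/-- A divisor which is invariant under the twist comes from the curve over `k`. -/
theorem exists_baseChange_eq {E : Divisor W L} (hE : twistDiv k K 1 E = E) :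
    ∃ E₀ : Divisor k K, E₀.baseChange W L = E := by
  choose s hs using exists_liesOver (k := k) (K := K) W L
  have hfin : (Function.support fun P => E (s P)).Finite := by
    refine Set.Finite.of_finite_image (f := s) (E.support.finite_toSet.subset ?_) ?_
    · rintro _ ⟨P, hP, rfl⟩
      exact Finsupp.mem_support_iff.2 hP
    · intro P _ P' _ h
      have h1 := hs P
      rw [h] at h1
      exact h1.eq (hs P')
  refine ⟨Finsupp.ofSupportFinite (fun P => E (s P)) hfin, ?_⟩
  ext Q
  rcases Q.exists_liesOver_or k K with ⟨P, hP⟩ | h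
  · rw [hP.baseChange_apply, Finsupp.ofSupportFinite_coe]
    obtain ⟨n, rfl⟩ := (hs P).exists_twist_eq hP
    exact (twistDiv_eq_self_twist hE n _).symm
  · rw [Divisor.baseChange_apply_of_forall_mem h]
    by_contra hne
    refine Set.infinite_range_of_injective (f := fun n : ℤ => twist k K n Q)
      (fun m n hmn => (twist_eq_twist_iff h).1 hmn) (E.support.finite_toSet.subset ?_)
    rintro _ ⟨n, rfl⟩
    rw [Finset.mem_coe, Finsupp.mem_support_iff, twistDiv_eq_self_twist hE]
    exact fun h => hne h.symm

/-- A basis of `H⁰(O(E))` yields a basis of the sections of the base change. -/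
theorem mem_span_incl_basis {ι : Type*} {E : Divisor k K} (b : Module.Basis ι k (H0 E)) {f : L}
    (hf : f ∈ H0 (E.baseChange W L)) :
    f ∈ Submodule.span W (Set.range fun i => incl k K W L (b i)) := by
  refine Submodule.span_le.2 ?_ (mem_span_incl_of_mem_H0 (twistDiv_baseChange E) hf)
  rintro _ ⟨a, ha, rfl⟩
  have ha' : a ∈ H0 E := incl_mem_H0_baseChange.1 ha
  have h1 := congrArg (fun z : H0 E => incl k K W L (z : K)) (b.linearCombination_repr ⟨a, ha'⟩)
  dsimp only at h1
  rw [SetLike.mem_coe, ← h1, Finsupp.linearCombination_apply, Finsupp.sum,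
    AddSubmonoidClass.coe_finsetSum, map_sum]
  refine sum_mem fun i _ => ?_
  rw [Submodule.coe_smul, Algebra.smul_def, map_mul, incl_algebraMap, ← Algebra.smul_def]
  exact Submodule.smul_mem _ _ (Submodule.subset_span ⟨i, rfl⟩)

variable (W L) in
theorem h0_baseChange (E : Divisor k K) : h0 (E.baseChange W L) = h0 E := by
  let b := Module.finBasis k (H0 E)
  have hli : LinearIndependent W fun i => incl k K W L (b i) :=
    linearIndependent_incl (b.linearIndependent.map' (H0 E).subtype (Submodule.ker_subtype _))
  have hspan : Submodule.span W (Set.range fun i => incl k K W L (b i)) =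
      H0 (E.baseChange W L) := by
    refine le_antisymm (Submodule.span_le.2 ?_) fun f hf => mem_span_incl_basis b hf
    rintro _ ⟨i, rfl⟩
    exact incl_mem_H0_baseChange.2 (b i).2
  rw [h0, ← hspan, finrank_span_eq_card hli, Fintype.card_fin, h0]

variable (W L) in
/-- Base change preserves degrees, by comparison of the Riemann-Roch formulas for large multiples of
a point and of its fibre. -/
theorem Divisor.deg_baseChange (E : Divisor k K) : (E.baseChange W L).deg = E.deg := by
  have hsingle : ∀ P : Place k K,
      (Divisor.baseChange W L (Finsupp.single P 1 : Divisor k K)).deg = P.degree := fun P => by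
    have h1 := Divisor.one_le_deg_baseChange_single W L P
    have h2 : (1 : ℤ) ≤ P.degree := by exact_mod_cast P.degree_pos
    have key : ∀ n : ℕ, 2 * (genus k K + genus W L) ≤ n →
        n * (Divisor.baseChange W L (Finsupp.single P 1 : Divisor k K)).deg + 1 - genus W L =
          n * P.degree + 1 - genus k K := fun n hn => by
      have h3 : Divisor.baseChange W L (n • Finsupp.single P 1 : Divisor k K) =
          n • Divisor.baseChange W L (Finsupp.single P 1 : Divisor k K) :=
        map_nsmul (Divisor.baseChangeHom k K W L) _ _
      have h4 : (n : ℤ) ≤ n * P.degree := by nlinarith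
      have h5 : (n : ℤ) ≤
        n * (Divisor.baseChange W L (Finsupp.single P 1 : Divisor k K)).deg := by nlinarith
      have h6 : (n • Finsupp.single P 1 : Divisor k K).deg = n * P.degree := by
        rw [Divisor.deg_nsmul, Divisor.deg_single, one_mul]
      have h7 := h0_eq (E := (n • Finsupp.single P 1 : Divisor k K)) (by rw [h6]; omega)
      have h8 := h0_eq (E := n • Divisor.baseChange W L (Finsupp.single P 1 : Divisor k K))
        (by rw [Divisor.deg_nsmul]; omega)
      rw [← h3, h0_baseChange, h3, Divisor.deg_nsmul] at h8
      rw [h6] at h7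
      omega
    have h3 := key (2 * (genus k K + genus W L)) le_rfl
    have h4 := key (2 * (genus k K + genus W L) + 1) (by omega)
    push_cast at h3 h4
    linarith
  have h : (Divisor.degHom W L).comp (Divisor.baseChangeHom k K W L) = Divisor.degHom k K := by
    refine Finsupp.addHom_ext' fun P => AddMonoidHom.ext_int ?_
    change (Divisor.baseChange W L (Finsupp.single P 1 : Divisor k K)).deg =
      Divisor.deg (Finsupp.single P 1 : Divisor k K)
    rw [hsingle, Divisor.deg_single, one_mul]
  exact DFunLike.congr_fun h E

end Descent

/-! ### Moore systems -/

section Linearized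

variable {W : Type*} [Field W]

/-- The polynomial `∑ cᵢ X ^ (q ^ i)`, where `i` runs up to `n - 1`. -/
def linearized (q : ℕ) (c : ℕ → W) (n : ℕ) : Polynomial W :=
  ∑ i ∈ Finset.range n, Polynomial.C (c i) * Polynomial.X ^ q ^ i

theorem eval_linearized (q : ℕ) (c : ℕ → W) (n : ℕ) (x : W) :
    (linearized q c n).eval x = ∑ i ∈ Finset.range n, c i * x ^ q ^ i := by
  simp [linearized, Polynomial.eval_finsetSum]

theorem degree_linearized_lt {q : ℕ} (hq : 1 < q) (c : ℕ → W) (n : ℕ) :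
    (linearized q c n).degree < (q ^ n : ℕ) := by
  refine (Polynomial.degree_sum_le _ _).trans_lt ?_
  rw [Finset.sup_lt_iff (WithBot.bot_lt_coe _)]
  intro i hi
  refine (Polynomial.degree_C_mul_X_pow_le _ _).trans_lt ?_
  exact_mod_cast Nat.pow_lt_pow_right hq (Finset.mem_range.1 hi)

theorem linearized_succ (q : ℕ) {c : ℕ → W} {n : ℕ} (hc : c n = 1) :
    linearized q c (n + 1) = Polynomial.X ^ q ^ n + linearized q c n := by
  rw [linearized, Finset.sum_range_succ, hc, Polynomial.C_1, one_mul, add_comm, linearized]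

end Linearized

section Moore

variable {k W : Type*} [Field k] [Fintype k] [Field W] [Algebra k W]

theorem sum_smul_pow_card_pow {ι : Type*} (s : Finset ι) (a : ι → k) (v : ι → W) (m : ℕ) :
    (∑ j ∈ s, a j • v j) ^ Fintype.card k ^ m = ∑ j ∈ s, a j • v j ^ Fintype.card k ^ m := by
  induction m with
  | zero => simp
  | succ m ih =>
    have h := map_sum (FiniteField.frobeniusAlgHom k W) (fun j => a j • v j ^ Fintype.card k ^ m) s
    simp only [map_smul, FiniteField.frobeniusAlgHom_apply, ← pow_mul] at h
    rw [pow_succ, pow_mul, ih, h]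

theorem eval_linearized_sum_smul (c : ℕ → W) (n : ℕ) {ι : Type*} [Fintype ι] (a : ι → k)
    (v : ι → W) : (linearized (Fintype.card k) c n).eval (∑ j, a j • v j) =
      ∑ j, a j • (linearized (Fintype.card k) c n).eval (v j) := by
  simp only [eval_linearized, sum_smul_pow_card_pow, Finset.mul_sum, Finset.smul_sum]
  rw [Finset.sum_comm]
  simp only [mul_smul_comm]

/-- The `k`-span of `v`, of cardinality `q ^ n`. -/
theorem exists_card_span {n : ℕ} {v : Fin n → W} (hv : LinearIndependent k v) :
    ∃ s : Finset W, s.card = Fintype.card k ^ n ∧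
      ∀ x ∈ s, ∃ a : Fin n → k, ∑ j, a j • v j = x := by
  classical
  have hinj : Function.Injective fun a : Fin n → k => ∑ j, a j • v j :=
    hv.fintypeLinearCombination_injective
  refine ⟨Finset.univ.image fun a : Fin n → k => ∑ j, a j • v j, ?_, fun x hx => ?_⟩
  · rw [Finset.card_image_of_injective _ hinj, Finset.card_univ, Fintype.card_fun,
      Fintype.card_fin]
  · obtain ⟨a, -, ha⟩ := Finset.mem_image.1 hx
    exact ⟨a, ha⟩

/-- The vectors `(v_j ^ (q ^ i))_j`, for `i < n`, are linearly independent if the `n` elements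
`v_j` are linearly independent over `k`: a linearized polynomial which vanishes at all `v_j` has
more roots than its degree permits. -/
theorem coeff_eq_zero_of_sum_pow_eq_zero {n : ℕ} {v : Fin n → W} (hv : LinearIndependent k v)
    {c : ℕ → W} (hc : ∀ j, ∑ i ∈ Finset.range n, c i * v j ^ Fintype.card k ^ i = 0) :
    ∀ i < n, c i = 0 := by
  have hq : 1 < Fintype.card k := Fintype.one_lt_card
  obtain ⟨s, hs, hmem⟩ := exists_card_span hv
  have hdeg : (linearized (Fintype.card k) c n).degree < s.card := by
    rw [hs]
    exact degree_linearized_lt hq c n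
  have h0 : linearized (Fintype.card k) c n = 0 := by
    refine Polynomial.eq_zero_of_degree_lt_of_eval_finset_eq_zero s hdeg fun x hx => ?_
    obtain ⟨a, rfl⟩ := hmem x hx
    rw [eval_linearized_sum_smul]
    refine Finset.sum_eq_zero fun j _ => ?_
    rw [eval_linearized, hc, smul_zero]
  intro i hi
  have h1 := congrArg (fun p => Polynomial.coeff p (Fintype.card k ^ i)) h0
  simp only [linearized, Polynomial.finsetSum_coeff, Polynomial.coeff_C_mul,
    Polynomial.coeff_X_pow, Polynomial.coeff_zero] at h1
  rw [Finset.sum_eq_single_of_mem i (Finset.mem_range.2 hi)] at h1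
  · simpa using h1
  · intro i' _ hi'
    rw [if_neg fun h => hi' (Nat.pow_right_injective hq h).symm, mul_zero]

theorem isUnit_moore {n : ℕ} {v : Fin n → W} (hv : LinearIndependent k v) :
    IsUnit (Matrix.of fun i j : Fin n => v j ^ Fintype.card k ^ (i : ℕ)) := by
  rw [← Matrix.vecMul_injective_iff_isUnit]
  refine (injective_iff_map_eq_zero (Matrix.vecMulLinear _)).2 fun d hd => ?_
  ext i
  have h := coeff_eq_zero_of_sum_pow_eq_zero hv (c := fun i => if h : i < n then d ⟨i, h⟩ else 0)
    (fun j => by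
      have h1 : ∑ i : Fin n, d i * v j ^ Fintype.card k ^ (i : ℕ) = 0 := congrFun hd j
      rw [Finset.sum_range, ← h1]
      exact Finset.sum_congr rfl fun i _ => by rw [dif_pos i.2]) i i.2
  rwa [dif_pos i.2] at h

theorem isUnit_moore_succ {n : ℕ} {v : Fin n → W} (hv : LinearIndependent k v) :
    IsUnit (Matrix.of fun i j : Fin n => v j ^ Fintype.card k ^ ((i : ℕ) + 1)) := by
  have h : (Matrix.of fun i j : Fin n => v j ^ Fintype.card k ^ ((i : ℕ) + 1)) =
      (Matrix.of fun i j : Fin n => v j ^ Fintype.card k ^ (i : ℕ)).map (frobHom k W) := by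
    ext i j
    rw [Matrix.map_apply, Matrix.of_apply, Matrix.of_apply, frobHom_apply, ← pow_mul, pow_succ]
  rw [h]
  exact (isUnit_moore hv).map (frobHom k W).mapMatrix

/-- The monic polynomial whose roots are the elements of the `k`-span of the `v_j` is linearized,
and its linear coefficient does not vanish. -/
theorem exists_linearized_eq_prod {n : ℕ} {v : Fin n → W} (hv : LinearIndependent k v) :
    ∃ c : ℕ → W, c 0 ≠ 0 ∧ ∀ x : W, ∑ i ∈ Finset.range (n + 1), c i * x ^ Fintype.card k ^ i =
      ∏ a : Fin n → k, (x - ∑ j, a j • v j) := by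
  classical
  have hq : 1 < Fintype.card k := Fintype.one_lt_card
  obtain ⟨d, hd⟩ := (Matrix.vecMul_surjective_iff_isUnit.2 (isUnit_moore hv))
    fun j => -v j ^ Fintype.card k ^ n
  let c : ℕ → W := fun i => if h : i < n then d ⟨i, h⟩ else 1
  have hcn : c n = 1 := dif_neg (lt_irrefl n)
  have hc : ∀ j, ∑ i ∈ Finset.range (n + 1), c i * v j ^ Fintype.card k ^ i = 0 := fun j => by
    have h1 := congrFun hd j
    dsimp only [Matrix.vecMul, dotProduct] at h1
    rw [Finset.sum_range_succ, hcn, one_mul, Finset.sum_range, ← eq_neg_iff_add_eq_zero, ← h1]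
    refine Finset.sum_congr rfl fun i _ => ?_
    simp only [c, dif_pos i.2, Matrix.of_apply]
  refine ⟨c, fun hc0 => ?_, fun x => ?_⟩
  · -- otherwise the first `n` rows of the twisted Moore matrix would be dependent
    have h1 := Matrix.vecMul_injective_iff_isUnit.2 (isUnit_moore_succ hv)
    have h2 : (fun i : Fin n => c (i + 1)) = 0 := by
      apply h1
      dsimp only
      rw [Matrix.zero_vecMul]
      ext j
      rw [Pi.zero_apply, ← hc j, Finset.sum_range_succ', hc0, zero_mul, add_zero,
        Finset.sum_range]
      rfl
    rcases Nat.eq_zero_or_pos n with rfl | hn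
    · exact one_ne_zero (hcn.symm.trans hc0)
    · have h3 := congrFun h2 ⟨n - 1, by omega⟩
      dsimp only at h3
      rw [Nat.sub_add_cancel hn, hcn] at h3
      exact one_ne_zero h3
  · obtain ⟨s, hs, hmem⟩ := exists_card_span hv
    have hdeg := degree_linearized_lt hq c n
    have hdegp : (linearized (Fintype.card k) c (n + 1)).degree =
        ((Fintype.card k ^ n : ℕ) : WithBot ℕ) := by
      rw [linearized_succ _ hcn, Polynomial.degree_add_eq_left_of_degree_lt,
        Polynomial.degree_X_pow]
      rwa [Polynomial.degree_X_pow]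
    have hdegr : (∏ a : Fin n → k, (Polynomial.X - Polynomial.C (∑ j, a j • v j))).degree =
        ((Fintype.card k ^ n : ℕ) : WithBot ℕ) := by
      rw [Polynomial.degree_prod, Finset.sum_congr rfl fun a _ => Polynomial.degree_X_sub_C _]
      simp
    have heq : linearized (Fintype.card k) c (n + 1) =
        ∏ a : Fin n → k, (Polynomial.X - Polynomial.C (∑ j, a j • v j)) := by
      refine Polynomial.eq_of_degree_sub_lt_of_eval_finset_eq s ?_ fun x hx => ?_
      · rw [hs, ← hdegp]
        refine Polynomial.degree_sub_lt_left (hdegp.trans hdegr.symm) ?_ ?_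
        · intro h
          rw [h, Polynomial.degree_zero] at hdegp
          exact WithBot.bot_ne_coe hdegp
        · rw [(Polynomial.monic_prod_of_monic _ _
              fun a _ => Polynomial.monic_X_sub_C _).leadingCoeff,
            linearized_succ _ hcn]
          exact (Polynomial.monic_X_pow_add hdeg).leadingCoeff
      · obtain ⟨a, rfl⟩ := hmem x hx
        rw [eval_linearized_sum_smul, Polynomial.eval_prod, Finset.prod_eq_zero (Finset.mem_univ a)
          (by rw [Polynomial.eval_sub, Polynomial.eval_X, Polynomial.eval_C, sub_self])]
        refine Finset.sum_eq_zero fun j _ => ?_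
        rw [eval_linearized, hc, smul_zero]
    rw [← eval_linearized, heq, Polynomial.eval_prod]
    exact Finset.prod_congr rfl fun a _ => by
      rw [Polynomial.eval_sub, Polynomial.eval_X, Polynomial.eval_C]

end Moore

/-! ### Divisors of shtukas up to equivalence -/

section AvoidPlaces

variable {k K : Type*} [Field k] [Field K] [Algebra k K] [IsCurveFunctionField k K]

/-- There are closed points outside a given finite set: a function with simple zeros at the
points of that set has a pole elsewhere. -/
theorem exists_place_notMem (T : Finset (Place k K)) : ∃ P : Place k K, P ∉ T := by
  rcases T.eq_empty_or_nonempty with rfl | ⟨P, hP⟩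
  · obtain ⟨P⟩ := exists_place k K
    exact ⟨P, Finset.notMem_empty P⟩
  · choose r hr0 hr using fun P : Place k K => P.exists_ord_eq 1
    obtain ⟨f, hf⟩ := Place.exists_approx T r 2
    have hord : ∀ R ∈ T, R.ord f = 1 := fun R hR => by
      rw [← hr R]
      refine R.ord_eq_of_val_sub_lt ((R.mem_stalk.1 (hf R hR)).trans_lt ?_)
      rw [R.val_eq (hr0 R), hr R, WithZero.exp_lt_exp]
      norm_num
    have hf0 : f ≠ 0 := by
      rintro rfl
      have := hord P hP
      rw [Place.ord_zero] at this
      exact zero_ne_one this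
    obtain ⟨R, hR⟩ := exists_notMem_of_transcendental
      (P.transcendental_of_ord_ne_zero (f := f) (by rw [hord P hP]; exact one_ne_zero))
    refine ⟨R, fun hRT => hR ?_⟩
    rw [← Place.mem_stalk_zero, Place.mem_stalk_iff_ord _ hf0, hord R hRT]
    norm_num

end AvoidPlaces

section IsOneOn

variable {F K : Type*} [Field F] [Field K] [Algebra F K]

theorem Divisor.apply_pos {D : Divisor F K} (hD : 0 ≤ D) {P : Place F K} (hP : P ∈ D.support) :
    0 < D P :=
  lt_of_le_of_ne (hD P) (Ne.symm (Finsupp.mem_support_iff.1 hP))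

theorem IsOneOn.val_sub_lt_one {D : Divisor F K} (hD : 0 ≤ D) {f : K} (hf : IsOneOn D f)
    {P : Place F K} (hP : P ∈ D.support) : P.val (f - 1) < 1 := by
  rw [← Place.mem_stalk_neg_one]
  exact P.stalk_mono (by have := Divisor.apply_pos hD hP; omega) (hf P hP)

theorem IsOneOn.ord_eq_zero {D : Divisor F K} (hD : 0 ≤ D) {f : K} (hf : IsOneOn D f)
    {P : Place F K} (hP : P ∈ D.support) : P.ord f = 0 := by
  rw [P.ord_eq_of_val_sub_lt (f := f) (g := 1) (by rw [map_one]; exact hf.val_sub_lt_one hD hP),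
    Place.ord_one]

theorem IsOneOn.ne_zero {D : Divisor F K} (hD : 0 ≤ D) {f : K} (hf : IsOneOn D f)
    {P : Place F K} (hP : P ∈ D.support) : f ≠ 0 := by
  rintro rfl
  have h := hf.val_sub_lt_one hD hP
  rw [zero_sub, Valuation.map_neg, map_one] at h
  exact lt_irrefl _ h

theorem IsOneOn.inv {D : Divisor F K} (hD : 0 ≤ D) {f : K} (hf : IsOneOn D f) :
    IsOneOn D f⁻¹ := by
  intro P hP
  have hf0 := hf.ne_zero hD hP
  have h : f⁻¹ - 1 = -(f⁻¹ * (f - 1)) := by field_simp; ring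
  rw [← Place.mem_stalk, h, Submodule.neg_mem_iff, P.mul_mem_stalk_iff (inv_ne_zero hf0),
    P.ord_inv, hf.ord_eq_zero hD hP, neg_zero, add_zero]
  exact hf P hP

end IsOneOn

section Invariant

variable {k K W L : Type*} [Field k] [Fintype k] [Field K] [Algebra k K] [IsCurveFunctionField k K]
  [Field W] [Algebra k W] [IsAlgClosed W] [Field L] [Algebra W L] [Algebra (W ⊗[k] K) L]
  [IsScalarTower W (W ⊗[k] K) L] [IsFractionRing (W ⊗[k] K) L] [IsCurveFunctionField W L]

/-- A divisor which is equivalent to its twist is equivalent to a divisor of the curve over `k`.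
If `(u)` is the difference of the divisor and its twist, the claim amounts to the existence of
`h` with `u⁻¹ h⁽¹⁾ = h` and `h|_D = 1`. A function with the latter property is corrected to a fixed
one by Lang's theorem for the sections which vanish on `D`. -/
theorem exists_baseChange_equivOn {D : Divisor k K} (hD : 0 ≤ D) (hD0 : D ≠ 0) {E : Divisor W L}
    (hED : E.SupportedAway (D.baseChange W L))
    (hE : EquivOn (D.baseChange W L) (E - twistDiv k K 1 E) 0) :
    ∃ E₀ : Divisor k K, E₀.SupportedAway D ∧
      EquivOn (D.baseChange W L) E (E₀.baseChange W L) := by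
  classical
  obtain ⟨u, hu0, hu1, hu⟩ := hE
  have hD' : 0 ≤ D.baseChange W L := Divisor.baseChange_nonneg hD
  obtain ⟨P₁, hP₁⟩ := exists_place_notMem D.support
  -- the multiple of `P₁` serves to make the degree of `B` large
  set n : ℕ := (2 * (genus W L : ℤ) - E.deg + D.deg).toNat with hn
  set C : Divisor k K := n • Finsupp.single P₁ 1 - D with hC
  set B : Divisor W L := E + C.baseChange W L with hB
  have hBdeg : 2 * (genus W L : ℤ) - 2 < B.deg := by
    have h1 : (1 : ℤ) ≤ P₁.degree := by exact_mod_cast P₁.degree_pos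
    rw [hB, Divisor.deg_add, Divisor.deg_baseChange, hC, Divisor.deg_sub, Divisor.deg_nsmul,
      Divisor.deg_single, one_mul]
    have h2 : (n : ℤ) ≤ n * P₁.degree := by nlinarith
    omega
  have hBD : ∀ Q ∈ (D.baseChange W L).support, B Q = -(D.baseChange W L Q) := fun Q hQ => by
    obtain ⟨P, hP, hQP⟩ := Divisor.mem_support_baseChange.1 hQ
    have hPP : P ≠ P₁ := fun h => hP₁ (h ▸ hP)
    rw [hB, Finsupp.add_apply, Finsupp.notMem_support_iff.1 (Finset.disjoint_right.1 hED hQ),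
      zero_add, hQP.baseChange_apply, hQP.baseChange_apply, hC, Finsupp.sub_apply,
      Finsupp.smul_apply, Finsupp.single_eq_of_ne hPP, smul_zero, zero_sub]
  -- the operator `z ↦ u⁻¹ z⁽¹⁾` maps the stalk of `O(B)` at a point to that at its twist
  have hstalk : ∀ (Q : Place W L) (z : L), z ∈ Q.stalk (B Q) →
      u⁻¹ * twistFun k K W L 1 z ∈ (twist k K 1 Q).stalk (B (twist k K 1 Q)) := fun Q z hz => by
    have h1 := hu (twist k K 1 Q)
    rw [Finsupp.sub_apply, Finsupp.zero_apply, sub_zero, twistDiv_twist] at h1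
    rw [Place.mul_mem_stalk_iff _ (inv_ne_zero hu0), Place.ord_inv, ← h1, Place.mem_stalk,
      val_twist, hB, Finsupp.add_apply, Divisor.baseChange_twist]
    rw [Place.mem_stalk, hB, Finsupp.add_apply] at hz
    convert hz using 2
    ring
  have hstable : ∀ z ∈ H0 B, u⁻¹ * twistFun k K W L 1 z ∈ H0 B := fun z hz => mem_H0.2 fun Q => by
    rw [← twist_twist_neg (k := k) (K := K) 1 Q]
    exact hstalk _ z (mem_H0.1 hz _)
  obtain ⟨r, hr1, hr0⟩ : ∃ r : Place W L → L, (∀ Q ∈ (D.baseChange W L).support, r Q = 1) ∧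
      ∀ Q ∉ (D.baseChange W L).support, r Q = 0 :=
    ⟨fun Q => if Q ∈ (D.baseChange W L).support then 1 else 0, fun Q hQ => if_pos hQ,
      fun Q hQ => if_neg hQ⟩
  have hr : r ∈ Repartitions W L := by
    rw [mem_repartitions]
    convert Set.finite_empty
    ext Q
    simp only [Set.mem_ofPred_eq, Set.mem_empty_iff_false, iff_false, not_not]
    rw [Place.mem_stalk_zero]
    by_cases hQ : Q ∈ (D.baseChange W L).support
    · rw [hr1 Q hQ]; exact one_mem _
    · rw [hr0 Q hQ]; exact zero_mem _
  obtain ⟨h₀, hh₀⟩ := exists_sub_mem_stalk hBdeg hr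
  have hdiff : u⁻¹ * twistFun k K W L 1 h₀ - h₀ ∈ H0 B := by
    rw [mem_H0]
    intro R
    obtain ⟨Q, rfl⟩ : ∃ Q, twist k K 1 Q = R := ⟨_, twist_twist_neg 1 R⟩
    have h1 := hstalk Q _ (hh₀ Q)
    have h2 := hh₀ (twist k K 1 Q)
    have hsupp : twist k K 1 Q ∈ (D.baseChange W L).support ↔ Q ∈ (D.baseChange W L).support := by
      rw [Finsupp.mem_support_iff, Finsupp.mem_support_iff, Divisor.baseChange_twist]
    by_cases hQ : Q ∈ (D.baseChange W L).support
    · have hQ' := hsupp.2 hQ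
      have h3 := hu1.inv hD' _ hQ'
      rw [← hBD _ hQ', ← Place.mem_stalk] at h3
      rw [hr1 _ hQ'] at h2
      rw [hr1 _ hQ, map_sub, map_one] at h1
      convert sub_mem (add_mem h1 h3) h2 using 1
      ring
    · rw [hr0 _ (mt hsupp.1 hQ), sub_zero] at h2
      rw [hr0 _ hQ, sub_zero] at h1
      exact sub_mem h1 h2
  obtain ⟨w, hw, hwe⟩ := exists_sub_eq_of_stable (inv_ne_zero hu0) hstable hdiff
  set h := h₀ - w with hh
  have hfix : twistFun k K W L 1 h = u * h := by
    have h1 : u⁻¹ * twistFun k K W L 1 h = h := by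
      rw [hh, map_sub, mul_sub]
      linear_combination -hwe
    rw [← h1, mul_inv_cancel_left₀ hu0, h1]
  have hone : IsOneOn (D.baseChange W L) h := fun Q hQ => by
    have h1 := sub_mem (hh₀ Q) (mem_H0.1 hw Q)
    rw [hr1 Q hQ, hBD Q hQ] at h1
    rw [← Place.mem_stalk]
    convert h1 using 1
    rw [hh]
    ring
  obtain ⟨P, hP⟩ : D.support.Nonempty := Finsupp.support_nonempty_iff.2 hD0
  obtain ⟨Q, hQ⟩ := exists_liesOver W L P
  have hne : h ≠ 0 := hone.ne_zero hD' (Divisor.mem_support_baseChange.2 ⟨P, hP, hQ⟩)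
  obtain ⟨E₀, hE₀⟩ := exists_baseChange_eq k K (E := E + Divisor.div h)
    ((twistDiv_eq_self_iff k K).2 fun Q => by
      have h1 := hu (twist k K 1 Q)
      have h2 := ord_twist (k := k) (K := K) 1 Q h
      rw [Finsupp.sub_apply, Finsupp.zero_apply, sub_zero, twistDiv_twist] at h1
      rw [hfix, Place.ord_mul _ hu0 hne] at h2
      rw [Finsupp.add_apply, Finsupp.add_apply, Divisor.div_apply, Divisor.div_apply]
      omega)
  refine ⟨E₀, ?_, h⁻¹, inv_ne_zero hne, hone.inv hD', fun Q => ?_⟩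
  · rw [Divisor.SupportedAway, Finset.disjoint_right]
    intro P hP
    obtain ⟨Q, hQ⟩ := exists_liesOver W L P
    have hQD : Q ∈ (D.baseChange W L).support := Divisor.mem_support_baseChange.2 ⟨P, hP, hQ⟩
    rw [Finsupp.notMem_support_iff, ← hQ.baseChange_apply, hE₀, Finsupp.add_apply,
      Finsupp.notMem_support_iff.1 (Finset.disjoint_right.1 hED hQD), zero_add, Divisor.div_apply]
    exact hone.ord_eq_zero hD' hQD
  · rw [hE₀, Finsupp.add_apply, Divisor.div_apply, Place.ord_inv]
    ring

end Invariant

/-! ### Liftings of principal parts -/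

section Lift

variable {k K : Type*} [Field k] [Field K] [Algebra k K]

theorem Divisor.SupportedAway.apply_eq_zero {E D : Divisor k K} (h : E.SupportedAway D)
    {P : Place k K} (hP : P ∈ D.support) : E P = 0 :=
  Finsupp.notMem_support_iff.1 (Finset.disjoint_right.1 h hP)

theorem PrincipalParts.apply_eq_zero {D : Divisor k K} (α : PrincipalParts D) {P : Place k K}
    (hP : P ∉ D.support) : α.1 P = 0 := by
  obtain ⟨a, ha, hα⟩ := α.2 P (Set.mem_univ P)
  rw [Finsupp.notMem_support_iff.1 hP] at ha
  rw [← hα]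
  exact (Submodule.Quotient.mk_eq_zero _).2 ha

/-- Liftings exist since `H¹(O(E))` vanishes. -/
theorem exists_isLift [IsCurveFunctionField k K] {D E : Divisor k K} (hD : 0 ≤ D)
    (hED : E.SupportedAway D) (hE : 2 * (genus k K : ℤ) - 2 < E.deg) (α : PrincipalParts D) :
    ∃ a, IsLift D E α a := by
  classical
  choose s hs hsα using fun P : Place k K => α.2 P (Set.mem_univ P)
  have hr : (fun P => if P ∈ D.support then s P else 0) ∈ Repartitions k K := by
    rw [mem_repartitions]
    refine D.support.finite_toSet.subset fun P hP => ?_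
    by_contra h
    refine hP ?_
    rw [if_neg (by exact_mod_cast h)]
    exact zero_mem _
  obtain ⟨a, ha⟩ := exists_sub_mem_stalk hE hr
  refine ⟨a, mem_H0.2 fun P => ?_, fun P hP => ?_⟩
  · have h1 := ha P
    rw [Finsupp.add_apply]
    by_cases hP : P ∈ D.support
    · rw [if_pos hP, hED.apply_eq_zero hP] at h1
      rw [hED.apply_eq_zero hP, zero_add]
      have h2 := add_mem (P.stalk_mono (hD P) h1) (hs P)
      rwa [sub_add_cancel] at h2
    · rw [if_neg hP, sub_zero] at h1
      rwa [Finsupp.notMem_support_iff.1 hP, add_zero]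
  · have h1 := ha P
    rw [if_pos hP, hED.apply_eq_zero hP] at h1
    rw [← hsα P]
    exact (Submodule.Quotient.eq _).2 h1

theorem IsLift.notMem_H0 {D E : Divisor k K} (hED : E.SupportedAway D) {α : PrincipalParts D}
    {a : K} (ha : IsLift D E α a) (hα : α ≠ 0) : a ∉ H0 E := by
  intro haE
  apply hα
  refine Subtype.ext (funext fun P => ?_)
  by_cases hP : P ∈ D.support
  · have h1 := mem_H0.1 haE P
    rw [hED.apply_eq_zero hP] at h1
    rw [← ha.2 P hP]
    exact (Submodule.Quotient.mk_eq_zero _).2 h1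
  · exact PrincipalParts.apply_eq_zero α hP

/-- A ring homomorphism which maps `H⁰(O(E))` isomorphically to the span of `v` maps the
hypergeometric ratio to the ratio of the products `∏ (x - ∑ xⱼ vⱼ)`. -/
theorem exists_map_hyp_eq [Fintype k] {D E : Divisor k K} {α β : PrincipalParts D}
    (hα : ∃ a, IsLift D E α a) (hβ : ∃ b, IsLift D E β b) :
    ∃ a b, IsLift D E α a ∧ IsLift D E β b ∧ ∀ {n : ℕ} (e : Module.Basis (Fin n) k (H0 E))
      {W : Type*} [Field W] [Algebra k W] (ev : K →ₐ[k] W), ev (Hyp D α β E) =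
        (∏ x : Fin n → k, (ev a - ∑ j, x j • ev (e j))) /
          ∏ x : Fin n → k, (ev b - ∑ j, x j • ev (e j)) := by
  refine ⟨hα.choose, hβ.choose, hα.choose_spec, hβ.choose_spec, fun {n} e W _ _ ev => ?_⟩
  rw [Hyp, dif_pos ⟨hα, hβ⟩]
  -- the sign turns the factors `ã + e` into `ã - e`
  let σ : (Fin n → k) ≃ H0 E := (Equiv.neg _).trans e.equivFun.symm.toEquiv
  have hσ : ∀ x, ev ((σ x : H0 E) : K) = -∑ j, x j • ev (e j) := fun x => by
    have h1 : ((σ x : H0 E) : K) = ∑ j, (-x) j • (e j : K) := by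
      change ((e.equivFun.symm (-x) : H0 E) : K) = _
      rw [Module.Basis.equivFun_symm_apply]
      simp
    rw [h1, map_sum, ← Finset.sum_neg_distrib]
    exact Finset.sum_congr rfl fun j _ => by rw [map_smul, Pi.neg_apply, neg_smul]
  rw [← finprod_comp_equiv σ, finprod_eq_prod_of_fintype, map_prod, ← Finset.prod_div_distrib]
  refine Finset.prod_congr rfl fun x _ => ?_
  rw [map_div₀, map_add, map_add, hσ, ← sub_eq_add_neg, ← sub_eq_add_neg]

end Lift

section Value

variable {F K : Type*} [Field F] [Field K] [Algebra F K]

theorem Place.val_eq_one_of_sub (P : Place F K) {f : K} {c : F} (hc : c ≠ 0)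
    (h : P.val (f - algebraMap F K c) < 1) : P.val f = 1 := by
  rw [← P.val_algebraMap hc] at h ⊢
  exact Valuation.map_eq_of_sub_lt _ h

theorem Place.val_div_sub_lt (P : Place F K) {f g : K} {c d : F} (hd : d ≠ 0)
    (hf : P.val (f - algebraMap F K c) < 1) (hg : P.val (g - algebraMap F K d) < 1) :
    P.val (f / g - algebraMap F K (c / d)) < 1 := by
  have hg1 := P.val_eq_one_of_sub hd hg
  have hd1 := P.val_algebraMap hd
  have hg0 : g ≠ 0 := fun h => by rw [h, map_zero] at hg1; exact zero_ne_one hg1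
  have hd0 : algebraMap F K d ≠ 0 := (map_ne_zero _).2 hd
  have h : f / g - algebraMap F K (c / d) = ((f - algebraMap F K c) * algebraMap F K d -
      algebraMap F K c * (g - algebraMap F K d)) / (g * algebraMap F K d) := by
    rw [map_div₀]
    field_simp
    ring
  rw [h, map_div₀, map_mul, hg1, hd1, one_mul, div_one]
  refine (P.val.map_sub _ _).trans_lt (max_lt ?_ ?_)
  · rwa [map_mul, hd1, mul_one]
  · rw [map_mul, mul_comm]
    exact mul_lt_one_of_lt_of_le hg (P.val_algebraMap_le_one c)

end Value

section Symbol

variable {k K W L : Type*} [Field k] [Fintype k] [Field K] [Algebra k K] [IsCurveFunctionField k K]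
  [Field W] [Algebra k W] [IsAlgClosed W] [Field L] [Algebra W L] [Algebra (W ⊗[k] K) L]
  [IsScalarTower W (W ⊗[k] K) L] [IsFractionRing (W ⊗[k] K) L] [IsCurveFunctionField W L]

/-- Sections of `O(E)` which approximate `-a` at the first `n` twists of a generic point exist and
are unique for `n = h⁰(O(E))`, and the value of their sum with `a` at the point itself is
given by the product of all `a - e` for `e` in `H⁰(O(E))`. The conditions form a Moore system for
the coefficients of the section, and the value is obtained from the linearized polynomial whose
roots are the values of all `e`. -/
theorem existsUnique_section {ξ : Place W L} {ev : K →ₐ[k] W}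
    (hev : ∀ (n : ℤ) (a : K), (twist k K n ξ).val
      (incl k K W L a - algebraMap W L ((frob k W ^ n) (ev a))) < 1)
    {E : Divisor k K} {n : ℕ} (e : Module.Basis (Fin n) k (H0 E)) :
    ∃ c : W, c ≠ 0 ∧ ∀ a : K, ∃ f : L,
      (f - incl k K W L a ∈ H0 (E.baseChange W L) ∧
        ∀ i ∈ Finset.range n, f ∈ (twist k K ((i : ℤ) + 1) ξ).stalk (-1)) ∧
      (∀ g : L, g - incl k K W L a ∈ H0 (E.baseChange W L) →
        (∀ i ∈ Finset.range n, g ∈ (twist k K ((i : ℤ) + 1) ξ).stalk (-1)) → g = f) ∧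
      ξ.val (f - algebraMap W L
        (c * ∏ x : Fin n → k, (ev a - ∑ j, x j • ev (e j)))) < 1 := by
  have hv : LinearIndependent k fun j => ev (e j) :=
    (e.linearIndependent.map' (H0 E).subtype (Submodule.ker_subtype _)).map'
      ev.toLinearMap (LinearMap.ker_eq_bot.2 ev.injective)
  obtain ⟨c, hc0, hc⟩ := exists_linearized_eq_prod hv
  refine ⟨(c 0)⁻¹, inv_ne_zero hc0, fun a => ?_⟩
  set M := Matrix.of fun i j : Fin n => ev (e j) ^ Fintype.card k ^ ((i : ℕ) + 1) with hM
  have hMu : IsUnit M := isUnit_moore_succ hv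
  -- `y m w` is the value at the `m`-th twist of `ξ` of the function `F w`
  let y : ℕ → (Fin n → W) → W := fun m w =>
    ev a ^ Fintype.card k ^ m + ∑ j, w j * ev (e j) ^ Fintype.card k ^ m
  let F : (Fin n → W) → L := fun w => incl k K W L a + ∑ j, w j • incl k K W L (e j)
  have hF : ∀ (m : ℕ) w, (twist k K (m : ℤ) ξ).val (F w - algebraMap W L (y m w)) < 1 :=
    fun m w => by
      rw [← Place.mem_stalk_neg_one]
      have h1 : F w - algebraMap W L (y m w) =
          (incl k K W L a - algebraMap W L ((frob k W ^ (m : ℤ)) (ev a))) + ∑ j, w j •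
            (incl k K W L (e j) - algebraMap W L ((frob k W ^ (m : ℤ)) (ev (e j)))) := by
        simp only [F, y, frob_pow_apply, Algebra.smul_def, mul_sub, Finset.sum_sub_distrib, map_add,
          map_sum, map_mul]
        ring
      rw [h1]
      refine add_mem ?_ (sum_mem fun j _ => Submodule.smul_mem _ _ ?_)
      · rw [Place.mem_stalk_neg_one]; exact hev m a
      · rw [Place.mem_stalk_neg_one]; exact hev m _
  have hF0 : ∀ (m : ℕ) w, F w ∈ (twist k K (m : ℤ) ξ).stalk (-1) ↔ y m w = 0 := fun m w => by
    rw [Place.mem_stalk_neg_one]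
    constructor
    · intro h
      refine (twist k K (m : ℤ) ξ).eq_of_val_sub_lt_one (hF m w) ?_
      rwa [map_zero, sub_zero]
    · intro h
      have := hF m w
      rwa [h, map_zero, sub_zero] at this
  have hsys : ∀ w, (∀ i ∈ Finset.range n, F w ∈ (twist k K ((i : ℤ) + 1) ξ).stalk (-1)) ↔
      M.mulVec w = fun i : Fin n => -(ev a ^ Fintype.card k ^ ((i : ℕ) + 1)) := fun w => by
    rw [funext_iff]
    have h1 : ∀ i : Fin n, M.mulVec w i = ∑ j, w j * ev (e j) ^ Fintype.card k ^ ((i : ℕ) + 1) :=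
      fun i => by
        change ∑ j, M i j * w j = _
        exact Finset.sum_congr rfl fun j _ => by rw [hM, Matrix.of_apply, mul_comm]
    constructor
    · intro h i
      have h2 := (hF0 ((i : ℕ) + 1) w).1 (by exact_mod_cast h i (Finset.mem_range.2 i.2))
      rw [h1, eq_neg_iff_add_eq_zero, add_comm]
      exact h2
    · intro h i hi
      have h2 := h ⟨i, Finset.mem_range.1 hi⟩
      rw [h1, eq_neg_iff_add_eq_zero, add_comm] at h2
      exact_mod_cast (hF0 (i + 1) w).2 h2
  have hFmem : ∀ w, F w - incl k K W L a ∈ H0 (E.baseChange W L) := fun w => by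
    simp only [F, add_sub_cancel_left]
    exact sum_mem fun j _ => Submodule.smul_mem _ _ (incl_mem_H0_baseChange.2 (e j).2)
  have hFsurj : ∀ g, g - incl k K W L a ∈ H0 (E.baseChange W L) → ∃ w, F w = g := fun g hg => by
    obtain ⟨w, hw⟩ := (Submodule.mem_span_range_iff_exists_fun W).1 (mem_span_incl_basis e hg)
    exact ⟨w, by simp only [F]; rw [hw]; ring⟩
  obtain ⟨w, hw⟩ := Matrix.mulVec_surjective_iff_isUnit.2 hMu
    fun i : Fin n => -(ev a ^ Fintype.card k ^ ((i : ℕ) + 1))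
  have hwF := (hsys w).2 hw
  refine ⟨F w, ⟨hFmem w, hwF⟩, fun g hg hgi => ?_, ?_⟩
  · obtain ⟨w', rfl⟩ := hFsurj g hg
    rw [Matrix.mulVec_injective_iff_isUnit.2 hMu (((hsys w').1 hgi).trans hw.symm)]
  · have h0 := hF 0 w
    -- the terms `m = 1, …, n` of this sum vanish by the choice of `w`
    have hy : ∑ i ∈ Finset.range (n + 1), c i * y i w =
        ∏ x : Fin n → k, (ev a - ∑ j, x j • ev (e j)) := by
      have hroot : ∀ j, ∑ i ∈ Finset.range (n + 1), c i * ev (e j) ^ Fintype.card k ^ i = 0 :=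
        fun j => by
          classical
          rw [hc, Finset.prod_eq_zero (Finset.mem_univ (Pi.single j 1))]
          simp [Pi.single_apply]
      rw [← hc]
      simp only [y, mul_add, Finset.sum_add_distrib, Finset.mul_sum]
      rw [Finset.sum_comm, add_eq_left]
      refine Finset.sum_eq_zero fun j _ => ?_
      rw [Finset.sum_congr rfl fun i _ => mul_left_comm (c i) (w j) _, ← Finset.mul_sum, hroot,
        mul_zero]
    rw [Finset.sum_range_succ', Finset.sum_eq_zero, zero_add] at hy
    · rw [← hy, inv_mul_cancel_left₀ hc0]
      rwa [Nat.cast_zero, twist_zero] at h0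
    · intro i hi
      have h1 := (hF0 (i + 1) w).1 (by exact_mod_cast hwF i hi)
      rw [h1, mul_zero]

/-- The liftings `ψ` of `α` in `Ψ` in terms of the functions `f ψ`, where `(f) = E - E₀ + S` with
`S` the sum of the first `n` twists of the generic point `ξ`. -/
theorem isPsiLift_iff {ξ : Place W L} (hξ : ∀ a : K, incl k K W L a ∈ ξ.O) {D E₀ : Divisor k K}
    {E : Divisor W L} (hD : 0 ≤ D) (hED : E.SupportedAway (D.baseChange W L))
    (hE₀ : E₀.SupportedAway D) {n : ℕ} {f : L} (hf0 : f ≠ 0)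
    (hf1 : IsOneOn (D.baseChange W L) f)
    (hf : ∀ Q : Place W L, E Q - (E₀.baseChange W L -
      ∑ i ∈ Finset.range n, Finsupp.single (twist k K ((i : ℤ) + 1) ξ) 1 : Divisor W L) Q = Q.ord f)
    {α : PrincipalParts D} {a : K} (ha : IsLift D E₀ α a) {ψ : L} :
    IsPsiLift D E α ψ ↔ f * ψ - incl k K W L a ∈ H0 (E₀.baseChange W L) ∧
      ∀ i ∈ Finset.range n, f * ψ ∈ (twist k K ((i : ℤ) + 1) ξ).stalk (-1) := by
  classical
  set S : Divisor W L :=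
    ∑ i ∈ Finset.range n, Finsupp.single (twist k K ((i : ℤ) + 1) ξ) 1 with hS
  have hSapply : ∀ Q, S Q = ∑ i ∈ Finset.range n,
      if twist k K ((i : ℤ) + 1) ξ = Q then 1 else 0 := fun Q => by
    rw [hS, Finsupp.finsetSum_apply]
    exact Finset.sum_congr rfl fun i _ => Finsupp.single_apply
  have hS1 : ∀ i ∈ Finset.range n, S (twist k K ((i : ℤ) + 1) ξ) = 1 := fun i hi => by
    rw [hSapply, Finset.sum_eq_single_of_mem i hi, if_pos rfl]
    intro j _ hji
    rw [if_neg fun h => hji ?_]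
    have := (twist_eq_twist_iff hξ).1 h
    omega
  have hS0 : ∀ Q, (∀ i ∈ Finset.range n, twist k K ((i : ℤ) + 1) ξ ≠ Q) → S Q = 0 := fun Q hQ => by
    rw [hSapply]
    exact Finset.sum_eq_zero fun i hi => if_neg (hQ i hi)
  have hSnonneg : ∀ Q, 0 ≤ S Q := fun Q => by
    rw [hSapply]
    exact Finset.sum_nonneg fun i _ => by split_ifs <;> norm_num
  have hD' : 0 ≤ D.baseChange W L := Divisor.baseChange_nonneg hD
  have hmem : ψ ∈ H0 (E + D.baseChange W L) ↔
      ∀ Q : Place W L, f * ψ ∈ Q.stalk (E₀.baseChange W L Q - S Q + D.baseChange W L Q) := by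
    rw [mem_H0]
    refine forall_congr' fun Q => ?_
    rw [Q.mul_mem_stalk_iff hf0, ← hf Q, Finsupp.add_apply, Finsupp.sub_apply]
    exact iff_of_eq (by congr 2; ring)
  -- near `D`, the functions `ψ` and `f ψ` have the same principal parts
  have hsub : ψ ∈ H0 (E + D.baseChange W L) → ∀ Q ∈ (D.baseChange W L).support,
      f * ψ - ψ ∈ Q.stalk 0 := fun hψ Q hQ => by
    have h1 := mem_H0.1 hψ Q
    rw [Finsupp.add_apply, hED.apply_eq_zero hQ, zero_add] at h1
    have h2 := Q.mul_mem_stalk (hf1 Q hQ) h1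
    rw [neg_add_cancel] at h2
    convert h2 using 1
    ring
  have hE₀' : ∀ Q ∈ (D.baseChange W L).support, E₀.baseChange W L Q = 0 := fun Q hQ => by
    obtain ⟨P, hP, hQP⟩ := Divisor.mem_support_baseChange.1 hQ
    rw [hQP.baseChange_apply, hE₀.apply_eq_zero hP]
  have ha' := incl_mem_H0_baseChange (W := W) (L := L).2 ha.1
  rw [Divisor.baseChange_add] at ha'
  constructor
  · rintro ⟨⟨hψ, -⟩, hlift⟩
    have h1 := hmem.1 hψ
    refine ⟨mem_H0.2 fun Q => ?_, fun i hi => ?_⟩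
    · by_cases hQ : Q ∈ (D.baseChange W L).support
      · obtain ⟨P, hP, hQP⟩ := Divisor.mem_support_baseChange.1 hQ
        rw [hE₀' Q hQ]
        have h2 := hlift P hP Q hQP a (ha.2 P hP)
        rw [Place.val_le_one_iff, ← Place.mem_stalk_zero] at h2
        convert add_mem (hsub hψ Q hQ) h2 using 1
        ring
      · have h2 := h1 Q
        have h3 := mem_H0.1 ha' Q
        rw [Finsupp.notMem_support_iff.1 hQ, add_zero] at h2
        rw [Finsupp.add_apply, Finsupp.notMem_support_iff.1 hQ, add_zero] at h3
        exact sub_mem (Q.stalk_mono (by have := hSnonneg Q; omega) h2) h3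
    · have h2 := h1 (twist k K ((i : ℤ) + 1) ξ)
      have hgen := forall_incl_mem_twist hξ ((i : ℤ) + 1)
      rwa [hS1 i hi, Divisor.baseChange_apply_of_forall_mem hgen,
        Divisor.baseChange_apply_of_forall_mem hgen] at h2
  · rintro ⟨hdiff, hvan⟩
    have hψ : ψ ∈ H0 (E + D.baseChange W L) := hmem.2 fun Q => by
      by_cases hQ : ∃ i ∈ Finset.range n, twist k K ((i : ℤ) + 1) ξ = Q
      · obtain ⟨i, hi, rfl⟩ := hQ
        have hgen := forall_incl_mem_twist hξ ((i : ℤ) + 1)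
        rw [hS1 i hi, Divisor.baseChange_apply_of_forall_mem hgen,
          Divisor.baseChange_apply_of_forall_mem hgen]
        exact hvan i hi
      · push Not at hQ
        rw [hS0 Q hQ, sub_zero]
        have h1 := mem_H0.1 ha' Q
        rw [Finsupp.add_apply] at h1
        have h2 := add_mem (Q.stalk_mono (by have := hD' Q; simp at this; omega)
          (mem_H0.1 hdiff Q)) h1
        rwa [sub_add_cancel] at h2
    have hlift : ∀ P ∈ D.support, ∀ Q : Place W L, Q.LiesOver P →
        ∀ b : K, (P.stalk 0).mkQ b = α.1 P → ψ - incl k K W L b ∈ Q.stalk 0 :=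
      fun P hP Q hQP b hb => by
        have hQ : Q ∈ (D.baseChange W L).support :=
          Divisor.mem_support_baseChange.2 ⟨P, hP, hQP⟩
        have h1 := mem_H0.1 hdiff Q
        rw [hE₀' Q hQ] at h1
        have h2 : a - b ∈ P.stalk 0 :=
          (Submodule.Quotient.eq _).1 ((ha.2 P hP).trans hb.symm)
        rw [← hQP.incl_mem_stalk_iff] at h2
        convert add_mem (sub_mem h1 (hsub hψ Q hQ)) h2 using 1
        rw [map_sub]
        ring
    refine ⟨⟨hψ, fun Q hQ => ?_⟩, fun P hP Q hQP b hb => ?_⟩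
    · -- the points over `P` are permuted by the twist, and `ψ - a` is regular at each of them
      obtain ⟨P, hP, hQP⟩ := Divisor.mem_support_baseChange.1 hQ
      have hQP' : (twist k K (-1) Q).LiesOver P := liesOver_twist_iff.2 hQP
      have h1 := hlift P hP Q hQP a (ha.2 P hP)
      have h2 := hlift P hP _ hQP' a (ha.2 P hP)
      rw [Place.mem_stalk, ← val_twist (k := k) (K := K) 1, twist_twist_neg, map_sub, twistFun_incl,
        ← Place.mem_stalk] at h2
      rw [Place.val_le_one_iff, ← Place.mem_stalk_zero]
      convert sub_mem h1 h2 using 1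
      ring
    · rw [Place.val_le_one_iff, ← Place.mem_stalk_zero]
      exact hlift P hP Q hQP b hb

end Symbol

/-! ### The symbol of a shtuka with a generic basepoint -/

theorem sum_Icc_one_eq_sum_range {M : Type*} [AddCommMonoid M] (f : ℤ → M) (n : ℕ) :
    ∑ i ∈ Finset.Icc (1 : ℤ) n, f i = ∑ i ∈ Finset.range n, f ((i : ℤ) + 1) := by
  refine Finset.sum_nbij' (fun i => (i - 1).toNat) (fun i => (i : ℤ) + 1) ?_ ?_ ?_ ?_ ?_
  · intro i hi
    rw [Finset.mem_Icc] at hi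
    rw [Finset.mem_range]
    omega
  · intro i hi
    rw [Finset.mem_range] at hi
    rw [Finset.mem_Icc]
    omega
  · intro i hi
    rw [Finset.mem_Icc] at hi
    omega
  · intro i _
    omega
  · intro i hi
    rw [Finset.mem_Icc] at hi
    congr 1
    omega

section Generic

variable {k K W L : Type*} [Field k] [Fintype k] [Field K] [Algebra k K] [IsCurveFunctionField k K]
  [Field W] [Algebra k W] [IsAlgClosed W] [Field L] [Algebra W L] [Algebra (W ⊗[k] K) L]
  [IsScalarTower W (W ⊗[k] K) L] [IsFractionRing (W ⊗[k] K) L] [IsCurveFunctionField W L]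

/-- For a shtuka with zero `ξ⁽ⁿ⁺¹⁾`, the sum of `E` and of the first `n` twists of `ξ` is equivalent
to its twist. -/
theorem IsShtuka.exists_equivOn {ξ : Place W L} (hξ : ∀ a : K, incl k K W L a ∈ ξ.O)
    {D : Divisor k K} {E : Divisor W L} {n : ℕ} (hE : IsShtuka D ξ (twist k K ((n : ℤ) + 1) ξ) E) :
    ∃ E₀ : Divisor k K, E₀.SupportedAway D ∧ EquivOn (D.baseChange W L) E (E₀.baseChange W L -
      ∑ i ∈ Finset.range n, Finsupp.single (twist k K ((i : ℤ) + 1) ξ) 1) := by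
  classical
  set S : Divisor W L :=
    ∑ i ∈ Finset.range n, Finsupp.single (twist k K ((i : ℤ) + 1) ξ) 1 with hS
  have htel : S - twistDiv k K 1 S =
      Finsupp.single (twist k K 1 ξ) 1 - Finsupp.single (twist k K ((n : ℤ) + 1) ξ) 1 := by
    have h1 := Finset.sum_range_sub'
      (fun i : ℕ => (Finsupp.single (twist k K ((i : ℤ) + 1) ξ) 1 : Divisor W L)) n
    rw [Nat.cast_zero, zero_add] at h1
    rw [hS, twistDiv_sum, ← Finset.sum_sub_distrib, ← h1]
    refine Finset.sum_congr rfl fun i _ => ?_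
    rw [twistDiv_single, ← twist_add, Nat.cast_succ, add_comm (1 : ℤ)]
  have haway : (E + S).SupportedAway (D.baseChange W L) := by
    rw [Divisor.SupportedAway, Finset.disjoint_right]
    intro Q hQ
    rw [Finsupp.notMem_support_iff, Finsupp.add_apply, hE.supportedAway.apply_eq_zero hQ, zero_add,
      hS, Finsupp.finsetSum_apply]
    refine Finset.sum_eq_zero fun i _ => Finsupp.single_eq_of_ne ?_
    rintro rfl
    exact Finsupp.mem_support_iff.1 hQ
      (Divisor.baseChange_apply_of_forall_mem (forall_incl_mem_twist hξ _) D)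
  obtain ⟨u, hu0, hu1, hu⟩ := hE.equivOn
  obtain ⟨E₀, hE₀, f, hf0, hf1, hf⟩ := exists_baseChange_equivOn hE.effective hE.ne_zero haway
    ⟨u, hu0, hu1, fun Q => by
      have h2 := DFunLike.congr_fun htel Q
      have h3 := hu Q
      rw [Finsupp.sub_apply, Finsupp.sub_apply] at h2 h3
      rw [twistDiv_add, Finsupp.sub_apply, Finsupp.add_apply, Finsupp.add_apply,
        Finsupp.zero_apply, ← h3]
      linarith⟩
  refine ⟨E₀, hE₀, f, hf0, hf1, fun Q => ?_⟩
  rw [← hf Q, Finsupp.sub_apply, Finsupp.add_apply]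
  ring

theorem deg_eq_of_equivOn {ξ : Place W L} {D E₀ : Divisor k K} {E : Divisor W L} {n : ℕ}
    (hE : EquivOn (D.baseChange W L) E (E₀.baseChange W L -
      ∑ i ∈ Finset.range n, Finsupp.single (twist k K ((i : ℤ) + 1) ξ) 1)) :
    E₀.deg = E.deg + n := by
  obtain ⟨f, -, -, hf⟩ := hE
  have h1 : E - (E₀.baseChange W L -
      ∑ i ∈ Finset.range n, Finsupp.single (twist k K ((i : ℤ) + 1) ξ) 1) = Divisor.div f := by
    ext Q
    rw [Finsupp.sub_apply, hf, Divisor.div_apply]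
  have h2 := congrArg Divisor.deg h1
  simp only [Divisor.deg_sub, Divisor.deg_sum, Divisor.deg_single, Place.degree_eq_one, deg_div,
    Divisor.deg_baseChange, Nat.cast_one, mul_one, Finset.sum_const, Finset.card_range,
    nsmul_eq_mul] at h2
  linarith

/-- If `E` is equivalent to `E₀` minus the first `n` twists of the generic point `ξ`, where
`n = h⁰(O(E₀))`, the symbol is well defined and is the value of a hypergeometric ratio. -/
theorem symbol_of_equivOn {ξ : Place W L} (hξ : ∀ a : K, incl k K W L a ∈ ξ.O)
    {D E₀ : Divisor k K} {E : Divisor W L} (hD : 0 ≤ D)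
    (hED : E.SupportedAway (D.baseChange W L)) (hE₀ : E₀.SupportedAway D)
    (hdeg : 2 * (genus k K : ℤ) - 2 < E₀.deg) {n : ℕ} (hn : h0 E₀ = n)
    (hE : EquivOn (D.baseChange W L) E (E₀.baseChange W L -
      ∑ i ∈ Finset.range n, Finsupp.single (twist k K ((i : ℤ) + 1) ξ) 1)) :
    SymbolWellDefined D ξ E ∧ ∀ (η : Place W L) (α β : PrincipalParts D), α ≠ 0 → β ≠ 0 →
      catalanDrinfeld D ξ η E α β = ξ.eval (incl k K W L (Hyp D α β E₀)) := by
  obtain ⟨f, hf0, hf1, hf⟩ := hE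
  obtain ⟨ev', hevk, hev⟩ := exists_eval_incl (k := k) hξ
  let ev : K →ₐ[k] W := { ev' with commutes' := hevk }
  let e : Module.Basis (Fin n) k (H0 E₀) := Module.finBasisOfFinrankEq k (H0 E₀) hn
  obtain ⟨c, hc0, hc⟩ := existsUnique_section (ξ := ξ) (ev := ev) hev e
  have hlift : ∀ α : PrincipalParts D, ∃ a, IsLift D E₀ α a := exists_isLift hD hE₀ hdeg
  have hiff : ∀ {α : PrincipalParts D} {a : K}, IsLift D E₀ α a → ∀ {ψ : L},
      (IsPsiLift D E α ψ ↔ f * ψ - incl k K W L a ∈ H0 (E₀.baseChange W L) ∧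
        ∀ i ∈ Finset.range n, f * ψ ∈ (twist k K ((i : ℤ) + 1) ξ).stalk (-1)) :=
    fun {_ _} ha {_} => isPsiLift_iff hξ hD hED hE₀ hf0 hf1 hf ha
  have huniq : ∀ α : PrincipalParts D, ∃! ψ, IsPsiLift D E α ψ := fun α => by
    obtain ⟨a, ha⟩ := hlift α
    obtain ⟨F, hF, hFu, -⟩ := hc a
    refine ⟨f⁻¹ * F, (hiff ha).2 (by rwa [mul_inv_cancel_left₀ hf0]), fun ψ hψ => ?_⟩
    rw [← hFu _ ((hiff ha).1 hψ).1 ((hiff ha).1 hψ).2, inv_mul_cancel_left₀ hf0]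
  have hval : ∀ {α : PrincipalParts D} {a : K}, IsLift D E₀ α a →
      ξ.val (f * psi D E α - algebraMap W L
        (c * ∏ x : Fin n → k, (ev a - ∑ j, x j • ev (e j)))) < 1 := fun {α a} ha => by
    have hψ : IsPsiLift D E α (psi D E α) := by
      have hex := (huniq α).exists
      rw [psi, dif_pos hex]
      exact hex.choose_spec
    obtain ⟨F, -, hFu, hFv⟩ := hc a
    rwa [hFu _ ((hiff ha).1 hψ).1 ((hiff ha).1 hψ).2]
  have hne : ∀ {α : PrincipalParts D} {a : K}, IsLift D E₀ α a → α ≠ 0 →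
      c * ∏ x : Fin n → k, (ev a - ∑ j, x j • ev (e j)) ≠ 0 := fun {α a} ha hα => by
    refine mul_ne_zero hc0 (Finset.prod_ne_zero_iff.2 fun x _ h => ha.notMem_H0 hE₀ hα ?_)
    have h1 : a = ∑ j, x j • (e j : K) := by
      refine (ev : K →+* W).injective ?_
      change ev a = ev _
      rw [sub_eq_zero.1 h, map_sum]
      exact Finset.sum_congr rfl fun j _ => (map_smul ev _ _).symm
    rw [h1]
    exact sum_mem fun j _ => Submodule.smul_mem _ _ (e j).2
  have hquot : ∀ α β : PrincipalParts D,
      psi D E α / psi D E β = (f * psi D E α) / (f * psi D E β) := fun α β =>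
    (mul_div_mul_left _ _ hf0).symm
  refine ⟨⟨huniq, fun α β hα hβ => ?_⟩, fun η α β hα hβ => ?_⟩
  · obtain ⟨a, ha⟩ := hlift α
    obtain ⟨b, hb⟩ := hlift β
    rw [hquot]
    exact ξ.val_eq_one_of_sub (div_ne_zero (hne ha hα) (hne hb hβ))
      (ξ.val_div_sub_lt (hne hb hβ) (hval ha) (hval hb))
  · obtain ⟨a, b, ha, hb, hHyp⟩ := exists_map_hyp_eq (hlift α) (hlift β)
    have h1 := hev 0 (Hyp D α β E₀)
    rw [twist_zero, zpow_zero] at h1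
    have h2 : ev' (Hyp D α β E₀) = _ := hHyp e ev
    rw [catalanDrinfeld, hquot, ξ.eval_eq (ξ.val_div_sub_lt (hne hb hβ) (hval ha) (hval hb)),
      ξ.eval_eq h1, AlgEquiv.one_apply, h2, mul_div_mul_left _ _ hc0]

end Generic

end RankOneShtuka

end

open RankOneShtuka in
theorem proposition5p3 {k K W L : Type*} [Field k] [Fintype k] [Field K] [Algebra k K]
    [IsCurveFunctionField k K] [Field W] [Algebra k W] [IsAlgClosed W]
    [Field L] [Algebra W L] [Algebra (W ⊗[k] K) L] [IsScalarTower W (W ⊗[k] K) L]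
    [IsFractionRing (W ⊗[k] K) L]
    (ξ : Place W L) (hξ : IsGeneric k K ξ) (N : ℤ) (hN : (genus k K : ℤ) < N)
    (D : Divisor k K) (E : Divisor W L) (hE : IsShtuka D ξ (twist k K N ξ) E) :
    IsNondegenerate D ξ (twist k K N ξ) E ∧
    SymbolWellDefined D ξ E ∧
    (∃ E₀ : Divisor k K, E₀.SupportedAway D ∧
      EquivOn (D.baseChange W L) E
        (E₀.baseChange W L - ∑ i ∈ Finset.Icc 1 (N - 1), Finsupp.single (twist k K i ξ) 1)) ∧
    ∀ E₀ : Divisor k K, E₀.SupportedAway D →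
      EquivOn (D.baseChange W L) E
        (E₀.baseChange W L - ∑ i ∈ Finset.Icc 1 (N - 1), Finsupp.single (twist k K i ξ) 1) →
      2 * (genus k K : ℤ) - 2 < E₀.deg ∧
      ∀ α β : PrincipalParts D, α ≠ 0 → β ≠ 0 →
        catalanDrinfeld D ξ (twist k K N ξ) E α β =
          ξ.eval (incl k K W L (Hyp D α β E₀)) := by
  have hL := isCurveFunctionField_baseChange k K W L
  have hmem := hξ.incl_mem
  obtain ⟨n, rfl⟩ : ∃ n : ℕ, N = (n : ℤ) + 1 := ⟨(N - 1).toNat, by omega⟩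
  simp only [add_sub_cancel_right,
    sum_Icc_one_eq_sum_range (fun i => (Finsupp.single (twist k K i ξ) 1 : Divisor W L)) n]
  have key : ∀ E₀ : Divisor k K, EquivOn (D.baseChange W L) E (E₀.baseChange W L -
      ∑ i ∈ Finset.range n, Finsupp.single (twist k K ((i : ℤ) + 1) ξ) 1) →
      2 * (genus k K : ℤ) - 2 < E₀.deg ∧ h0 E₀ = n := fun E₀ hE₀ => by
    have h1 := deg_eq_of_equivOn hE₀
    rw [hE.deg_eq] at h1
    have h2 : 2 * (genus k K : ℤ) - 2 < E₀.deg := by omega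
    have h3 := h0_eq h2
    exact ⟨h2, by omega⟩
  obtain ⟨E₁, hE₁, hEq₁⟩ := hE.exists_equivOn hmem
  refine ⟨fun i _ hi h => ?_, ?_, ⟨E₁, hE₁, hEq₁⟩, fun E₀ hE₀ hEq => ?_⟩
  · have := (twist_eq_twist_iff hmem).1 h
    omega
  · exact (symbol_of_equivOn hmem hE.effective hE.supportedAway hE₁ (key E₁ hEq₁).1
      (key E₁ hEq₁).2 hEq₁).1
  · exact ⟨(key E₀ hEq).1, (symbol_of_equivOn hmem hE.effective hE.supportedAway hE₀
      (key E₀ hEq).1 (key E₀ hEq).2 hEq).2 _⟩
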